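/- \textbf{Setting.} A parity game $\mathcal G$ is a finite directed graph $(V,E)$ without self-loops in which every vertex has a successor, whose vertices are partitioned between the players Even ($\mathsf E$) and Odd ($\mathsf O$) and carry priorities $\pi(v)\ge 1$. A play is an infinite path; it is won by the player who has the parity of the highest priority occurring infinitely often. A strategy of a player $\wp$ from $v$ maps each prefix of a play that starts in $v$ and ends in a vertex of $\wp$ to a successor of that vertex. A set $G\subseteq V$ induces a subgame if every $v\in G$ has a successor in $G$. In a subgame $G$: the winning region of $\wp$ is the set of vertices from which $\wp$ has a strategy agreeing only with plays won by $\wp$; a dominion of $\wp$ is a set $D\subseteq G$ such that from each $v\in D$ player $\wp$ has a winning strategy agreeing only with plays that stay in $D$; $\mathrm{Attr}_\wp(S,G)$ is the set of vertices from which $\wp$ has a strategy agreeing only with plays that reach $S$; and $S\subseteq G$ is $\wp$-closed if $\mathrm{Attr}_{\bar\wp}(G\setminus S,G)=G\setminus S$, where $\bar\wp$ is the opponent of $\wp$. We write $\log$ for $\log_2$. \textbf{Algorithm.} For $\wp\in\{\mathsf E,\mathsf O\}$, $d$ even if $\wp=\mathsf E$ and odd if $\wp=\mathsf O$, and $p,q\in\mathbb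 N$, the procedure $\mathrm{Solve}_\wp(G,d,p,q)$ returns $G$ if $G=\emptyset$ or $q\le 1$ (or $d=0$, which for the inputs below implies $G=\emptyset$). Otherwise it computes successively $G_1:=\mathrm{Solve}_\wp(G,d,p,\lfloor q/2\rfloor)$, $N:=\{v\in G_1:\pi(v)=d\}$, $H:=G_1\setminus\mathrm{Attr}_\wp(N,G_1)$, $W:=\mathrm{Solve}_{\bar\wp}(H,d-1,q,p)$, $G_2:=G_1\setminus\mathrm{Attr}_{\bar\wp}(W,G_1)$, and returns $\mathrm{Solve}_\wp(G_2,d,p,\lfloor q/2\rfloor)$. \textbf{Theorem.} (1) Let $G$ induce a subgame, let $d$ be at least every priority in $G$, and let $\wp$ be the player with the parity of $d$. (a) For all $p,q\in\mathbb N$ the set $\mathrm{Solve}_\wp(G,d,p,q)$ is $\wp$-closed in $G$, contains every dominion of $\wp$ in $G$ of size at most $p$, and is disjoint from every dominion of $\bar\wp$ in $G$ of size at most $q$. (b) $\mathrm{Solve}_\wp(G,d,|G|,|G|)$ is the winning region of $\wp$ in $G$, and its complement in $G$ is the winning region of $\bar\wp$ in $G$. (c) If $p,q\ge1$ and $\ell=\lfloor\log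 p\rfloor+\lfloor\log q\rfloor$, then the execution of $\mathrm{Solve}_\wp(G,d,p,q)$ performs at most $2^{\ell+1}\binom{d+\ell}{\ell}-1$ calls of the two procedures (the main call included). (2) The algorithm has an implementation on a unit-cost random access machine with words of $O(\log(n+d))$ bits such that the following holds, with a constant $C$ independent of the game. Given a parity game with $n>0$ vertices $\{0,\dots,n-1\}$ (hence $n\ge2$), $m$ edges (given as a list) and priorities at most $d$, the implementation performs exactly the calls that occur in the execution of $\mathrm{Solve}_\wp(V,d,n,n)$, in the same order and with the same arguments, where $\wp$ has the parity of $d$; it outputs the set returned by $\mathrm{Solve}_\wp(V,d,n,n)$; it uses at most $C(m+n\log n)$ words of memory; and it takes at most $$C\cdot m\cdot n^{4.9+2\log\left(1+\frac{d}{2\log n}\right)}$$ steps. Moreover, this last bound is $n^{O\left(1+\log\left(1+\frac d{\log n}\right)\right)}$ for all such $n,m,d$; and for every $c>0$ it is $n^{O\left(\log\left(1+\frac d{\log n}\right)\right)}$ in the range $d\ge c\log n$, where the constant hidden in the exponent may depend on $c$. -/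

import Mathlib

/-- The two players. -/
inductive Player where
  | even
  | odd
  deriving DecidableEq

namespace Player

/-- The opponent. -/
def opp : Player → Player
  | even => odd
  | odd => even

/-- The player that likes the priority `k`: Even if `k` is even, Odd if `k` is odd. -/
def ofParity (k : ℕ) : Player := if k % 2 = 0 then even else odd

/-- Numerical code of a player (used for machine inputs). -/
def code : Player → ℕ
  | even => 0
  | odd => 1

end Player

/-- A parity game on the vertex set `V`: vertices are owned by Even or Odd and carry positive
priorities, every vertex has a successor, and there are no self-loops. -/
structure ParityGame (V : Type*) where
  owner : V → Player
  edges : Finset (V × V)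
  prio : V → ℕ
  prio_pos : ∀ v, 1 ≤ prio v
  no_loop : ∀ v, (v, v) ∉ edges
  total : ∀ v, ∃ w, (v, w) ∈ edges

namespace ParityGame

variable {V : Type*}

/-- The set `G` induces a subgame: every vertex of `G` has a successor in `G`. -/
def IsSubgame (𝒢 : ParityGame V) (G : Finset V) : Prop :=
  ∀ v ∈ G, ∃ w ∈ G, (v, w) ∈ 𝒢.edges

/-- An infinite path in the subgame `G`. -/
def IsPlay (𝒢 : ParityGame V) (G : Finset V) (ρ : ℕ → V) : Prop :=
  ∀ i, ρ i ∈ G ∧ (ρ i, ρ (i + 1)) ∈ 𝒢.edges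

/-- The play `ρ` is winning for `P`: the highest priority that occurs infinitely often on `ρ`
has the parity of `P`. -/
def WinsPlay (𝒢 : ParityGame V) (P : Player) (ρ : ℕ → V) : Prop :=
  ∃ k, IsGreatest {j | ∃ᶠ i in Filter.atTop, 𝒢.prio (ρ i) = j} k ∧ Player.ofParity k = P

/-- The prefix `ρ[0], …, ρ[i]` (of length `i + 1`). -/
def prefixOf (ρ : ℕ → V) (i : ℕ) : List V := (List.range (i + 1)).map ρ

/-- `σ` is a strategy for `P` from `v` in the subgame `G`: on each prefix of a play from `v` that
ends in a vertex of `P`, it returns a successor (in `G`) of this last vertex. Its values on other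
lists are irrelevant. -/
def IsStrategy (𝒢 : ParityGame V) (G : Finset V) (P : Player) (v : V) (σ : List V → V) : Prop :=
  ∀ ρ : ℕ → V, 𝒢.IsPlay G ρ → ρ 0 = v → ∀ i, 𝒢.owner (ρ i) = P →
    σ (prefixOf ρ i) ∈ G ∧ (ρ i, σ (prefixOf ρ i)) ∈ 𝒢.edges

/-- The strategy `σ` for `P` from `v` agrees with the play `ρ`. -/
def Agrees (𝒢 : ParityGame V) (P : Player) (v : V) (σ : List V → V) (ρ : ℕ → V) : Prop :=
  ρ 0 = v ∧ ∀ i, 𝒢.owner (ρ i) = P → ρ (i + 1) = σ (prefixOf ρ i)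

/-- From `v`, the player `P` has a strategy in the subgame `G` that agrees only with plays
satisfying `Φ`. -/
def CanForce (𝒢 : ParityGame V) (G : Finset V) (P : Player) (v : V) (Φ : (ℕ → V) → Prop) :
    Prop :=
  ∃ σ : List V → V, 𝒢.IsStrategy G P v σ ∧
    ∀ ρ : ℕ → V, 𝒢.IsPlay G ρ → 𝒢.Agrees P v σ ρ → Φ ρ

open Classical in
/-- The winning region of `P` in the subgame `G`. -/
noncomputable def winRegion (𝒢 : ParityGame V) (P : Player) (G : Finset V) : Finset V :=
  G.filter fun v => 𝒢.CanForce G P v fun ρ => 𝒢.WinsPlay P ρ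

/-- `D` is a dominion of `P` in the subgame `G`. -/
def IsDominion (𝒢 : ParityGame V) (P : Player) (G D : Finset V) : Prop :=
  D ⊆ G ∧ ∀ v ∈ D, 𝒢.CanForce G P v fun ρ => 𝒢.WinsPlay P ρ ∧ ∀ i, ρ i ∈ D

open Classical in
/-- The `P`-attractor of `S` in the subgame `G`. -/
noncomputable def attr (𝒢 : ParityGame V) (P : Player) (S G : Finset V) : Finset V :=
  G.filter fun v => 𝒢.CanForce G P v fun ρ => ∃ i, ρ i ∈ S

/-- `S` is `P`-closed in the subgame `G`. -/
def IsClosedIn [DecidableEq V] (𝒢 : ParityGame V) (P : Player) (S G : Finset V) : Prop :=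
  S ⊆ G ∧ 𝒢.attr P.opp (G \ S) G = G \ S

/-- The algorithm `Solve_P(G, d, p, q)`, where `p` is the precision of the player `P` and `q` is
the precision of the opponent: `solve even G d pE pO` is `Solve_E(G, d, pE, pO)` and
`solve odd G d pO pE` is `Solve_O(G, d, pO, pE)`. It is meant for `d` of the parity of `P` that
bounds the priorities in `G`; then `d = 0` implies that `G` is empty, and the algorithm returns
`G` immediately. -/
noncomputable def solve [DecidableEq V] (𝒢 : ParityGame V) :
    Player → Finset V → ℕ → ℕ → ℕ → Finset V
  | _, G, 0, _, _ => G
  | P, G, d + 1, p, q =>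
    if _h : G = ∅ ∨ q ≤ 1 then G
    else
      let G₁ := solve 𝒢 P G (d + 1) p (q / 2)
      let N := G₁.filter fun v => 𝒢.prio v = d + 1
      let H := G₁ \ 𝒢.attr P N G₁
      let W := solve 𝒢 P.opp H d q p
      let G₂ := G₁ \ 𝒢.attr P.opp W G₁
      solve 𝒢 P G₂ (d + 1) p (q / 2)
termination_by _ _ d _ q => (d, q)
decreasing_by all_goals simp_wf; omega

/-- The arguments of one call to the procedure `solve`. -/
structure Call (V : Type*) where
  player : Player
  set : Finset V
  maxPrio : ℕ
  ownPrec : ℕ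
  oppPrec : ℕ

/-- The list of all calls (in the order in which they are started, the main call being the first
one) that are performed during the execution of `solve 𝒢 P G d p q`. -/
noncomputable def calls [DecidableEq V] (𝒢 : ParityGame V) :
    Player → Finset V → ℕ → ℕ → ℕ → List (Call V)
  | P, G, 0, p, q => [⟨P, G, 0, p, q⟩]
  | P, G, d + 1, p, q =>
    if _h : G = ∅ ∨ q ≤ 1 then [⟨P, G, d + 1, p, q⟩]
    else
      let G₁ := 𝒢.solve P G (d + 1) p (q / 2)
      let N := G₁.filter fun v => 𝒢.prio v = d + 1
      let H := G₁ \ 𝒢.attr P N G₁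
      let W := 𝒢.solve P.opp H d q p
      let G₂ := G₁ \ 𝒢.attr P.opp W G₁
      ⟨P, G, d + 1, p, q⟩ ::
        (calls 𝒢 P G (d + 1) p (q / 2) ++
          (calls 𝒢 P.opp H d q p ++ calls 𝒢 P G₂ (d + 1) p (q / 2)))
termination_by _ _ d _ q => (d, q)
decreasing_by all_goals simp_wf; omega

end ParityGame

/-! A structured random access machine with unit costs: finitely many registers and finitely many
arrays, all holding natural numbers below a word bound `W`; every array has `M` cells. -/

namespace Ram

/-- The content of the registers and of the arrays. -/
structure Store where
  reg : ℕ → ℕ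
  arr : ℕ → ℕ → ℕ

/-- Expressions: constants, registers, array cells `a[e]`, arithmetic, comparisons. -/
inductive Expr where
  | const (k : ℕ)
  | reg (r : ℕ)
  | read (a : ℕ) (e : Expr)
  | add (e f : Expr)
  | sub (e f : Expr)
  | mul (e f : Expr)
  | div (e f : Expr)
  | lt (e f : Expr)
  | eq (e f : Expr)

namespace Expr

/-- The value of an expression; comparisons give `1` (true) or `0` (false), subtraction is
truncated, division is integer division. -/
def val (s : Store) : Expr → ℕ
  | const k => k
  | reg r => s.reg r
  | read a e => s.arr a (e.val s)
  | add e f => e.val s + f.val s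
  | sub e f => e.val s - f.val s
  | mul e f => e.val s * f.val s
  | div e f => e.val s / f.val s
  | lt e f => if e.val s < f.val s then 1 else 0
  | eq e f => if e.val s = f.val s then 1 else 0

/-- The evaluation of the expression only produces words below `W` and only accesses array cells
with index below `M`. -/
def Safe (M W : ℕ) (s : Store) : Expr → Prop
  | const k => k < W
  | reg r => s.reg r < W
  | read a e => e.Safe M W s ∧ e.val s < M ∧ s.arr a (e.val s) < W
  | add e f => e.Safe M W s ∧ f.Safe M W s ∧ e.val s + f.val s < W
  | sub e f => e.Safe M W s ∧ f.Safe M W s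
  | mul e f => e.Safe M W s ∧ f.Safe M W s ∧ e.val s * f.val s < W
  | div e f => e.Safe M W s ∧ f.Safe M W s
  | lt e f => e.Safe M W s ∧ f.Safe M W s ∧ 1 < W
  | eq e f => e.Safe M W s ∧ f.Safe M W s ∧ 1 < W

/-- The number of elementary operations in an expression. -/
def cost : Expr → ℕ
  | const _ => 1
  | reg _ => 1
  | read _ e => e.cost + 1
  | add e f => e.cost + f.cost + 1
  | sub e f => e.cost + f.cost + 1
  | mul e f => e.cost + f.cost + 1
  | div e f => e.cost + f.cost + 1
  | lt e f => e.cost + f.cost + 1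
  | eq e f => e.cost + f.cost + 1

/-- Only registers and arrays with number below `k` are mentioned. -/
def Within (k : ℕ) : Expr → Prop
  | const _ => True
  | reg r => r < k
  | read a e => a < k ∧ e.Within k
  | add e f => e.Within k ∧ f.Within k
  | sub e f => e.Within k ∧ f.Within k
  | mul e f => e.Within k ∧ f.Within k
  | div e f => e.Within k ∧ f.Within k
  | lt e f => e.Within k ∧ f.Within k
  | eq e f => e.Within k ∧ f.Within k

end Expr

/-- Programs. The command `mark` has no effect on the store; the stores at which it is executed
are listed in the run. -/
inductive Prog where
  | set (r : ℕ) (e : Expr)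
  | write (a : ℕ) (i e : Expr)
  | seq (c₁ c₂ : Prog)
  | ite (e : Expr) (c₁ c₂ : Prog)
  | while (e : Expr) (c : Prog)
  | mark

/-- Only registers and arrays with number below `k` are mentioned. A program with this property
running with arrays of `M` cells has `k + k * M` words of memory. -/
def Prog.Within (k : ℕ) : Prog → Prop
  | set r e => r < k ∧ e.Within k
  | write a i e => a < k ∧ i.Within k ∧ e.Within k
  | seq c₁ c₂ => c₁.Within k ∧ c₂.Within k
  | ite e c₁ c₂ => e.Within k ∧ c₁.Within k ∧ c₂.Within k
  | .while e c => e.Within k ∧ c.Within k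
  | mark => True

/-- `Run M W c s s' t l`: with arrays of `M` cells and words below `W`, the program `c` started in
the store `s` terminates in the store `s'` after `t` steps, and `l` lists the stores at which
`mark` was executed. There is no run when a cell outside of the arrays is accessed or a word
overflows. -/
inductive Run (M W : ℕ) : Prog → Store → Store → ℕ → List Store → Prop where
  | set (s : Store) (r : ℕ) (e : Expr) (he : e.Safe M W s) :
      Run M W (.set r e) s ⟨Function.update s.reg r (e.val s), s.arr⟩ (e.cost + 1) []
  | write (s : Store) (a : ℕ) (i e : Expr) (hi : i.Safe M W s) (he : e.Safe M W s)
      (hM : i.val s < M) :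
      Run M W (.write a i e) s
        ⟨s.reg, Function.update s.arr a (Function.update (s.arr a) (i.val s) (e.val s))⟩
        (i.cost + e.cost + 1) []
  | seq {c₁ c₂ : Prog} {s s₁ s₂ : Store} {t₁ t₂ : ℕ} {l₁ l₂ : List Store}
      (h₁ : Run M W c₁ s s₁ t₁ l₁) (h₂ : Run M W c₂ s₁ s₂ t₂ l₂) :
      Run M W (.seq c₁ c₂) s s₂ (t₁ + t₂) (l₁ ++ l₂)
  | iteTrue {e : Expr} {c₁ c₂ : Prog} {s s' : Store} {t : ℕ} {l : List Store}
      (he : e.Safe M W s) (hv : e.val s ≠ 0) (h : Run M W c₁ s s' t l) :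
      Run M W (.ite e c₁ c₂) s s' (e.cost + 1 + t) l
  | iteFalse {e : Expr} {c₁ c₂ : Prog} {s s' : Store} {t : ℕ} {l : List Store}
      (he : e.Safe M W s) (hv : e.val s = 0) (h : Run M W c₂ s s' t l) :
      Run M W (.ite e c₁ c₂) s s' (e.cost + 1 + t) l
  | whileTrue {e : Expr} {c : Prog} {s s₁ s₂ : Store} {t₁ t₂ : ℕ} {l₁ l₂ : List Store}
      (he : e.Safe M W s) (hv : e.val s ≠ 0) (h₁ : Run M W c s s₁ t₁ l₁)
      (h₂ : Run M W (.while e c) s₁ s₂ t₂ l₂) :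
      Run M W (.while e c) s s₂ (e.cost + 1 + t₁ + t₂) (l₁ ++ l₂)
  | whileFalse {e : Expr} {c : Prog} {s : Store} (he : e.Safe M W s) (hv : e.val s = 0) :
      Run M W (.while e c) s s (e.cost + 1) []
  | mark (s : Store) : Run M W .mark s s 1 [s]

/-- The initial store for a game on the vertices `0, …, n - 1` whose edges are listed by `es`, and
for the bound `d` on the priorities. Registers `0, 1, 2` hold `n`, the number of edges, and `d`;
arrays `0, 1` hold the owners and the priorities of the vertices; arrays `2, 3` hold the sources
and the targets of the edges; everything else is `0`. -/
def inputStore {n : ℕ} (𝒢 : ParityGame (Fin n)) (es : List (Fin n × Fin n)) (d : ℕ) : Store where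
  reg := fun r => if r = 0 then n else if r = 1 then es.length else if r = 2 then d else 0
  arr := fun a i =>
    if a = 0 then (if h : i < n then (𝒢.owner ⟨i, h⟩).code else 0)
    else if a = 1 then (if h : i < n then 𝒢.prio ⟨i, h⟩ else 0)
    else if a = 2 then (if h : i < es.length then ((es[i]).1 : ℕ) else 0)
    else if a = 3 then (if h : i < es.length then ((es[i]).2 : ℕ) else 0)
    else 0

/-- The store shows the arguments of the call `c`: registers `3, 4, 5, 6` hold the player, the
bound on the priorities and the two precisions, and array `5` has entry `1` exactly at the
vertices of the set. -/
def ShowsCall {n : ℕ} (s : Store) (c : ParityGame.Call (Fin n)) : Prop :=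
  s.reg 3 = c.player.code ∧ s.reg 4 = c.maxPrio ∧ s.reg 5 = c.ownPrec ∧ s.reg 6 = c.oppPrec ∧
    ∀ v : Fin n, s.arr 5 v = 1 ↔ v ∈ c.set

end Ram

/-! Correctness is one induction along the recursion, `separates_solve`, with the invariant
`Separates`: the returned set is a trap for the opponent, contains the small dominions of the player
and misses the small dominions of the opponent. A small own dominion survives because its trace on
`H` is a dominion there, hence disjoint from the result `W` of the middle call, and a trap for the
opponent disjoint from `W` is also disjoint from the attractor of `W`.

The heart is `Separates.step`, for a dominion `D` of the opponent with at most `q` vertices. Let `X`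
be a largest dominion of the opponent inside `D` that the first call has removed completely. If `X`
is not all of `D`, the opponent wins all of `D \ X` although the other player likes the top priority
`d`. Zielonka's argument (`IsPosDominion.of_top`, `IsPosDominion.exists_restSet`) then yields a
nonempty dominion `B` of the opponent in `D \ X` outside the attractor to priority `d`. By
maximality `X ∪ B` meets `G₁`, so it has more than `q / 2` vertices, because the first call removes
all dominions of size at most `q / 2`. The part of `B` in `G₁` lies in `H` and is found by the
middle call, in which the opponent has precision `q`. Hence at most `q / 2` vertices of `D` are left
in `G₂`, and the third call removes them.

Dominions are defined by history-dependent strategies. Positional determinacy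
(`exists_posDominions`) shows that each of them is won by a single positional strategy
(`isDominion_iff`), so all surgery on dominions is done with `IsPosDominion`. Since the winning
regions are dominions, full precision computes them (`solve_card_eq`).

For the number of calls, the first and third call lower `ℓ` by one by halving `q`, while the middle
call lowers `d` and exchanges `p` and `q`, which keeps `ℓ`; Pascal's rule closes the induction in
`length_calls_le`. For `p = q = n` the bound is turned into a power of `n` by
`two_pow_mul_choose_le`.

For the machine, one call must cost O(n + m) time and the whole recursion O(m) memory. Attractors
are computed by a worklist that handles each edge once (`WorkInv`). The sets `G₁` of the pending
middle calls are nested, so one rank per vertex stores all of them; a middle call needs no stack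
frame, because its caller's parameters are recovered by exchanging the precisions and incrementing
`d`. Only the halving calls push frames, at most `log p + log q` at a time. The simulation is
`loopRun_solve`. -/

namespace Player

@[simp] theorem opp_opp (P : Player) : P.opp.opp = P := by cases P <;> rfl

theorem opp_ne (P : Player) : P.opp ≠ P := by cases P <;> decide

theorem eq_opp_iff {P Q : Player} : Q = P.opp ↔ Q ≠ P := by
  cases P <;> cases Q <;> simp [opp]

theorem ofParity_succ (d : ℕ) : ofParity (d + 1) = (ofParity d).opp := by
  unfold ofParity
  rcases Nat.mod_two_eq_zero_or_one d with h | h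
  · rw [if_pos h, if_neg (by omega)]; rfl
  · rw [if_neg (by omega : ¬ d % 2 = 0), if_pos (by omega)]; rfl

end Player

/-! ### Plays and strategies -/

namespace ParityGame

open Filter

section Plays

variable {V : Type*} {𝒢 : ParityGame V} {P : Player} {G : Finset V}

/-- The winner depends only on what occurs infinitely often. This is used whenever a play eventually
settles in a region. -/
theorem winsPlay_shift (ρ : ℕ → V) (k : ℕ) :
    𝒢.WinsPlay P (fun i => ρ (i + k)) ↔ 𝒢.WinsPlay P ρ := by
  have h : ∀ j, (∃ᶠ i in atTop, 𝒢.prio (ρ (i + k)) = j) ↔ ∃ᶠ i in atTop, 𝒢.prio (ρ i) = j := by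
    intro j
    conv_rhs => rw [← Filter.map_add_atTop_eq_nat k]
    rw [Filter.frequently_map]
  simp only [WinsPlay, h]

theorem WinsPlay.unique {Q : Player} {ρ : ℕ → V} (h₁ : 𝒢.WinsPlay P ρ) (h₂ : 𝒢.WinsPlay Q ρ) :
    P = Q := by
  obtain ⟨k, hk, rfl⟩ := h₁
  obtain ⟨k', hk', rfl⟩ := h₂
  rw [hk.unique hk']

theorem winsPlay_of_frequently_max {ρ : ℕ → V} {d : ℕ} (hd : ∀ i, 𝒢.prio (ρ i) ≤ d)
    (hf : ∃ᶠ i in atTop, 𝒢.prio (ρ i) = d) : 𝒢.WinsPlay (Player.ofParity d) ρ := by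
  refine ⟨d, ⟨hf, ?_⟩, rfl⟩
  intro j hj
  obtain ⟨i, hi⟩ := Filter.Frequently.exists hj
  exact hi ▸ hd i

theorem prefixOf_succ (ρ : ℕ → V) (i : ℕ) :
    prefixOf ρ (i + 1) = prefixOf ρ i ++ [ρ (i + 1)] := by
  simp [prefixOf, List.range_succ]

@[simp] theorem getLast?_prefixOf (ρ : ℕ → V) (i : ℕ) : (prefixOf ρ i).getLast? = some (ρ i) := by
  simp [prefixOf, List.range_succ]

theorem prefixOf_congr {ρ ρ' : ℕ → V} {i : ℕ} (h : ∀ j ≤ i, ρ j = ρ' j) :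
    prefixOf ρ i = prefixOf ρ' i := by
  unfold prefixOf
  refine List.map_congr_left fun j hj => h j ?_
  simpa [Nat.lt_succ_iff] using hj

/-- A finite path in a subgame extends to a play. -/
theorem exists_play_extending (hG : 𝒢.IsSubgame G) (ρ : ℕ → V) (i : ℕ) (h0 : ∀ j ≤ i, ρ j ∈ G)
    (h1 : ∀ j < i, (ρ j, ρ (j + 1)) ∈ 𝒢.edges) :
    ∃ ρ', 𝒢.IsPlay G ρ' ∧ ∀ j ≤ i, ρ' j = ρ j := by
  classical
  choose! f hf hfe using hG
  refine ⟨fun j => if j ≤ i then ρ j else f^[j - i] (ρ i), ?_, fun j hj => by simp [hj]⟩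
  have hit : ∀ k, f^[k] (ρ i) ∈ G := by
    intro k
    induction k with
    | zero => exact h0 i le_rfl
    | succ k ih => rw [Function.iterate_succ_apply']; exact hf _ ih
  intro j
  by_cases hj : j < i
  · simpa [hj.le, Nat.succ_le_of_lt hj] using ⟨h0 j hj.le, h1 j hj⟩
  · have h2 : ¬ j + 1 ≤ i := by omega
    have h3 : (if j ≤ i then ρ j else f^[j - i] (ρ i)) = f^[j - i] (ρ i) := by
      split_ifs with h
      · have : j = i := by omega
        subst this; simp
      · rfl
    simp only [h2, if_false, h3]
    refine ⟨hit _, ?_⟩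
    rw [show j + 1 - i = (j - i) + 1 by omega, Function.iterate_succ_apply']
    exact hfe _ (hit _)

/-- A strategy of `P` can be played against a positional strategy of the opponent. -/
theorem exists_play (hG : 𝒢.IsSubgame G) {v : V} (hv : v ∈ G) {σ : List V → V}
    (hσ : 𝒢.IsStrategy G P v σ) (τ : V → V)
    (hτ : ∀ u ∈ G, 𝒢.owner u ≠ P → τ u ∈ G ∧ (u, τ u) ∈ 𝒢.edges) :
    ∃ ρ, 𝒢.IsPlay G ρ ∧ 𝒢.Agrees P v σ ρ ∧ ∀ i, 𝒢.owner (ρ i) ≠ P → ρ (i + 1) = τ (ρ i) := by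
  classical
  let next : List V × V → List V × V := fun x =>
    let w := if 𝒢.owner x.2 = P then σ x.1 else τ x.2
    (x.1 ++ [w], w)
  let st : ℕ → List V × V := fun i => next^[i] ([v], v)
  have hst : ∀ i, st (i + 1) = next (st i) := fun i => Function.iterate_succ_apply' _ _ _
  let ρ : ℕ → V := fun i => (st i).2
  have hpre : ∀ i, prefixOf ρ i = (st i).1 := by
    intro i
    induction i with
    | zero => rfl
    | succ i ih => rw [prefixOf_succ, ih]; simp only [ρ, hst]; rfl
  have hstep : ∀ i, ρ (i + 1) = if 𝒢.owner (ρ i) = P then σ (prefixOf ρ i) else τ (ρ i) := by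
    intro i
    rw [hpre]; simp only [ρ, hst]; rfl
  have hall : ∀ i, (∀ j ≤ i, ρ j ∈ G) ∧ ∀ j < i, (ρ j, ρ (j + 1)) ∈ 𝒢.edges := by
    intro i
    induction i with
    | zero => exact ⟨fun j hj => by obtain rfl : j = 0 := by omega
                                    exact hv, fun j hj => by omega⟩
    | succ i ih =>
      have key : ρ (i + 1) ∈ G ∧ (ρ i, ρ (i + 1)) ∈ 𝒢.edges := by
        rw [hstep]
        split_ifs with ho
        -- A strategy is only constrained on prefixes of infinite plays, so the finite path built so
        -- far must be extended before legality of the move can be used.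
        · obtain ⟨ρ', hρ', he⟩ := exists_play_extending hG ρ i ih.1 ih.2
          have h := hσ ρ' hρ' (he 0 (Nat.zero_le _)) i (by rw [he i le_rfl]; exact ho)
          rw [prefixOf_congr he, he i le_rfl] at h
          exact h
        · exact hτ _ (ih.1 i le_rfl) ho
      constructor
      · intro j hj
        rcases Nat.lt_or_ge j (i + 1) with h | h
        · exact ih.1 j (by omega)
        · obtain rfl : j = i + 1 := by omega
          exact key.1
      · intro j hj
        rcases Nat.lt_or_ge j i with h | h
        · exact ih.2 j h
        · obtain rfl : j = i := by omega
          exact key.2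
  refine ⟨ρ, fun i => ⟨(hall i).1 i le_rfl, (hall (i + 1)).2 i (Nat.lt_succ_self i)⟩,
    ⟨rfl, fun i hi => by rw [hstep, if_pos hi]⟩, fun i hi => by rw [hstep, if_neg hi]⟩

/-- A positional strategy, played as long as the play is in `D`. -/
theorem canForce_of_positional (hG : 𝒢.IsSubgame G) {v : V} {Φ : (ℕ → V) → Prop} (D : Finset V)
    (τ : V → V) (hτ : ∀ u ∈ D, 𝒢.owner u = P → τ u ∈ G ∧ (u, τ u) ∈ 𝒢.edges)
    (hΦ : ∀ ρ, 𝒢.IsPlay G ρ → ρ 0 = v →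
      (∀ i, ρ i ∈ D → 𝒢.owner (ρ i) = P → ρ (i + 1) = τ (ρ i)) → Φ ρ) :
    𝒢.CanForce G P v Φ := by
  classical
  choose! f hf hfe using hG
  -- Outside of `D` an arbitrary successor keeps the strategy legal; the value at the empty list is
  -- never consulted.
  refine ⟨fun l => match l.getLast? with
    | some u => if u ∈ D then τ u else f u
    | none => v, ?_, ?_⟩
  · intro ρ hρ _ i hi
    simp only [getLast?_prefixOf]
    split_ifs with h
    · exact hτ _ h hi
    · exact ⟨hf _ (hρ i).1, hfe _ (hρ i).1⟩
  · intro ρ hρ ha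
    refine hΦ ρ hρ ha.1 fun i hD hi => ?_
    have := ha.2 i hi
    simp only [getLast?_prefixOf, if_pos hD] at this
    exact this

end Plays

/-! ### Traps and positional dominions -/

section Traps

variable {V : Type*}

/-- `X` is a trap for `Q` in `G`: in `G`, the player `Q` cannot leave `X`, and the opponent can
stay in `X`. -/
structure IsTrap (𝒢 : ParityGame V) (Q : Player) (G X : Finset V) : Prop where
  subset : X ⊆ G
  closed : ∀ v ∈ X, 𝒢.owner v = Q → ∀ w ∈ G, (v, w) ∈ 𝒢.edges → w ∈ X
  exists_succ : ∀ v ∈ X, 𝒢.owner v ≠ Q → ∃ w ∈ X, (v, w) ∈ 𝒢.edges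

/-- `D` is a dominion of `P` in `G` on which a positional strategy wins. -/
structure IsPosDominion (𝒢 : ParityGame V) (P : Player) (G D : Finset V) : Prop where
  subset : D ⊆ G
  closed : ∀ v ∈ D, 𝒢.owner v ≠ P → ∀ w ∈ G, (v, w) ∈ 𝒢.edges → w ∈ D
  exists_strategy : ∃ τ : V → V,
    (∀ v ∈ D, 𝒢.owner v = P → τ v ∈ D ∧ (v, τ v) ∈ 𝒢.edges) ∧
    ∀ ρ, 𝒢.IsPlay D ρ → (∀ i, 𝒢.owner (ρ i) = P → ρ (i + 1) = τ (ρ i)) → 𝒢.WinsPlay P ρ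

variable {𝒢 : ParityGame V} {P Q : Player} {G X Y D : Finset V}

theorem IsTrap.isSubgame (h : 𝒢.IsTrap Q G X) (hG : 𝒢.IsSubgame G) : 𝒢.IsSubgame X := by
  intro v hv
  by_cases ho : 𝒢.owner v = Q
  · obtain ⟨w, hw, he⟩ := hG v (h.subset hv)
    exact ⟨w, h.closed v hv ho w hw he, he⟩
  · exact h.exists_succ v hv ho

theorem IsTrap.refl (hG : 𝒢.IsSubgame G) : 𝒢.IsTrap Q G G :=
  ⟨subset_rfl, fun _ _ _ _ hw _ => hw, fun v hv _ => hG v hv⟩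

theorem IsTrap.trans (h₁ : 𝒢.IsTrap Q G X) (h₂ : 𝒢.IsTrap Q X Y) : 𝒢.IsTrap Q G Y :=
  ⟨h₂.subset.trans h₁.subset,
    fun v hv ho w hw he => h₂.closed v hv ho w (h₁.closed v (h₂.subset hv) ho w hw he) he,
    h₂.exists_succ⟩

theorem IsPosDominion.isTrap (h : 𝒢.IsPosDominion P G D) : 𝒢.IsTrap P.opp G D := by
  refine ⟨h.subset, fun v hv ho => h.closed v hv (Player.eq_opp_iff.1 ho), fun v hv ho => ?_⟩
  obtain ⟨τ, hτ, _⟩ := h.exists_strategy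
  have ho' : 𝒢.owner v = P := by rwa [Ne, Player.eq_opp_iff, not_not] at ho
  exact ⟨τ v, hτ v hv ho'⟩

theorem IsPosDominion.empty : 𝒢.IsPosDominion P G ∅ :=
  ⟨by simp, by simp, id, by simp, fun ρ h _ => absurd (h 0).1 (by simp)⟩

theorem IsPosDominion.mono (h : 𝒢.IsPosDominion P G D) (h₁ : D ⊆ X) (h₂ : X ⊆ G) :
    𝒢.IsPosDominion P X D :=
  ⟨h₁, fun v hv ho w hw => h.closed v hv ho w (h₂ hw), h.exists_strategy⟩

/-- The opponent cannot leave `X`, so enlarging the game from `X` to `G` offers no new escape from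
`D`. -/
theorem IsPosDominion.of_trap (h : 𝒢.IsPosDominion P X D) (hX : 𝒢.IsTrap P.opp G X) :
    𝒢.IsPosDominion P G D :=
  ⟨h.subset.trans hX.subset, fun v hv ho w hw he =>
    h.closed v hv ho w (hX.closed v (h.subset hv) (Player.eq_opp_iff.2 ho) w hw he) he,
    h.exists_strategy⟩

variable [DecidableEq V]

/-- The player cannot leave `X`, so the old strategy automatically stays in `D ∩ X`. Dominions are
cut down to smaller subgames in this way throughout the correctness proof. -/
theorem IsPosDominion.inter_trap (h : 𝒢.IsPosDominion P G D) (hX : 𝒢.IsTrap P G X) :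
    𝒢.IsPosDominion P X (D ∩ X) := by
  obtain ⟨τ, hτ, hw⟩ := h.exists_strategy
  refine ⟨Finset.inter_subset_right, fun v hv ho w hw' he => ?_, τ, fun v hv ho => ?_,
    fun ρ hρ => hw ρ fun i => ⟨(Finset.mem_inter.1 (hρ i).1).1, (hρ i).2⟩⟩
  · rw [Finset.mem_inter] at hv ⊢
    exact ⟨h.closed v hv.1 ho w (hX.subset hw') he, hw'⟩
  · rw [Finset.mem_inter] at hv ⊢
    obtain ⟨h1, h2⟩ := hτ v hv.1 ho
    exact ⟨⟨h1, hX.closed v hv.2 ho _ (h.subset h1) h2⟩, h2⟩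

/-- Two dominions of which the second lives outside of the first one. -/
theorem IsPosDominion.union (h : 𝒢.IsPosDominion P G X) (h' : 𝒢.IsPosDominion P (G \ X) Y) :
    𝒢.IsPosDominion P G (X ∪ Y) := by
  obtain ⟨τ, hτ, hw⟩ := h.exists_strategy
  obtain ⟨τ', hτ', hw'⟩ := h'.exists_strategy
  refine ⟨Finset.union_subset h.subset (h'.subset.trans Finset.sdiff_subset), ?_,
    fun v => if v ∈ X then τ v else τ' v, ?_, ?_⟩
  · intro v hv ho w hwG he
    rw [Finset.mem_union] at hv ⊢
    rcases hv with hv | hv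
    · exact .inl (h.closed v hv ho w hwG he)
    · by_cases hx : w ∈ X
      · exact .inl hx
      · exact .inr (h'.closed v hv ho w (Finset.mem_sdiff.2 ⟨hwG, hx⟩) he)
  · intro v hv ho
    by_cases hx : v ∈ X
    · simp only [if_pos hx, Finset.mem_union]
      exact ⟨.inl (hτ v hx ho).1, (hτ v hx ho).2⟩
    · have hv' : v ∈ Y := (Finset.mem_union.1 hv).resolve_left hx
      simp only [if_neg hx, Finset.mem_union]
      exact ⟨.inr (hτ' v hv' ho).1, (hτ' v hv' ho).2⟩
  · intro ρ hρ hag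
    beta_reduce at hag
    -- Once in `X`, the play remains there and the first strategy decides; a play that never enters
    -- `X` stays in `Y`.
    by_cases hex : ∃ k, ρ k ∈ X
    · obtain ⟨k, hk⟩ := hex
      have hstay : ∀ i, ρ (i + k) ∈ X := by
        intro i
        induction i with
        | zero => simpa using hk
        | succ i ih =>
          rw [show i + 1 + k = i + k + 1 by omega]
          by_cases ho : 𝒢.owner (ρ (i + k)) = P
          · rw [hag _ ho, if_pos ih]; exact (hτ _ ih ho).1
          · refine h.closed _ ih ho _ ?_ (hρ _).2
            exact (Finset.union_subset h.subset (h'.subset.trans Finset.sdiff_subset)) (hρ _).1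
      rw [← winsPlay_shift ρ k]
      refine hw _ (fun i => ⟨hstay i, ?_⟩) fun i ho => ?_
      · rw [show i + 1 + k = i + k + 1 by omega]; exact (hρ _).2
      · have := hag _ ho
        rw [if_pos (hstay i)] at this
        rw [show i + 1 + k = i + k + 1 by omega]; exact this
    · push Not at hex
      refine hw' ρ (fun i => ⟨(Finset.mem_union.1 (hρ i).1).resolve_left (hex i), (hρ i).2⟩) ?_
      intro i ho
      rw [hag i ho, if_neg (hex i)]

end Traps

/-! ### Attractors -/

section Attractors

variable {V : Type*} {𝒢 : ParityGame V} {P : Player} {G S X D : Finset V}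

theorem mem_attr {v : V} : v ∈ 𝒢.attr P S G ↔
    v ∈ G ∧ 𝒢.CanForce G P v fun ρ => ∃ i, ρ i ∈ S := by
  simp [attr]

theorem attr_subset : 𝒢.attr P S G ⊆ G := fun _ hv => (mem_attr.1 hv).1

variable [DecidableEq V]

/-- `τ` attracts the vertices of `A` to `S`, as witnessed by the ranking `r`. -/
def Attracts (𝒢 : ParityGame V) (P : Player) (G S A : Finset V) (τ : V → V) (r : V → ℕ) : Prop :=
  ∀ v ∈ A, v ∉ S →
    (𝒢.owner v = P → τ v ∈ A ∧ (v, τ v) ∈ 𝒢.edges ∧ r (τ v) < r v) ∧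
    (𝒢.owner v ≠ P → ∀ w ∈ G, (v, w) ∈ 𝒢.edges → w ∈ A ∧ r w < r v)

/-- As long as `G \ S` is not a trap, some vertex of it is forced into `S` in one move; that vertex
is added to `S` and the construction repeated. -/
theorem exists_attracts (𝒢 : ParityGame V) (P : Player) (G : Finset V) (S : Finset V)
    (hS : S ⊆ G) :
    ∃ (A : Finset V) (τ : V → V) (r : V → ℕ), S ⊆ A ∧ A ⊆ G ∧ 𝒢.IsTrap P G (G \ A) ∧
      𝒢.Attracts P G S A τ r := by
  induction hk : (G \ S).card using Nat.strong_induction_on generalizing S with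
  | _ k ih =>
  by_cases htrap : 𝒢.IsTrap P G (G \ S)
  · exact ⟨S, id, fun _ => 0, subset_rfl, hS, htrap, fun v hv hn => absurd hv hn⟩
  have hex : ∃ v ∈ G \ S, (𝒢.owner v = P ∧ ∃ w ∈ S, (v, w) ∈ 𝒢.edges) ∨
      (𝒢.owner v ≠ P ∧ ∀ w ∈ G, (v, w) ∈ 𝒢.edges → w ∈ S) := by
    by_contra hcon
    push Not at hcon
    refine htrap ⟨Finset.sdiff_subset, fun v hv ho w hw he => ?_, fun v hv ho => ?_⟩
    · exact Finset.mem_sdiff.2 ⟨hw, fun hwS => (hcon v hv).1 ho w hwS he⟩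
    · obtain ⟨w, hw, he, hwS⟩ := (hcon v hv).2 ho
      exact ⟨w, Finset.mem_sdiff.2 ⟨hw, hwS⟩, he⟩
  obtain ⟨v, hv, hcase⟩ := hex
  rw [Finset.mem_sdiff] at hv
  obtain ⟨A, τ, r, hSA, hAG, hT, hA⟩ := ih _ (by
    subst hk
    refine Finset.card_lt_card ⟨Finset.sdiff_subset_sdiff subset_rfl (Finset.subset_insert v S),
      fun h => ?_⟩
    have := h (Finset.mem_sdiff.2 hv)
    simp at this) (insert v S) (Finset.insert_subset hv.1 hS) rfl
  have hSA' : S ⊆ A := (Finset.subset_insert v S).trans hSA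
  obtain ⟨w₀, hw₀⟩ : ∃ w₀, 𝒢.owner v = P → w₀ ∈ S ∧ (v, w₀) ∈ 𝒢.edges := by
    by_cases ho : 𝒢.owner v = P
    · rcases hcase with ⟨_, w, hw, he⟩ | ⟨h, _⟩
      · exact ⟨w, fun _ => ⟨hw, he⟩⟩
      · exact absurd ho h
    · exact ⟨v, fun h => absurd h ho⟩
  -- The vertex `v` reaches `S` in one move. Shifting the old ranks by two keeps them above the
  -- ranks of `S` and `v`, which were targets in the inductive call.
  refine ⟨A, Function.update τ v w₀, fun u => if u ∈ S then 0 else if u = v then 1 else r u + 2,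
    hSA', hAG, hT, ?_⟩
  have hr : ∀ u, (if u ∈ S then 0 else if u = v then 1 else r u + 2) ≤ r u + 2 := by
    intro u; split_ifs <;> omega
  intro u hu huS
  by_cases huv : u = v
  · subst huv
    simp only [Function.update_self, if_neg huS, if_true]
    refine ⟨fun ho => ?_, fun ho w hw he => ?_⟩
    · obtain ⟨h1, h2⟩ := hw₀ ho
      exact ⟨hSA' h1, h2, by simp [h1]⟩
    · rcases hcase with ⟨h, _⟩ | ⟨_, h⟩
      · exact absurd h ho
      · exact ⟨hSA' (h w hw he), by simp [h w hw he]⟩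
  · obtain ⟨h1, h2⟩ := hA u hu (by simp [huv, huS])
    simp only [Function.update_of_ne huv, if_neg huS, if_neg huv]
    exact ⟨fun ho => ⟨(h1 ho).1, (h1 ho).2.1,
        (hr _).trans_lt (by have := (h1 ho).2.2; omega)⟩,
      fun ho w hw he => ⟨(h2 ho w hw he).1,
        (hr _).trans_lt (by have := (h2 ho w hw he).2; omega)⟩⟩

/-- The rank drops with every move outside of `S`. The starting time `k` is arbitrary so that
recurrent visits to `A` give recurrent visits to `S`. -/
theorem Attracts.exists_mem {A : Finset V} {τ : V → V} {r : V → ℕ}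
    (h : 𝒢.Attracts P G S A τ r) {ρ : ℕ → V} (hρ : 𝒢.IsPlay G ρ) (k : ℕ) (hk : ρ k ∈ A)
    (hτ : ∀ i, ρ i ∈ A \ S → 𝒢.owner (ρ i) = P → ρ (i + 1) = τ (ρ i)) :
    ∃ i, k ≤ i ∧ ρ i ∈ S := by
  induction hn : r (ρ k) using Nat.strong_induction_on generalizing k with
  | _ n ih =>
  by_cases hS : ρ k ∈ S
  · exact ⟨k, le_rfl, hS⟩
  have key : ρ (k + 1) ∈ A ∧ r (ρ (k + 1)) < r (ρ k) := by
    by_cases ho : 𝒢.owner (ρ k) = P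
    · rw [hτ k (Finset.mem_sdiff.2 ⟨hk, hS⟩) ho]
      have := (h _ hk hS).1 ho
      exact ⟨this.1, this.2.2⟩
    · exact (h _ hk hS).2 ho _ (hρ (k + 1)).1 (hρ k).2
  obtain ⟨i, hi, hiS⟩ := ih _ (hn ▸ key.2) (k + 1) key.1 rfl
  exact ⟨i, by omega, hiS⟩

/-- A trap for `P` outside of `S` is disjoint from the attractor. -/
theorem IsTrap.disjoint_attr (hG : 𝒢.IsSubgame G) (hX : 𝒢.IsTrap P G X) (hS : Disjoint X S) :
    Disjoint X (𝒢.attr P S G) := by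
  rw [Finset.disjoint_left] at hS ⊢
  intro v hvX hv
  obtain ⟨hvG, σ, hσ, hreach⟩ := mem_attr.1 hv
  -- The counter-strategy of the opponent: stay in `X` while there, move anywhere otherwise.
  have hsucc : ∀ u, ∃ w, u ∈ G → 𝒢.owner u ≠ P →
      (w ∈ G ∧ (u, w) ∈ 𝒢.edges) ∧ (u ∈ X → w ∈ X) := by
    intro u
    by_cases hu : u ∈ G ∧ 𝒢.owner u ≠ P
    · by_cases hx : u ∈ X
      · obtain ⟨w, hw, he⟩ := hX.exists_succ u hx hu.2
        exact ⟨w, fun _ _ => ⟨⟨hX.subset hw, he⟩, fun _ => hw⟩⟩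
      · obtain ⟨w, hw, he⟩ := hG u hu.1
        exact ⟨w, fun _ _ => ⟨⟨hw, he⟩, fun h => absurd h hx⟩⟩
    · exact ⟨u, fun h1 h2 => absurd ⟨h1, h2⟩ hu⟩
  choose τ hτ using hsucc
  obtain ⟨ρ, hρ, hag, hτρ⟩ := exists_play hG hvG hσ τ fun u hu ho => (hτ u hu ho).1
  have hstay : ∀ i, ρ i ∈ X := by
    intro i
    induction i with
    | zero => rw [hag.1]; exact hvX
    | succ i ih =>
      by_cases ho : 𝒢.owner (ρ i) = P
      · exact hX.closed _ ih ho _ (hρ (i + 1)).1 (hρ i).2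
      · rw [hτρ i ho]; exact (hτ _ (hρ i).1 ho).2 ih
  obtain ⟨i, hi⟩ := hreach ρ hρ hag
  exact hS (hstay i) hi

/-- The attractor is the complement of a trap; its vertices are attracted positionally. -/
theorem attr_spec (hG : 𝒢.IsSubgame G) (hS : S ⊆ G) :
    S ⊆ 𝒢.attr P S G ∧ 𝒢.IsTrap P G (G \ 𝒢.attr P S G) ∧
      ∃ τ r, 𝒢.Attracts P G S (𝒢.attr P S G) τ r := by
  obtain ⟨A, τ, r, hSA, hAG, hT, hA⟩ := exists_attracts 𝒢 P G S hS
  suffices h : 𝒢.attr P S G = A by rw [h]; exact ⟨hSA, hT, τ, r, hA⟩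
  apply Finset.Subset.antisymm
  · intro v hv
    by_contra hvA
    have hd : Disjoint (G \ A) S :=
      Finset.disjoint_left.2 fun u hu huS => (Finset.mem_sdiff.1 hu).2 (hSA huS)
    exact Finset.disjoint_left.1 (hT.disjoint_attr hG hd)
      (Finset.mem_sdiff.2 ⟨attr_subset hv, hvA⟩) hv
  · intro v hv
    refine mem_attr.2 ⟨hAG hv, canForce_of_positional hG (A \ S) τ (fun u hu ho => ?_) ?_⟩
    · rw [Finset.mem_sdiff] at hu
      have := (hA u hu.1 hu.2).1 ho
      exact ⟨hAG this.1, this.2.1⟩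
    · intro ρ hρ h0 hτ
      obtain ⟨i, -, hi⟩ := hA.exists_mem hρ 0 (h0 ▸ hv) hτ
      exact ⟨i, hi⟩

/-- The complement of the attractor is the largest trap disjoint from `S`. In this form the worklist
algorithm can be verified without mentioning strategies. -/
theorem eq_attr_of_trap (hG : 𝒢.IsSubgame G) {A : Finset V} (hSA : S ⊆ A) (hAG : A ⊆ G)
    (hT : 𝒢.IsTrap P G (G \ A))
    (hmin : ∀ T, 𝒢.IsTrap P G T → Disjoint T S → Disjoint T A) : A = 𝒢.attr P S G := by
  have hs := attr_spec (P := P) hG (hSA.trans hAG)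
  have h1 : Disjoint (G \ A) S :=
    Finset.disjoint_left.2 fun u hu huS => (Finset.mem_sdiff.1 hu).2 (hSA huS)
  have h2 : Disjoint (G \ 𝒢.attr P S G) S :=
    Finset.disjoint_left.2 fun u hu huS => (Finset.mem_sdiff.1 hu).2 (hs.1 huS)
  have h3 := hT.disjoint_attr hG h1
  have h4 := hmin _ hs.2.1 h2
  rw [Finset.disjoint_left] at h3 h4
  ext v
  constructor
  · intro hv
    by_contra hn
    exact h4 (Finset.mem_sdiff.2 ⟨hAG hv, hn⟩) hv
  · intro hv
    by_contra hn
    exact h3 (Finset.mem_sdiff.2 ⟨attr_subset hv, hn⟩) hv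

/-- The complement of an attractor is a trap, and a trap is disjoint from the attractor of its
complement. -/
theorem isClosedIn_iff (hG : 𝒢.IsSubgame G) : 𝒢.IsClosedIn P X G ↔ 𝒢.IsTrap P.opp G X := by
  constructor
  · rintro ⟨hX, h⟩
    have := (attr_spec (P := P.opp) hG (Finset.sdiff_subset (s := G) (t := X))).2.1
    rwa [h, Finset.sdiff_sdiff_eq_self hX] at this
  · intro h
    refine ⟨h.subset, Finset.Subset.antisymm (fun v hv => ?_)
      (attr_spec hG Finset.sdiff_subset).1⟩
    exact Finset.mem_sdiff.2 ⟨attr_subset hv, fun hx =>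
      Finset.disjoint_left.1 (h.disjoint_attr hG Finset.disjoint_sdiff) hx hv⟩

/-- Attract to `D` first, then win inside of `D`; the finite prefix does not matter. -/
theorem IsPosDominion.attr (hG : 𝒢.IsSubgame G) (h : 𝒢.IsPosDominion P G D) :
    𝒢.IsPosDominion P G (𝒢.attr P D G) := by
  obtain ⟨τ, hτ, hw⟩ := h.exists_strategy
  obtain ⟨hsub, htrap, τ', r, hatt⟩ := attr_spec (P := P) hG h.subset
  refine ⟨attr_subset, ?_, fun v => if v ∈ D then τ v else τ' v, ?_, ?_⟩
  · intro v hv ho w hwG he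
    by_cases hD : v ∈ D
    · exact hsub (h.closed v hD ho w hwG he)
    · exact ((hatt v hv hD).2 ho w hwG he).1
  · intro v hv ho
    by_cases hD : v ∈ D
    · simp only [if_pos hD]; exact ⟨hsub (hτ v hD ho).1, (hτ v hD ho).2⟩
    · simp only [if_neg hD]
      have := (hatt v hv hD).1 ho
      exact ⟨this.1, this.2.1⟩
  · intro ρ hρ hag
    beta_reduce at hag
    have hρG : 𝒢.IsPlay G ρ := fun i => ⟨attr_subset (hρ i).1, (hρ i).2⟩
    obtain ⟨k, -, hk⟩ := hatt.exists_mem hρG 0 (hρ 0).1 fun i hi ho => by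
      rw [hag i ho, if_neg (Finset.mem_sdiff.1 hi).2]
    have hstay : ∀ i, ρ (i + k) ∈ D := by
      intro i
      induction i with
      | zero => simpa using hk
      | succ i ih =>
        rw [show i + 1 + k = i + k + 1 by omega]
        by_cases ho : 𝒢.owner (ρ (i + k)) = P
        · rw [hag _ ho, if_pos ih]; exact (hτ _ ih ho).1
        · exact h.closed _ ih ho _ (hρG _).1 (hρG _).2
    rw [← winsPlay_shift ρ k]
    refine hw _ (fun i => ⟨hstay i, ?_⟩) fun i ho => ?_
    · rw [show i + 1 + k = i + k + 1 by omega]; exact (hρ _).2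
    · have := hag _ ho
      rw [if_pos (hstay i)] at this
      rw [show i + 1 + k = i + k + 1 by omega]; exact this

/-- If `P` likes the highest priority `d` and wins everywhere outside of the attractor of the
vertices of priority `d`, then `P` wins everywhere. -/
theorem IsPosDominion.of_top {d : ℕ} (hG : 𝒢.IsSubgame G) (hd : ∀ v ∈ G, 𝒢.prio v ≤ d)
    (hP : P = Player.ofParity d) {H : Finset V}
    (hH : H = G \ 𝒢.attr P (G.filter fun v => 𝒢.prio v = d) G)
    (h : 𝒢.IsPosDominion P H H) : 𝒢.IsPosDominion P G G := by
  set N := G.filter fun v => 𝒢.prio v = d with hN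
  obtain ⟨τ, hτ, hw⟩ := h.exists_strategy
  obtain ⟨hsub, htrap, τ', r, hatt⟩ := attr_spec (P := P) hG (Finset.filter_subset _ _ : N ⊆ G)
  rw [← hH] at htrap
  choose! f hf hfe using hG
  set A := 𝒢.attr P N G with hA
  have hHA : ∀ v ∈ G, v ∈ A ∨ v ∈ H := by
    intro v hv
    by_cases hv' : v ∈ A
    · exact .inl hv'
    · exact .inr (by rw [hH]; exact Finset.mem_sdiff.2 ⟨hv, hv'⟩)
  have hnA : ∀ v ∈ H, v ∉ A := fun v hv => (Finset.mem_sdiff.1 (hH ▸ hv)).2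
  refine ⟨subset_rfl, fun _ _ _ _ hw _ => hw,
    fun v => if v ∈ N then f v else if v ∈ A then τ' v else τ v, ?_, ?_⟩
  · intro v hv ho
    by_cases h1 : v ∈ N
    · simp only [if_pos h1]; exact ⟨hf v hv, hfe v hv⟩
    · by_cases h2 : v ∈ A
      · simp only [if_neg h1, if_pos h2]
        have := (hatt v h2 h1).1 ho
        exact ⟨attr_subset this.1, this.2.1⟩
      · have h3 := (hHA v hv).resolve_left h2
        simp only [if_neg h1, if_neg h2]
        exact ⟨htrap.subset (hτ v h3 ho).1, (hτ v h3 ho).2⟩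
  · intro ρ hρ hag
    beta_reduce at hag
    -- Either the play returns to the attractor forever, and then sees priority `d` infinitely
    -- often, or it finally stays in `H` and follows the strategy given there.
    by_cases hinf : ∃ᶠ i in atTop, ρ i ∈ A
    · rw [hP]
      refine winsPlay_of_frequently_max (fun i => hd _ (hρ i).1) ?_
      rw [Filter.frequently_atTop] at hinf ⊢
      intro k
      obtain ⟨i, hi, hiA⟩ := hinf k
      obtain ⟨j, hj, hjN⟩ := hatt.exists_mem hρ i hiA fun i hi ho => by
        rw [Finset.mem_sdiff] at hi
        rw [hag i ho, if_neg hi.2, if_pos hi.1]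
      exact ⟨j, by omega, (Finset.mem_filter.1 hjN).2⟩
    · rw [Filter.not_frequently, Filter.eventually_atTop] at hinf
      obtain ⟨k, hk⟩ := hinf
      have hkH : ∀ i, ρ (i + k) ∈ H := fun i =>
        (hHA _ (hρ _).1).resolve_left (hk _ (by omega))
      rw [← winsPlay_shift ρ k]
      refine hw _ (fun i => ⟨hkH i, ?_⟩) fun i ho => ?_
      · rw [show i + 1 + k = i + k + 1 by omega]; exact (hρ _).2
      · have := hag _ ho
        have h2 := hnA _ (hkH i)
        rw [if_neg (fun h => h2 (hsub h)), if_neg h2] at this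
        rw [show i + 1 + k = i + k + 1 by omega]; exact this

end Attractors

/-! ### Positional determinacy -/

section Determinacy

variable {V : Type*} {𝒢 : ParityGame V} {P : Player} {G D : Finset V}

theorem IsPosDominion.canForce (hG : 𝒢.IsSubgame G) (h : 𝒢.IsPosDominion P G D) {v : V}
    (hv : v ∈ D) : 𝒢.CanForce G P v fun ρ => 𝒢.WinsPlay P ρ ∧ ∀ i, ρ i ∈ D := by
  obtain ⟨τ, hτ, hw⟩ := h.exists_strategy
  refine canForce_of_positional hG D τ (fun u hu ho => ⟨h.subset (hτ u hu ho).1, (hτ u hu ho).2⟩)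
    fun ρ hρ h0 hag => ?_
  have hstay : ∀ i, ρ i ∈ D := by
    intro i
    induction i with
    | zero => rw [h0]; exact hv
    | succ i ih =>
      by_cases ho : 𝒢.owner (ρ i) = P
      · rw [hag i ih ho]; exact (hτ _ ih ho).1
      · exact h.closed _ ih ho _ (hρ _).1 (hρ _).2
  exact ⟨hw ρ (fun i => ⟨hstay i, (hρ i).2⟩) fun i => hag i (hstay i), hstay⟩

variable [DecidableEq V]

/-- Positional determinacy. -/
theorem exists_posDominions (𝒢 : ParityGame V) (G : Finset V) (hG : 𝒢.IsSubgame G) (P : Player) :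
    ∃ A B, A ∪ B = G ∧ 𝒢.IsPosDominion P G A ∧ 𝒢.IsPosDominion P.opp G B := by
  induction hk : G.card using Nat.strong_induction_on generalizing G P with
  | _ k ih =>
  by_cases hne : G = ∅
  · subst hne
    exact ⟨∅, ∅, by simp, .empty, .empty⟩
  obtain ⟨v₀, hv₀, hmax⟩ :=
    G.exists_max_image 𝒢.prio (Finset.nonempty_iff_ne_empty.2 hne)
  set d := 𝒢.prio v₀ with hd
  -- The claim is symmetric in the players, so it suffices to treat the one who likes the highest
  -- priority.
  suffices hmain : ∃ A B, A ∪ B = G ∧ 𝒢.IsPosDominion (Player.ofParity d) G A ∧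
      𝒢.IsPosDominion (Player.ofParity d).opp G B by
    obtain ⟨A, B, hAB, hA, hB⟩ := hmain
    by_cases hP : P = Player.ofParity d
    · subst hP; exact ⟨A, B, hAB, hA, hB⟩
    · have := Player.eq_opp_iff.2 hP
      subst this
      exact ⟨B, A, by rw [Finset.union_comm, hAB], hB, by simpa using hA⟩
  set Q := Player.ofParity d with hQ
  set N := G.filter fun v => 𝒢.prio v = d with hN
  obtain ⟨hsub, htrap, -⟩ := attr_spec (P := Q) hG (Finset.filter_subset _ _ : N ⊆ G)
  set H := G \ 𝒢.attr Q N G with hH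
  have hv₀N : v₀ ∈ N := Finset.mem_filter.2 ⟨hv₀, rfl⟩
  have hHlt : H.card < k := by
    rw [← hk]
    refine Finset.card_lt_card ⟨Finset.sdiff_subset, fun h => ?_⟩
    exact (Finset.mem_sdiff.1 (h hv₀)).2 (hsub hv₀N)
  obtain ⟨A, B, hAB, hA, hB⟩ := ih _ hHlt H (htrap.isSubgame hG) Q rfl
  -- Zielonka's case distinction: if the opponent wins nothing in `H`, the player wins everywhere;
  -- otherwise the attractor `Y` of the opponent's part is split off and induction applies to `G \
  -- Y`.
  by_cases hBe : B = ∅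
  · subst hBe
    rw [Finset.union_empty] at hAB
    subst hAB
    exact ⟨G, ∅, by simp, .of_top hG hmax hQ rfl hA, .empty⟩
  have hB' : 𝒢.IsPosDominion Q.opp G B := hB.of_trap (by simpa using htrap)
  have hY := hB'.attr hG
  obtain ⟨hsubY, htrapY, -⟩ := attr_spec (P := Q.opp) hG hB'.subset
  set Y := 𝒢.attr Q.opp B G with hYdef
  have hlt : (G \ Y).card < k := by
    rw [← hk]
    obtain ⟨b, hb⟩ := Finset.nonempty_iff_ne_empty.2 hBe
    refine Finset.card_lt_card ⟨Finset.sdiff_subset, fun h => ?_⟩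
    exact (Finset.mem_sdiff.1 (h (hB'.subset hb))).2 (hsubY hb)
  obtain ⟨A', B', hAB', hA', hB''⟩ := ih _ hlt (G \ Y) (htrapY.isSubgame hG) Q rfl
  refine ⟨A', Y ∪ B', ?_, hA'.of_trap htrapY, hY.union hB''⟩
  rw [← Finset.union_assoc, Finset.union_comm A' Y, Finset.union_assoc, hAB',
    Finset.union_sdiff_of_subset hY.subset]

/-- If the opponent has a positional dominion in `D`, then `P` has no strategy in `G` that wins
and stays in `D`. -/
theorem IsPosDominion.not_canForce (hG : 𝒢.IsSubgame G) (hD : D ⊆ G) {B : Finset V}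
    (h : 𝒢.IsPosDominion P.opp D B) {v : V} (hv : v ∈ B) :
    ¬ 𝒢.CanForce G P v fun ρ => 𝒢.WinsPlay P ρ ∧ ∀ i, ρ i ∈ D := by
  classical
  rintro ⟨σ, hσ, hΦ⟩
  obtain ⟨τ, hτ, hw⟩ := h.exists_strategy
  have hG' := hG
  choose! f hf hfe using hG'
  obtain ⟨ρ, hρ, hag, hτρ⟩ := exists_play hG (hD (h.subset hv)) hσ
    (fun u => if u ∈ B then τ u else f u) (fun u hu ho => by
      split_ifs with hB
      · have := hτ u hB (Player.eq_opp_iff.2 ho)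
        exact ⟨hD (h.subset this.1), this.2⟩
      · exact ⟨hf u hu, hfe u hu⟩)
  obtain ⟨hwin, hstay⟩ := hΦ ρ hρ hag
  have hB : ∀ i, ρ i ∈ B := by
    intro i
    induction i with
    | zero => rw [hag.1]; exact hv
    | succ i ih =>
      by_cases ho : 𝒢.owner (ρ i) = P
      · refine h.closed _ ih (fun h' => P.opp_ne ?_) _ (hstay _) (hρ _).2
        rw [← h', ho]
      · rw [hτρ i ho, if_pos ih]; exact (hτ _ ih (Player.eq_opp_iff.2 ho)).1
  refine P.opp_ne ((hw ρ (fun i => ⟨hB i, (hρ i).2⟩) fun i ho => ?_).unique hwin)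
  rw [hτρ i (Player.eq_opp_iff.1 ho), if_pos (hB i)]

/-- Staying in `D` against every opponent makes `D` a trap, so determinacy applies to the game on
`D`. A nonempty part won by the opponent would defeat the given strategies, hence one positional
strategy wins on all of `D`. -/
theorem isDominion_iff (hG : 𝒢.IsSubgame G) :
    𝒢.IsDominion P G D ↔ 𝒢.IsPosDominion P G D := by
  classical
  refine ⟨fun h => ?_, fun h => ⟨h.subset, fun v hv => h.canForce hG hv⟩⟩
  have hG' := hG
  choose! f hf hfe using hG'
  have htrap : 𝒢.IsTrap P.opp G D := by
    refine ⟨h.1, fun v hv ho w hw he => ?_, fun v hv ho => ?_⟩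
    · obtain ⟨σ, hσ, hΦ⟩ := h.2 v hv
      -- The opponent moves from `v` to the prescribed `w`; the dominion strategy stays in `D`, so
      -- `w` must belong to `D`.
      obtain ⟨ρ, hρ, hag, hτρ⟩ := exists_play hG (h.1 hv) hσ (Function.update f v w)
        (fun u hu _ => by
          by_cases huv : u = v
          · subst huv; simpa using ⟨hw, he⟩
          · simpa [huv] using ⟨hf u hu, hfe u hu⟩)
      have h1 := hτρ 0 (by rw [hag.1]; exact Player.eq_opp_iff.1 ho)
      rw [hag.1, Function.update_self] at h1
      exact h1 ▸ (hΦ ρ hρ hag).2 1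
    · obtain ⟨σ, hσ, hΦ⟩ := h.2 v hv
      obtain ⟨ρ, hρ, hag, -⟩ := exists_play hG (h.1 hv) hσ f fun u hu _ => ⟨hf u hu, hfe u hu⟩
      have h2 := (hρ 0).2
      rw [hag.1] at h2
      exact ⟨ρ 1, (hΦ ρ hρ hag).2 1, h2⟩
  obtain ⟨A, B, hAB, hA, hB⟩ := exists_posDominions 𝒢 D (htrap.isSubgame hG) P
  have hBe : B = ∅ := by
    rw [Finset.eq_empty_iff_forall_notMem]
    intro v hv
    exact hB.not_canForce hG h.1 hv (h.2 v (hB.subset hv))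
  rw [hBe, Finset.union_empty] at hAB
  subst hAB
  exact hA.of_trap htrap

/-- Neither of the two dominions of positional determinacy can be enlarged, because in each the
owner's positional strategy defeats any strategy of the other player. -/
theorem exists_winRegions (hG : 𝒢.IsSubgame G) (P : Player) :
    𝒢.winRegion P G ∪ 𝒢.winRegion P.opp G = G ∧
      𝒢.IsPosDominion P G (𝒢.winRegion P G) ∧
      𝒢.IsPosDominion P.opp G (𝒢.winRegion P.opp G) := by
  obtain ⟨A, B, hAB, hA, hB⟩ := exists_posDominions 𝒢 G hG P
  have key : ∀ (Q : Player) (A B : Finset V), A ∪ B = G → 𝒢.IsPosDominion Q G A →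
      𝒢.IsPosDominion Q.opp G B → 𝒢.winRegion Q G = A := by
    intro Q A B hAB hA hB
    ext v
    simp only [winRegion, Finset.mem_filter]
    constructor
    · rintro ⟨hvG, σ, hσ, hw⟩
      rw [← hAB, Finset.mem_union] at hvG
      refine hvG.resolve_right fun hvB => hB.not_canForce hG subset_rfl hvB
        ⟨σ, hσ, fun ρ hρ hag => ⟨hw ρ hρ hag, fun i => (hρ i).1⟩⟩
    · intro hv
      obtain ⟨σ, hσ, hw⟩ := hA.canForce hG hv
      exact ⟨hA.subset hv, σ, hσ, fun ρ hρ hag => (hw ρ hρ hag).1⟩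
  rw [key P A B hAB hA hB,
    key P.opp B A (by rw [Finset.union_comm, hAB]) hB (by simpa using hA)]
  exact ⟨hAB, hA, hB⟩

theorem not_isPosDominion_of_disjoint (hG : 𝒢.IsSubgame G) {A B : Finset V}
    (hA : 𝒢.IsPosDominion P G A) (hB : 𝒢.IsPosDominion P.opp G B) : Disjoint A B := by
  rw [Finset.disjoint_left]
  intro v hvA hvB
  refine hB.not_canForce hG subset_rfl hvB ?_
  obtain ⟨σ, hσ, hw⟩ := hA.canForce hG hvA
  exact ⟨σ, hσ, fun ρ hρ hag => ⟨(hw ρ hρ hag).1, fun i => (hρ i).1⟩⟩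

end Determinacy

/-! ### Correctness of the recursion and the number of calls -/

section Solve

variable {V : Type*} {𝒢 : ParityGame V} {P : Player} {G D : Finset V}
  {d p q : ℕ}

/-- A dominion induces a subgame and there are no self-loops, so a vertex brings along a second one.
This justifies stopping already at `q ≤ 1`. -/
theorem IsPosDominion.eq_empty_of_card_le_one (h : 𝒢.IsPosDominion P G D) (hG : 𝒢.IsSubgame G)
    (hc : D.card ≤ 1) : D = ∅ := by
  rw [Finset.eq_empty_iff_forall_notMem]
  intro v hv
  obtain ⟨w, hw, he⟩ := (h.isTrap.isSubgame hG) v hv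
  obtain rfl := Finset.card_le_one.1 hc v hv w hw
  exact 𝒢.no_loop v he

/-- The set `R` separates the dominions of `P` of size at most `p` from those of the opponent of
size at most `q`. -/
structure Separates (𝒢 : ParityGame V) (P : Player) (G : Finset V) (p q : ℕ) (R : Finset V) :
    Prop where
  trap : 𝒢.IsTrap P.opp G R
  own : ∀ D, 𝒢.IsPosDominion P G D → D.card ≤ p → D ⊆ R
  other : ∀ D, 𝒢.IsPosDominion P.opp G D → D.card ≤ q → Disjoint R D

theorem Separates.of_le_one (hG : 𝒢.IsSubgame G) (hq : G = ∅ ∨ q ≤ 1) :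
    𝒢.Separates P G p q G := by
  refine ⟨.refl hG, fun D hD _ => hD.subset, fun D hD hc => ?_⟩
  rcases hq with rfl | hq
  · exact Finset.disjoint_empty_left D
  · rw [hD.eq_empty_of_card_le_one hG (hc.trans hq)]
    exact Finset.disjoint_empty_right G

variable [DecidableEq V]

theorem solve_zero : 𝒢.solve P G 0 p q = G := by rw [solve]

theorem solve_base (h : G = ∅ ∨ q ≤ 1) : 𝒢.solve P G (d + 1) p q = G := by
  rw [solve, dif_pos h]

/-- The argument of the recursive call for the opponent. -/
noncomputable def restSet (𝒢 : ParityGame V) (P : Player) (d : ℕ) (G₁ : Finset V) : Finset V :=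
  G₁ \ 𝒢.attr P (G₁.filter fun v => 𝒢.prio v = d) G₁

theorem solve_step (h : ¬ (G = ∅ ∨ q ≤ 1)) {G₁ W : Finset V}
    (hG₁ : 𝒢.solve P G (d + 1) p (q / 2) = G₁)
    (hW : 𝒢.solve P.opp (𝒢.restSet P (d + 1) G₁) d q p = W) :
    𝒢.solve P G (d + 1) p q = 𝒢.solve P (G₁ \ 𝒢.attr P.opp W G₁) (d + 1) p (q / 2) := by
  subst hG₁ hW
  conv_lhs => rw [solve, dif_neg h]
  rfl

theorem calls_zero : 𝒢.calls P G 0 p q = [⟨P, G, 0, p, q⟩] := by rw [calls]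

theorem calls_base (h : G = ∅ ∨ q ≤ 1) :
    𝒢.calls P G (d + 1) p q = [⟨P, G, d + 1, p, q⟩] := by
  rw [calls, dif_pos h]

theorem calls_step (h : ¬ (G = ∅ ∨ q ≤ 1)) {G₁ W : Finset V}
    (hG₁ : 𝒢.solve P G (d + 1) p (q / 2) = G₁)
    (hW : 𝒢.solve P.opp (𝒢.restSet P (d + 1) G₁) d q p = W) :
    𝒢.calls P G (d + 1) p q = ⟨P, G, d + 1, p, q⟩ ::
      (𝒢.calls P G (d + 1) p (q / 2) ++ (𝒢.calls P.opp (𝒢.restSet P (d + 1) G₁) d q p ++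
        𝒢.calls P (G₁ \ 𝒢.attr P.opp W G₁) (d + 1) p (q / 2))) := by
  subst hG₁ hW
  conv_lhs => rw [calls, dif_neg h]
  rfl

theorem restSet_trap (hG : 𝒢.IsSubgame G) : 𝒢.IsTrap P G (𝒢.restSet P d G) :=
  (attr_spec hG (Finset.filter_subset _ _)).2.1

theorem restSet_prio_lt (hG : 𝒢.IsSubgame G) (hd : ∀ v ∈ G, 𝒢.prio v ≤ d + 1) :
    ∀ v ∈ 𝒢.restSet P (d + 1) G, 𝒢.prio v ≤ d := by
  intro v hv
  obtain ⟨hvG, hva⟩ := Finset.mem_sdiff.1 hv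
  have h1 := hd v hvG
  by_contra hn
  exact hva ((attr_spec hG (Finset.filter_subset _ _)).1
    (Finset.mem_filter.2 ⟨hvG, by omega⟩))

/-- If the opponent wins everywhere, but does not like the highest priority, then the opponent has
a nonempty dominion outside of the attractor of the vertices of this priority. -/
theorem IsPosDominion.exists_restSet (hG : 𝒢.IsSubgame G) (hd : ∀ v ∈ G, 𝒢.prio v ≤ d)
    (hP : P = Player.ofParity d) (h : 𝒢.IsPosDominion P.opp G G) (hne : G.Nonempty) :
    ∃ B, B.Nonempty ∧ 𝒢.IsPosDominion P.opp (𝒢.restSet P d G) B := by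
  obtain ⟨A, B, hAB, hA, hB⟩ :=
    exists_posDominions 𝒢 (𝒢.restSet P d G) ((restSet_trap hG).isSubgame hG) P
  refine ⟨B, ?_, hB⟩
  by_contra hBe
  rw [Finset.not_nonempty_iff_eq_empty] at hBe
  rw [hBe, Finset.union_empty] at hAB
  subst hAB
  have h1 := not_isPosDominion_of_disjoint hG (IsPosDominion.of_top hG hd hP rfl hA) h
  rw [Finset.disjoint_self_iff_empty] at h1
  exact hne.ne_empty h1

/-- The first and the third call handle only half of the precision `q`. The middle call suffices in
between because it captures the part in `G₁` of one dominion of the opponent that has more than `q /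
2` vertices. -/
theorem Separates.step (hG : 𝒢.IsSubgame G) (hd : ∀ v ∈ G, 𝒢.prio v ≤ d)
    (hP : P = Player.ofParity d) {G₁ W R : Finset V}
    (h₁ : 𝒢.Separates P G p (q / 2) G₁)
    (hW : 𝒢.Separates P.opp (𝒢.restSet P d G₁) q p W)
    (hR : 𝒢.Separates P (G₁ \ 𝒢.attr P.opp W G₁) p (q / 2) R) :
    𝒢.Separates P G p q R := by
  have hG₁ : 𝒢.IsSubgame G₁ := h₁.trap.isSubgame hG
  have hHtrap : 𝒢.IsTrap P G₁ (𝒢.restSet P d G₁) := restSet_trap hG₁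
  have hWG₁ : W ⊆ G₁ := hW.trap.subset.trans hHtrap.subset
  obtain ⟨hWA, hG₂trap, -⟩ := attr_spec (P := P.opp) hG₁ hWG₁
  set A := 𝒢.attr P.opp W G₁ with hA
  set G₂ := G₁ \ A with hG₂
  have hG₂' : 𝒢.IsTrap P.opp G G₂ := h₁.trap.trans hG₂trap
  refine ⟨hG₂'.trans hR.trap, fun D hD hc => ?_, fun D hD hc => ?_⟩
  · have hDG₁ : D ⊆ G₁ := h₁.own D hD hc
    have hD₁ : 𝒢.IsPosDominion P G₁ D := hD.mono hDG₁ h₁.trap.subset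
    -- In the middle call the roles are exchanged: there `D` is a dominion of the other side, whose
    -- precision is `p`.
    have hdis : Disjoint W (D ∩ 𝒢.restSet P d G₁) := by
      refine hW.other _ ?_ ((Finset.card_le_card Finset.inter_subset_left).trans hc)
      rw [Player.opp_opp]
      exact hD₁.inter_trap hHtrap
    have hDW : Disjoint D W := by
      rw [Finset.disjoint_left] at hdis ⊢
      exact fun v hv hvW => hdis hvW (Finset.mem_inter.2 ⟨hv, hW.trap.subset hvW⟩)
    have hDA := hD₁.isTrap.disjoint_attr hG₁ hDW
    have hDG₂ : D ⊆ G₂ := fun v hv =>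
      Finset.mem_sdiff.2 ⟨hDG₁ hv, Finset.disjoint_left.1 hDA hv⟩
    exact hR.own D (hD.mono hDG₂ hG₂'.subset) hc
  · have hDtrap : 𝒢.IsTrap P G D := by simpa using hD.isTrap
    have hDsub : 𝒢.IsSubgame D := hDtrap.isSubgame hG
    -- a maximal dominion inside of `D` that is disjoint from `G₁`
    classical
    obtain ⟨X, hX, hXmax⟩ := (D.powerset.filter fun X =>
      𝒢.IsPosDominion P.opp G X ∧ Disjoint X G₁).exists_max_image Finset.card
      ⟨∅, by simp [IsPosDominion.empty]⟩
    simp only [Finset.mem_filter, Finset.mem_powerset] at hX hXmax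
    obtain ⟨hXD, hXdom, hXG₁⟩ := hX
    by_cases hDX : D ⊆ X
    · exact (hXG₁.symm.mono_right hDX).mono_left (hR.trap.subset.trans hG₂trap.subset)
    have hDdom : 𝒢.IsPosDominion P.opp D D := hD.mono subset_rfl hD.subset
    have hXdomD : 𝒢.IsPosDominion P.opp D X := hXdom.mono hXD hD.subset
    have hoftrap : ∀ Y, 𝒢.IsPosDominion P.opp D Y → 𝒢.IsPosDominion P.opp G Y :=
      fun Y hY => hY.of_trap (by simpa using hDtrap)
    have hinter : 𝒢.IsTrap P.opp D (D ∩ G₁) := by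
      refine ⟨Finset.inter_subset_left, fun v hv ho w hw he => ?_, fun v hv ho => ?_⟩
      · rw [Finset.mem_inter] at hv ⊢
        exact ⟨hw, h₁.trap.closed v hv.2 ho w (hD.subset hw) he⟩
      · rw [Finset.mem_inter] at hv
        obtain ⟨w, hw, he⟩ := h₁.trap.exists_succ v hv.2 ho
        refine ⟨w, Finset.mem_inter.2 ⟨hD.closed v hv.1 ho w (h₁.trap.subset hw) he, hw⟩, he⟩
    -- The attractor of `X` in `D` is again a dominion, and it still avoids `G₁`, since `D ∩ G₁` is
    -- a trap for the opponent in `D`. Maximality of `X` gives equality.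
    have hXattr : 𝒢.attr P.opp X D = X := by
      have hsub := (attr_spec (P := P.opp) hDsub hXD).1
      refine (Finset.eq_of_subset_of_card_le hsub (hXmax _
        ⟨attr_subset, hoftrap _ (hXdomD.attr hDsub), ?_⟩)).symm
      have h2 : Disjoint (D ∩ G₁) X := hXG₁.symm.mono_left Finset.inter_subset_right
      have h3 := hinter.disjoint_attr hDsub h2
      rw [Finset.disjoint_left] at h3 ⊢
      exact fun v hv hvG => h3 (Finset.mem_inter.2 ⟨attr_subset hv, hvG⟩) hv
    have hrest : 𝒢.IsTrap P.opp D (D \ X) := by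
      have := (attr_spec (P := P.opp) hDsub hXD).2.1
      rwa [hXattr] at this
    have hrestsub : 𝒢.IsSubgame (D \ X) := hrest.isSubgame hDsub
    have hrestdom : 𝒢.IsPosDominion P.opp (D \ X) (D \ X) := by
      have := hDdom.inter_trap hrest
      rwa [Finset.inter_eq_right.2 Finset.sdiff_subset] at this
    have hrestne : (D \ X).Nonempty := by
      rw [Finset.nonempty_iff_ne_empty, Ne, Finset.sdiff_eq_empty_iff_subset]
      exact hDX
    obtain ⟨B, hBne, hB⟩ := IsPosDominion.exists_restSet hrestsub
      (fun v hv => hd v (hD.subset (Finset.sdiff_subset hv))) hP hrestdom hrestne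
    have hB' : 𝒢.IsPosDominion P.opp (D \ X) B :=
      hB.of_trap (by simpa using restSet_trap hrestsub)
    have hYdom : 𝒢.IsPosDominion P.opp G (X ∪ B) := hoftrap _ (hXdomD.union hB')
    have hXB : Disjoint X B := Finset.disjoint_right.2 fun v hv hx =>
      (Finset.mem_sdiff.1 (hB'.subset hv)).2 hx
    have hYD : X ∪ B ⊆ D :=
      Finset.union_subset hXD (hB'.subset.trans Finset.sdiff_subset)
    -- A smaller `X ∪ B` would have been removed by the first call, against the maximality of `X`.
    have hYcard : q / 2 < (X ∪ B).card := by
      by_contra hle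
      have hdis := h₁.other _ hYdom (not_lt.1 hle)
      have := hXmax _ ⟨hYD, hYdom, hdis.symm⟩
      rw [Finset.card_union_of_disjoint hXB] at this
      have := hBne.card_pos
      omega
    -- the part of `B` in `G₁` is found by the opponent
    have hBW : B ∩ G₁ ⊆ W := by
      have ht1 : 𝒢.IsTrap P.opp (D \ X) (D ∩ G₁) := by
        refine ⟨fun v hv => ?_, fun v hv ho w hw he => ?_, hinter.exists_succ⟩
        · rw [Finset.mem_inter] at hv
          exact Finset.mem_sdiff.2 ⟨hv.1, Finset.disjoint_right.1 hXG₁ hv.2⟩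
        · exact hinter.closed v hv ho w (Finset.sdiff_subset hw) he
      have hd1 := hB'.inter_trap ht1
      -- The dominion `B` is transported in two moves: it is cut down to `D ∩ G₁`, a trap for the
      -- opponent, and then lifted to `G₁`, where `D ∩ G₁` is a trap for `P`.
      have ht2 : 𝒢.IsTrap P.opp.opp G₁ (D ∩ G₁) := (hD.inter_trap h₁.trap).isTrap
      have hd2 := hd1.of_trap ht2
      have heq : B ∩ (D ∩ G₁) = B ∩ G₁ := by
        rw [← Finset.inter_assoc, Finset.inter_eq_left.2 (hB'.subset.trans Finset.sdiff_subset)]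
      rw [heq] at hd2
      have ht3 : 𝒢.IsTrap P G₁ (B ∩ G₁) := by simpa using hd2.isTrap
      have hdisN : Disjoint (B ∩ G₁) (G₁.filter fun v => 𝒢.prio v = d) := by
        rw [Finset.disjoint_left]
        intro v hv hvN
        rw [Finset.mem_inter] at hv
        have hvX := hB.subset hv.1
        exact (Finset.mem_sdiff.1 hvX).2
          ((attr_spec hrestsub (Finset.filter_subset _ _)).1
            (Finset.mem_filter.2 ⟨hB'.subset hv.1, (Finset.mem_filter.1 hvN).2⟩))
      have hdisA := ht3.disjoint_attr hG₁ hdisN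
      have hsub : B ∩ G₁ ⊆ 𝒢.restSet P d G₁ := fun v hv =>
        Finset.mem_sdiff.2 ⟨(Finset.mem_inter.1 hv).2, Finset.disjoint_left.1 hdisA hv⟩
      refine hW.own _ (hd2.mono hsub hHtrap.subset) ((Finset.card_le_card ?_).trans hc)
      exact Finset.inter_subset_left.trans (hB'.subset.trans Finset.sdiff_subset)
    have hYG₂ : Disjoint (X ∪ B) G₂ := by
      rw [Finset.disjoint_right]
      intro v hv hvY
      obtain ⟨hv1, hv2⟩ := Finset.mem_sdiff.1 hv
      rcases Finset.mem_union.1 hvY with h | h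
      · exact Finset.disjoint_left.1 hXG₁ h hv1
      · exact hv2 (hWA (hBW (Finset.mem_inter.2 ⟨h, hv1⟩)))
    -- At least `q / 2 + 1` of at most `q` vertices are gone; the rounding works for odd `q` as
    -- well.
    have hcard : (D ∩ G₂).card ≤ q / 2 := by
      have h1 : D ∩ G₂ ⊆ D \ (X ∪ B) := fun v hv => by
        rw [Finset.mem_inter] at hv
        exact Finset.mem_sdiff.2 ⟨hv.1, Finset.disjoint_right.1 hYG₂ hv.2⟩
      have h2 := Finset.card_le_card h1
      rw [Finset.card_sdiff_of_subset hYD] at h2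
      omega
    have hfin := hR.other _ (hD.inter_trap hG₂') hcard
    rw [Finset.disjoint_left] at hfin ⊢
    exact fun v hv hvD => hfin hv (Finset.mem_inter.2 ⟨hvD, hR.trap.subset hv⟩)

/-- The outer induction on `d` serves the middle call, the inner one on `q` the other two. For `d =
0` the set is empty because priorities are positive. -/
theorem separates_solve (hG : 𝒢.IsSubgame G) (hd : ∀ v ∈ G, 𝒢.prio v ≤ d)
    (hP : P = Player.ofParity d) : 𝒢.Separates P G p q (𝒢.solve P G d p q) := by
  induction d generalizing P G p q with
  | zero =>
    have hGe : G = ∅ := by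
      rw [Finset.eq_empty_iff_forall_notMem]
      intro v hv
      have := hd v hv
      have := 𝒢.prio_pos v
      omega
    rw [solve_zero]
    exact .of_le_one hG (.inl hGe)
  | succ d ihd =>
    induction q using Nat.strong_induction_on generalizing G with
    | _ q ihq =>
    by_cases hb : G = ∅ ∨ q ≤ 1
    · rw [solve_base hb]
      exact .of_le_one hG hb
    · rw [solve_step hb rfl rfl]
      have hq : q / 2 < q := by omega
      have h₁ := ihq (q / 2) hq hG hd
      have hG₁ := h₁.trap.isSubgame hG
      have hd₁ : ∀ v ∈ 𝒢.solve P G (d + 1) p (q / 2), 𝒢.prio v ≤ d + 1 :=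
        fun v hv => hd v (h₁.trap.subset hv)
      have hW := ihd (P := P.opp) (p := q) (q := p)
        ((restSet_trap (P := P) (d := d + 1) hG₁).isSubgame hG₁)
        (restSet_prio_lt hG₁ hd₁) (by rw [hP, Player.ofParity_succ, Player.opp_opp])
      have hG₂ := (attr_spec (P := P.opp) hG₁
        (hW.trap.subset.trans (restSet_trap hG₁).subset)).2.1
      exact .step hG hd hP h₁ hW
        (ihq (q / 2) hq (hG₂.isSubgame hG₁) fun v hv => hd₁ v (hG₂.subset hv))

theorem solve_card_eq (hG : 𝒢.IsSubgame G) (hd : ∀ v ∈ G, 𝒢.prio v ≤ d)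
    (hP : P = Player.ofParity d) :
    𝒢.solve P G d G.card G.card = 𝒢.winRegion P G ∧
      G \ 𝒢.solve P G d G.card G.card = 𝒢.winRegion P.opp G := by
  have h := separates_solve (p := G.card) (q := G.card) hG hd hP
  obtain ⟨hun, hA, hB⟩ := exists_winRegions hG P
  have h1 := h.own _ hA (Finset.card_le_card hA.subset)
  have h2 := h.other _ hB (Finset.card_le_card hB.subset)
  have h3 : 𝒢.solve P G d G.card G.card = 𝒢.winRegion P G := by
    refine Finset.Subset.antisymm (fun v hv => ?_) h1
    have := h.trap.subset hv
    rw [← hun, Finset.mem_union] at this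
    exact this.resolve_right (Finset.disjoint_left.1 h2 hv)
  refine ⟨h3, ?_⟩
  rw [h3]
  have h4 := not_isPosDominion_of_disjoint hG hA hB
  have h5 := Finset.union_sdiff_cancel_left h4
  rwa [hun] at h5

/-- The added `1` absorbs the call itself: with three subcalls the quantities on the left satisfy `N
= N₁ + N₂ + N₃ - 1`. The factor `2` per level of `l` pays for the two halving calls, and Pascal's
rule adds the middle one. -/
theorem length_calls_le {l : ℕ} (hp : 1 ≤ p) (hq : 1 ≤ q)
    (hl : l = Nat.log 2 p + Nat.log 2 q) :
    (𝒢.calls P G d p q).length + 1 ≤ 2 ^ (l + 1) * (d + l).choose l := by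
  induction d generalizing P G p q l with
  | zero =>
    rw [calls_zero]
    have : 1 ≤ 2 ^ l := Nat.one_le_two_pow
    simp [pow_succ]; omega
  | succ d ihd =>
    induction q using Nat.strong_induction_on generalizing G l with
    | _ q ihq =>
    by_cases hb : G = ∅ ∨ q ≤ 1
    · rw [calls_base hb]
      have h1 : 2 ^ 1 ≤ 2 ^ (l + 1) := Nat.pow_le_pow_right (by norm_num) (by omega)
      have h2 : 0 < (d + 1 + l).choose l := Nat.choose_pos (by omega)
      simp only [List.length_singleton]
      nlinarith
    · rw [calls_step hb rfl rfl]
      push Not at hb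
      have hlog : Nat.log 2 q = Nat.log 2 (q / 2) + 1 :=
        Nat.log_of_one_lt_of_le (by norm_num) (by omega)
      obtain ⟨l, rfl⟩ : ∃ k, l = k + 1 := ⟨Nat.log 2 p + Nat.log 2 (q / 2), by omega⟩
      have hl' : l = Nat.log 2 p + Nat.log 2 (q / 2) := by omega
      have h1 := ihq (q / 2) (by omega) (G := G) (by omega) hl'
      set G₁ := 𝒢.solve P G (d + 1) p (q / 2)
      set W := 𝒢.solve P.opp (𝒢.restSet P (d + 1) G₁) d q p
      have h2 := ihd (P := P.opp) (G := 𝒢.restSet P (d + 1) G₁) (p := q) (q := p) hq hp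
        (by rw [hl, add_comm] : l + 1 = _)
      have h3 := ihq (q / 2) (by omega) (G := G₁ \ 𝒢.attr P.opp W G₁) (by omega) hl'
      simp only [List.length_cons, List.length_append]
      have hch : (d + 1 + (l + 1)).choose (l + 1) =
          (d + 1 + l).choose l + (d + (l + 1)).choose (l + 1) := by
        rw [show d + 1 + (l + 1) = (d + 1 + l) + 1 by omega, Nat.choose_succ_succ,
          show d + 1 + l = d + (l + 1) by omega]
      rw [hch, Nat.mul_add]
      have h4 : 2 ^ (l + 1 + 1) * (d + 1 + l).choose l =
          2 * (2 ^ (l + 1) * (d + 1 + l).choose l) := by ring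
      omega

end Solve

end ParityGame

/-! ### Numerical estimates -/

section Bounds

open Real

theorem choose_le_exp_mul (d l : ℕ) (hl : 0 < l) :
    ((d + l).choose l : ℝ) ≤ exp l * (1 + d / l) ^ l := by
  have hl' : (0 : ℝ) < l := by exact_mod_cast hl
  have h1 : ((d + l).choose l : ℝ) ≤ ((d + l : ℕ) : ℝ) ^ l / (l.factorial : ℝ) :=
    Nat.choose_le_pow_div l (d + l)
  have h2 : ((l : ℝ) ^ l) / (l.factorial : ℝ) ≤ exp l := Real.pow_div_factorial_le_exp l hl'.le l
  have h3 : ((d + l : ℕ) : ℝ) = l * (1 + d / l) := by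
    push_cast; field_simp; ring
  rw [h3, mul_pow, mul_div_right_comm] at h1
  exact h1.trans (by gcongr)

/-- Bernoulli's inequality with exponent `x / l ≥ 1`. It removes the rounding of the logarithm from
the base and the exponent at the same time. -/
theorem one_add_div_pow_le {d x : ℝ} {l : ℕ} (hd : 0 ≤ d) (hl : 0 < l) (hx : (l : ℝ) ≤ x) :
    (1 + d / l) ^ l ≤ (1 + d / x) ^ x := by
  have hl' : (0 : ℝ) < l := by exact_mod_cast hl
  have hx' : 0 < x := hl'.trans_le hx
  have hy : 0 ≤ d / x := div_nonneg hd hx'.le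
  have h1 : 1 + x / l * (d / x) ≤ (1 + d / x) ^ (x / l) :=
    one_add_mul_self_le_rpow_one_add (by linarith) ((one_le_div hl').2 hx)
  have h2 : x / l * (d / x) = d / l := by field_simp
  rw [h2] at h1
  calc (1 + d / l) ^ l ≤ ((1 + d / x) ^ (x / l)) ^ l := by gcongr
    _ = (1 + d / x) ^ x := by
      rw [← rpow_natCast, ← rpow_mul (by linarith)]
      congr 1
      field_simp

/-- With `x = 2 log n` the three factors of the bound become powers of `n`: `2 ^ l` gives exponent
`2`, `exp l` gives `2 / ln 2 < 2.9`, and `(1 + d / x) ^ x` gives `2 log (1 + d / x)`. -/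
theorem two_pow_mul_choose_le (n d : ℕ) (hn : 2 ≤ n) :
    ((2 ^ (2 * Nat.log 2 n + 1) * (d + 2 * Nat.log 2 n).choose (2 * Nat.log 2 n) : ℕ) : ℝ) ≤
      2 * (n : ℝ) ^ ((4.9 : ℝ) + 2 * logb 2 (1 + d / (2 * logb 2 n))) := by
  set l := 2 * Nat.log 2 n with hl
  set x := 2 * logb 2 n with hx
  have hn' : (2 : ℝ) ≤ n := by exact_mod_cast hn
  have hn0 : (0 : ℝ) < n := by linarith
  have hlog2 : 0 < log 2 := log_pos (by norm_num)
  have hlpos : 0 < l := by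
    have := Nat.log_pos (b := 2) (by norm_num) hn
    omega
  have hlx : (l : ℝ) ≤ x := by
    have h1 : ((Nat.log 2 n : ℕ) : ℝ) ≤ logb 2 n := by
      have := Real.natLog_le_logb n 2
      simpa using this
    rw [hl, hx]; push_cast; linarith
  have hx0 : 0 < x := lt_of_lt_of_le (by exact_mod_cast hlpos) hlx
  have hd0 : (0 : ℝ) ≤ d := Nat.cast_nonneg d
  have hy : 0 < 1 + d / x := by positivity
  have hxl : x * log 2 = 2 * log n := by
    rw [hx, logb]; field_simp
  have h1 : (n : ℝ) ^ (2 * logb 2 (1 + d / x)) = (1 + d / x) ^ x := by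
    rw [rpow_def_of_pos hn0, rpow_def_of_pos hy, logb]
    congr 1
    generalize log (1 + d / x) = y
    field_simp
    linear_combination -y * hxl
  have h2 : (2 : ℝ) ^ l ≤ (n : ℝ) ^ (2 : ℝ) := by
    calc (2 : ℝ) ^ l = (2 : ℝ) ^ (l : ℝ) := (rpow_natCast _ _).symm
      _ ≤ (2 : ℝ) ^ x := rpow_le_rpow_of_exponent_le (by norm_num) hlx
      _ = (n : ℝ) ^ (2 : ℝ) := by
        rw [rpow_def_of_pos hn0, rpow_def_of_pos (by norm_num)]
        congr 1
        linarith
  have h3 : exp l ≤ (n : ℝ) ^ (2.9 : ℝ) := by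
    rw [rpow_def_of_pos hn0]
    apply exp_le_exp.2
    have hlogn : 0 ≤ log n := log_nonneg (by linarith)
    have h4 := Real.log_two_gt_d9
    nlinarith
  calc ((2 ^ (l + 1) * (d + l).choose l : ℕ) : ℝ)
      = 2 * (2 ^ l * ((d + l).choose l : ℝ)) := by push_cast; ring
    _ ≤ 2 * ((n : ℝ) ^ (2 : ℝ) * ((n : ℝ) ^ (2.9 : ℝ) * (1 + d / x) ^ x)) := by
        have h5 := choose_le_exp_mul d l hlpos
        have h6 := one_add_div_pow_le hd0 hlpos hlx
        gcongr
        exact h5.trans (by gcongr)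
    _ = 2 * (n : ℝ) ^ ((4.9 : ℝ) + 2 * logb 2 (1 + d / x)) := by
        rw [rpow_add hn0, h1, show (4.9 : ℝ) = 2 + 2.9 by norm_num, rpow_add hn0]
        ring

variable {n : ℕ}

theorem ParityGame.two_le_of_pos (𝒢 : ParityGame (Fin n)) (hn : 0 < n) : 2 ≤ n := by
  obtain ⟨w, hw⟩ := 𝒢.total ⟨0, hn⟩
  by_contra h
  have : w = ⟨0, hn⟩ := Fin.ext (by have := w.2; simp; omega)
  exact 𝒢.no_loop _ (this ▸ hw)

/-- Since `n ≥ 2`, the constant is at most a fixed power of `n`, and `m ≤ n ^ 2` raises the exponent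
`4.9` to `6.9`. -/
theorem time_bound_le (𝒢 : ParityGame (Fin n)) (hn : 0 < n) (d : ℕ) (C : ℝ) :
    C * (𝒢.edges.card * (n : ℝ) ^ ((4.9 : ℝ) + 2 * logb 2 (1 + d / (2 * logb 2 n)))) ≤
      (n : ℝ) ^ (|logb 2 (abs C)| + 6.9 + 2 * logb 2 (1 + d / logb 2 n)) := by
  have hn2 := 𝒢.two_le_of_pos hn
  have hn' : (2 : ℝ) ≤ n := by exact_mod_cast hn2
  have hn0 : (0 : ℝ) < n := by linarith
  have hlogn : 0 < logb 2 n := logb_pos (by norm_num) (by linarith)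
  have hC : C ≤ (n : ℝ) ^ |logb 2 (abs C)| := by
    rcases eq_or_ne C 0 with rfl | h0
    · positivity
    calc C ≤ |C| := le_abs_self C
      _ = (2 : ℝ) ^ logb 2 (abs C) :=
        (rpow_logb (by norm_num) (by norm_num) (abs_pos.2 h0)).symm
      _ ≤ (2 : ℝ) ^ |logb 2 (abs C)| := rpow_le_rpow_of_exponent_le (by norm_num) (le_abs_self _)
      _ ≤ (n : ℝ) ^ |logb 2 (abs C)| := rpow_le_rpow (by norm_num) hn' (abs_nonneg _)
  have hm : (𝒢.edges.card : ℝ) ≤ (n : ℝ) ^ (2 : ℝ) := by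
    have h := Finset.card_le_univ 𝒢.edges
    rw [Fintype.card_prod, Fintype.card_fin] at h
    rw [show (2 : ℝ) = ((2 : ℕ) : ℝ) by norm_num, rpow_natCast, sq]
    exact_mod_cast h
  have hexp : (4.9 : ℝ) + 2 * logb 2 (1 + d / (2 * logb 2 n)) ≤
      4.9 + 2 * logb 2 (1 + d / logb 2 n) := by
    have : (d : ℝ) / (2 * logb 2 n) ≤ d / logb 2 n :=
      div_le_div_of_nonneg_left (Nat.cast_nonneg d) hlogn (by linarith)
    have h2 : logb 2 (1 + d / (2 * logb 2 n)) ≤ logb 2 (1 + d / logb 2 n) :=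
      logb_le_logb_of_le (by norm_num) (by positivity) (by linarith)
    linarith
  calc C * (𝒢.edges.card * (n : ℝ) ^ ((4.9 : ℝ) + 2 * logb 2 (1 + d / (2 * logb 2 n))))
      ≤ (n : ℝ) ^ |logb 2 (abs C)| * ((n : ℝ) ^ (2 : ℝ) *
          (n : ℝ) ^ (4.9 + 2 * logb 2 (1 + d / logb 2 n))) := by
        gcongr
        linarith
    _ = _ := by
        rw [← rpow_add hn0, ← rpow_add hn0]
        congr 1
        ring

theorem exists_quasipolynomial_bound (C : ℝ) :
    ∃ B : ℝ, ∀ (n : ℕ) (𝒢 : ParityGame (Fin n)) (d : ℕ), 0 < n → (∀ v, 𝒢.prio v ≤ d) →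
      C * (𝒢.edges.card * (n : ℝ) ^ ((4.9 : ℝ) + 2 * logb 2 (1 + d / (2 * logb 2 n)))) ≤
        (n : ℝ) ^ (B * (1 + logb 2 (1 + d / logb 2 n))) := by
  refine ⟨|logb 2 (abs C)| + 6.9, fun n 𝒢 d hn _ => (time_bound_le 𝒢 hn d C).trans ?_⟩
  have hn2 : (2 : ℝ) ≤ n := by exact_mod_cast 𝒢.two_le_of_pos hn
  have hlogn : 0 < logb 2 n := logb_pos (by norm_num) (by linarith)
  have h0 : 0 ≤ logb 2 (1 + d / logb 2 n) :=
    logb_nonneg (by norm_num) (by linarith [div_nonneg (Nat.cast_nonneg (α := ℝ) d) hlogn.le])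
  refine rpow_le_rpow_of_exponent_le (by linarith) ?_
  nlinarith [abs_nonneg (logb 2 (abs C))]

/-- For `d ≥ c log n` the logarithm in the exponent is at least `log (1 + c) > 0`, so a multiple of
it absorbs the additive constant. -/
theorem exists_quasipolynomial_bound_of_le (C c : ℝ) (hc : 0 < c) :
    ∃ B : ℝ, ∀ (n : ℕ) (𝒢 : ParityGame (Fin n)) (d : ℕ), 0 < n → (∀ v, 𝒢.prio v ≤ d) →
      c * logb 2 n ≤ d →
      C * (𝒢.edges.card * (n : ℝ) ^ ((4.9 : ℝ) + 2 * logb 2 (1 + d / (2 * logb 2 n)))) ≤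
        (n : ℝ) ^ (B * logb 2 (1 + d / logb 2 n)) := by
  have hμ : 0 < logb 2 (1 + c) := logb_pos (by norm_num) (by linarith)
  refine ⟨(|logb 2 (abs C)| + 6.9) / logb 2 (1 + c) + 2,
    fun n 𝒢 d hn _ hcd => (time_bound_le 𝒢 hn d C).trans ?_⟩
  have hn2 : (2 : ℝ) ≤ n := by exact_mod_cast 𝒢.two_le_of_pos hn
  have hlogn : 0 < logb 2 n := logb_pos (by norm_num) (by linarith)
  have h0 : logb 2 (1 + c) ≤ logb 2 (1 + d / logb 2 n) := by
    refine logb_le_logb_of_le (by norm_num) (by linarith) ?_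
    have := (le_div_iff₀ hlogn).2 hcd
    linarith
  refine rpow_le_rpow_of_exponent_le (by linarith) ?_
  rw [add_mul]
  have h1 : |logb 2 (abs C)| + 6.9 ≤
      (|logb 2 (abs C)| + 6.9) / logb 2 (1 + c) * logb 2 (1 + d / logb 2 n) := by
    rw [div_mul_eq_mul_div, le_div_iff₀ hμ]
    have := abs_nonneg (logb 2 (abs C))
    exact mul_le_mul_of_nonneg_left h0 (by linarith)
  linarith

end Bounds

/-! ### Verification conditions for machine programs -/

namespace Ram

namespace Store

/-- Assignment to a register. -/
def setReg (s : Store) (r x : ℕ) : Store := ⟨Function.update s.reg r x, s.arr⟩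

/-- Assignment to an array cell. -/
def setArr (s : Store) (a i x : ℕ) : Store :=
  ⟨s.reg, Function.update s.arr a (Function.update (s.arr a) i x)⟩

@[simp] theorem setReg_reg (s : Store) (r x r' : ℕ) :
    (s.setReg r x).reg r' = if r' = r then x else s.reg r' := by
  simp [setReg, Function.update_apply]

@[simp] theorem setReg_arr (s : Store) (r x : ℕ) : (s.setReg r x).arr = s.arr := rfl

@[simp] theorem setArr_reg (s : Store) (a i x : ℕ) : (s.setArr a i x).reg = s.reg := rfl

@[simp] theorem setArr_arr (s : Store) (a i x b : ℕ) :
    (s.setArr a i x).arr b = if b = a then Function.update (s.arr b) i x else s.arr b := by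
  by_cases h : b = a
  · subst h; simp [setArr]
  · simp [setArr, h]

/-- All words are below `W`. -/
structure Bounded (M W : ℕ) (s : Store) : Prop where
  reg : ∀ r, s.reg r < W
  arr : ∀ a i, i < M → s.arr a i < W

/-- The stores agree except for the listed registers and arrays. -/
structure SameExcept (R A : List ℕ) (s s' : Store) : Prop where
  reg : ∀ r, r ∉ R → s'.reg r = s.reg r
  arr : ∀ a, a ∉ A → s'.arr a = s.arr a

theorem SameExcept.trans {R A R' A' : List ℕ} {s s' s'' : Store} (h : SameExcept R A s s')
    (h' : SameExcept R' A' s' s'') : SameExcept (R ++ R') (A ++ A') s s'' := by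
  constructor
  · intro r hr
    rw [List.mem_append, not_or] at hr
    rw [h'.reg r hr.2, h.reg r hr.1]
  · intro a ha
    rw [List.mem_append, not_or] at ha
    rw [h'.arr a ha.2, h.arr a ha.1]

theorem SameExcept.mono {R A R' A' : List ℕ} {s s' : Store} (h : SameExcept R A s s')
    (hR : ∀ r ∈ R, r ∈ R') (hA : ∀ a ∈ A, a ∈ A') : SameExcept R' A' s s' :=
  ⟨fun r hr => h.reg r fun h' => hr (hR r h'), fun a ha => h.arr a fun h' => ha (hA a h')⟩

end Store

namespace Expr

/-- The part of `Safe` that is not automatic when all words are below `W`. -/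
def Ok (M W : ℕ) (s : Store) : Expr → Prop
  | const k => k < W
  | reg _ => True
  | read _ e => e.Ok M W s ∧ e.val s < M
  | add e f => e.Ok M W s ∧ f.Ok M W s ∧ e.val s + f.val s < W
  | sub e f => e.Ok M W s ∧ f.Ok M W s
  | mul e f => e.Ok M W s ∧ f.Ok M W s ∧ e.val s * f.val s < W
  | div e f => e.Ok M W s ∧ f.Ok M W s
  | lt e f => e.Ok M W s ∧ f.Ok M W s
  | eq e f => e.Ok M W s ∧ f.Ok M W s

theorem Ok.safe {M W : ℕ} {s : Store} (hW : 1 < W) (hs : s.Bounded M W) {e : Expr}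
    (h : e.Ok M W s) : e.Safe M W s := by
  induction e with
  | const k => exact h
  | reg r => exact hs.reg r
  | read a e ih => exact ⟨ih h.1, h.2, hs.arr _ _ h.2⟩
  | add e f ihe ihf => exact ⟨ihe h.1, ihf h.2.1, h.2.2⟩
  | sub e f ihe ihf => exact ⟨ihe h.1, ihf h.2⟩
  | mul e f ihe ihf => exact ⟨ihe h.1, ihf h.2.1, h.2.2⟩
  | div e f ihe ihf => exact ⟨ihe h.1, ihf h.2⟩
  | lt e f ihe ihf => exact ⟨ihe h.1, ihf h.2, hW⟩
  | eq e f ihe ihf => exact ⟨ihe h.1, ihf h.2, hW⟩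

theorem Safe.val_lt {M W : ℕ} {s : Store} {e : Expr} (h : e.Safe M W s) : e.val s < W := by
  induction e with
  | const k => exact h
  | reg r => exact h
  | read a e ih => exact h.2.2
  | add e f ihe ihf => exact h.2.2
  | sub e f ihe ihf => exact (Nat.sub_le _ _).trans_lt (ihe h.1)
  | mul e f ihe ihf => exact h.2.2
  | div e f ihe ihf => exact (Nat.div_le_self _ _).trans_lt (ihe h.1)
  | lt e f ihe ihf =>
    have h1 := h.2.2
    simp only [val]; split_ifs <;> omega
  | eq e f ihe ihf =>
    have h1 := h.2.2
    simp only [val]; split_ifs <;> omega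

end Expr

theorem Store.Bounded.setReg {M W : ℕ} {s : Store} (hs : s.Bounded M W) {r x : ℕ} (hx : x < W) :
    (s.setReg r x).Bounded M W := by
  refine ⟨fun r' => ?_, hs.arr⟩
  rw [setReg_reg]
  split_ifs
  · exact hx
  · exact hs.reg r'

theorem Store.Bounded.setArr {M W : ℕ} {s : Store} (hs : s.Bounded M W) {a i x : ℕ}
    (hx : x < W) : (s.setArr a i x).Bounded M W := by
  refine ⟨hs.reg, fun b j hj => ?_⟩
  rw [setArr_arr]
  split_ifs
  · rw [Function.update_apply]
    split_ifs
    · exact hx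
    · exact hs.arr b j hj
  · exact hs.arr b j hj

/-- Total correctness of a program fragment without marks: from the store `s` (with words below
`W`) it terminates in a store which, together with the number of steps, satisfies `Q`. -/
def Wp (M W : ℕ) (c : Prog) (Q : Store → ℕ → Prop) (s : Store) : Prop :=
  s.Bounded M W → ∃ s' t, Run M W c s s' t [] ∧ s'.Bounded M W ∧ Q s' t

/-- Verification conditions of a program fragment. -/
def vc (M W : ℕ) : Prog → (Store → ℕ → Prop) → Store → Prop
  | .set r e, Q, s => e.Ok M W s ∧ Q (s.setReg r (e.val s)) (e.cost + 1)
  | .write a i e, Q, s => i.Ok M W s ∧ e.Ok M W s ∧ i.val s < M ∧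
      Q (s.setArr a (i.val s) (e.val s)) (i.cost + e.cost + 1)
  | .seq c₁ c₂, Q, s => vc M W c₁ (fun s₁ t₁ => vc M W c₂ (fun s₂ t₂ => Q s₂ (t₁ + t₂)) s₁) s
  | .ite e c₁ c₂, Q, s => e.Ok M W s ∧
      (e.val s ≠ 0 → vc M W c₁ (fun s' t => Q s' (e.cost + 1 + t)) s) ∧
      (e.val s = 0 → vc M W c₂ (fun s' t => Q s' (e.cost + 1 + t)) s)
  | .while e c, Q, s => Wp M W (.while e c) Q s
  | .mark, _, _ => False

section Rules

variable {M W : ℕ}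

theorem Wp.mono {c : Prog} {Q Q' : Store → ℕ → Prop} {s : Store} (h : Wp M W c Q s)
    (hQ : ∀ s' t, Q s' t → Q' s' t) : Wp M W c Q' s := by
  intro hs
  obtain ⟨s', t, h1, h2, h3⟩ := h hs
  exact ⟨s', t, h1, h2, hQ _ _ h3⟩

theorem Wp.seq {c₁ c₂ : Prog} {R Q : Store → ℕ → Prop} {s : Store} (h₁ : Wp M W c₁ R s)
    (h₂ : ∀ s₁ t₁, R s₁ t₁ → Wp M W c₂ (fun s₂ t₂ => Q s₂ (t₁ + t₂)) s₁) :
    Wp M W (.seq c₁ c₂) Q s := by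
  intro hs
  obtain ⟨s₁, t₁, r₁, b₁, q₁⟩ := h₁ hs
  obtain ⟨s₂, t₂, r₂, b₂, q₂⟩ := h₂ s₁ t₁ q₁ b₁
  exact ⟨s₂, t₁ + t₂, r₁.seq r₂, b₂, q₂⟩

/-- Straight-line code is verified by computing `vc`. A loop is its own verification condition, so
loops are proved separately by `Wp.while`. -/
theorem Wp.of_vc (hW : 1 < W) {c : Prog} {Q : Store → ℕ → Prop} {s : Store}
    (h : vc M W c Q s) : Wp M W c Q s := by
  induction c generalizing Q s with
  | set r e =>
    intro hs
    have hsafe := h.1.safe hW hs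
    exact ⟨_, _, .set s r e hsafe, hs.setReg hsafe.val_lt, h.2⟩
  | write a i e =>
    intro hs
    have hsi := h.1.safe hW hs
    have hse := h.2.1.safe hW hs
    exact ⟨_, _, .write s a i e hsi hse h.2.2.1, hs.setArr hse.val_lt, h.2.2.2⟩
  | seq c₁ c₂ ih₁ ih₂ => exact (ih₁ h).seq fun s₁ t₁ h' => ih₂ h'
  | ite e c₁ c₂ ih₁ ih₂ =>
    intro hs
    have hsafe := h.1.safe hW hs
    by_cases hv : e.val s = 0
    · obtain ⟨s', t, hr, hb, hq⟩ := ih₂ (h.2.2 hv) hs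
      exact ⟨s', _, .iteFalse hsafe hv hr, hb, hq⟩
    · obtain ⟨s', t, hr, hb, hq⟩ := ih₁ (h.2.1 hv) hs
      exact ⟨s', _, .iteTrue hsafe hv hr, hb, hq⟩
  | mark => exact h.elim
  | _ => exact h

/-- The rule for loops: the first argument of the invariant decreases with each iteration. -/
theorem Wp.while (hW : 1 < W) {e : Expr} {c : Prog} {Q : Store → ℕ → Prop}
    (Inv : ℕ → Store → Prop) (B : ℕ)
    (hOk : ∀ k s, Inv k s → e.Ok M W s)
    (hbody : ∀ k s, Inv k s → e.val s ≠ 0 →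
      Wp M W c (fun s' t => t ≤ B ∧ ∃ k' < k, Inv k' s') s)
    {k : ℕ} {s : Store} (h : Inv k s)
    (hQ : ∀ k' s' t, Inv k' s' → e.val s' = 0 → t ≤ (k + 1) * (B + e.cost + 1) → Q s' t) :
    Wp M W (.while e c) Q s := by
  induction k using Nat.strong_induction_on generalizing s Q with
  | _ k ih =>
  intro hs
  have hsafe := (hOk k s h).safe hW hs
  by_cases hv : e.val s = 0
  · exact ⟨s, _, .whileFalse hsafe hv, hs, hQ k s _ h hv (by nlinarith)⟩
  · obtain ⟨s₁, t₁, r₁, b₁, ht₁, k', hk', hI⟩ := hbody k s h hv hs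
    obtain ⟨s₂, t₂, r₂, b₂, hq⟩ := ih k' hk' (Q := fun s' t => Q s' (e.cost + 1 + t₁ + t)) hI
      (fun k'' s' t hI' hv' ht => by
        refine hQ k'' s' _ hI' hv' ?_
        have : (k' + 1) * (B + e.cost + 1) ≤ k * (B + e.cost + 1) :=
          Nat.mul_le_mul_right _ hk'
        rw [Nat.add_mul k 1, Nat.one_mul]
        omega) b₁
    exact ⟨s₂, _, .whileTrue hsafe hv r₁ r₂, b₂, hq⟩

/-- The loop `for r := 0, …, reg b - 1 do c`. -/
def forLoop (r b : ℕ) (c : Prog) : Prog :=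
  .seq (.set r (.const 0))
    (.while (.lt (.reg r) (.reg b)) (.seq c (.set r (.add (.reg r) (.const 1)))))

/-- The invariant `J i` includes the value of the counter, so the body has to establish `J (i + 1)`
only after the increment. -/
theorem Wp.forLoop (hW : 1 < W) {r b N B : ℕ} {c : Prog} {Q : Store → ℕ → Prop} {s : Store}
    (J : ℕ → Store → Prop) (hN : N < W)
    (hr : ∀ i s, J i s → s.reg r = i ∧ s.reg b = N) (h : J 0 (s.setReg r 0))
    (hbody : ∀ i s, i < N → J i s →
      Wp M W c (fun s' t => t ≤ B ∧ s'.reg r = i ∧ J (i + 1) (s'.setReg r (i + 1))) s)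
    (hQ : ∀ s' t, J N s' → t ≤ (N + 1) * (B + 10) → Q s' t) :
    Wp M W (Ram.forLoop r b c) Q s := by
  refine Wp.seq (R := fun s' t => s' = s.setReg r 0 ∧ t = 2)
    (.of_vc hW ⟨by simp only [Expr.Ok]; omega, rfl, rfl⟩) ?_
  rintro _ _ ⟨rfl, rfl⟩
  -- The increment and the test take four steps each and the initialization two, so `B + 10` per
  -- round covers everything.
  refine Wp.while (e := .lt (.reg r) (.reg b)) hW (fun k s => ∃ i, i + k = N ∧ J i s) (B + 4)
    (fun _ _ _ => ⟨trivial, trivial⟩)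
    ?_ ⟨0, Nat.zero_add N, h⟩ ?_
  · rintro k s ⟨i, hik, hJ⟩ hv
    obtain ⟨h1, h2⟩ := hr i s hJ
    have hiN : i < N := by
      simp only [Expr.val, h1, h2] at hv
      by_contra hn
      exact hv (if_neg hn)
    refine (hbody i s hiN hJ).seq fun s₁ t₁ ⟨ht, hri, hJ'⟩ => .of_vc hW ?_
    simp only [vc, Expr.Ok, Expr.val, Expr.cost, hri]
    refine ⟨⟨trivial, hW, by omega⟩, by omega, k - 1, by omega, i + 1, by omega, hJ'⟩
  · rintro k' s' t ⟨i, hik, hJ⟩ hv ht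
    obtain ⟨h1, h2⟩ := hr i s' hJ
    have hiN : ¬ i < N := by
      intro hn
      simp [Expr.val, h1, h2, hn] at hv
    obtain rfl : i = N := by omega
    refine hQ s' _ hJ ?_
    simp only [Expr.cost] at ht
    nlinarith

end Rules

end Ram

/-! ### The worklist algorithm for attractors -/

namespace ParityGame

section Worklist

variable {n : ℕ}

/-- The edges with number below `m` and target `v`, the last one first. -/
def bucket (tgt : ℕ → Fin n) : ℕ → Fin n → List ℕ
  | 0, _ => []
  | i + 1, v => if tgt i = v then i :: bucket tgt i v else bucket tgt i v

theorem mem_bucket {tgt : ℕ → Fin n} {m i : ℕ} {v : Fin n} :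
    i ∈ bucket tgt m v ↔ i < m ∧ tgt i = v := by
  induction m with
  | zero => simp [bucket]
  | succ m ih =>
    rw [bucket]
    split_ifs with h
    · rw [List.mem_cons, ih]
      constructor
      · rintro (rfl | ⟨h1, h2⟩)
        · exact ⟨Nat.lt_succ_self _, h⟩
        · exact ⟨by omega, h2⟩
      · rintro ⟨h1, h2⟩
        rcases Nat.lt_succ_iff_lt_or_eq.1 h1 with h3 | h3
        · exact .inr ⟨h3, h2⟩
        · exact .inl h3
    · rw [ih]
      constructor
      · rintro ⟨h1, h2⟩
        exact ⟨by omega, h2⟩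
      · rintro ⟨h1, h2⟩
        rcases Nat.lt_succ_iff_lt_or_eq.1 h1 with h3 | h3
        · exact ⟨h3, h2⟩
        · exact absurd (h3 ▸ h2) h

theorem nodup_bucket (tgt : ℕ → Fin n) (m : ℕ) (v : Fin n) : (bucket tgt m v).Nodup := by
  induction m with
  | zero => simp [bucket]
  | succ m ih =>
    rw [bucket]
    split_ifs with h
    · exact List.nodup_cons.2 ⟨fun hm => absurd (mem_bucket.1 hm).1 (lt_irrefl _), ih⟩
    · exact ih

/-- The number of edges in `todo` that lead from `u` to `G`. -/
def todoCount (src tgt : ℕ → Fin n) (G : Finset (Fin n)) (todo : Finset ℕ) (u : Fin n) : ℕ :=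
  (todo.filter fun i => src i = u ∧ tgt i ∈ G).card

theorem todoCount_erase {src tgt : ℕ → Fin n} {G : Finset (Fin n)} {todo : Finset ℕ} {i : ℕ}
    (hi : i ∈ todo) (hG : tgt i ∈ G) (u : Fin n) :
    todoCount src tgt G (todo.erase i) u =
      if src i = u then todoCount src tgt G todo u - 1 else todoCount src tgt G todo u := by
  unfold todoCount
  rw [Finset.filter_erase]
  split_ifs with h
  · exact Finset.card_erase_of_mem (Finset.mem_filter.2 ⟨hi, h, hG⟩)
  · rw [Finset.erase_eq_of_notMem]
    exact fun hm => h (Finset.mem_filter.1 hm).2.1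

/-- The invariant of the computation of an attractor: the list `Q` contains the vertices found so
far; the edges into its first `k` vertices have been processed, except for those in `cur`; `todo`
contains the edges that have not been processed. -/
structure WorkInv (𝒢 : ParityGame (Fin n)) (P : Player) (G S : Finset (Fin n)) (m : ℕ)
    (src tgt : ℕ → Fin n) (Q : List (Fin n)) (k : ℕ) (cur : List ℕ) (todo : Finset ℕ) : Prop where
  le_length : k ≤ Q.length
  nodup : Q.Nodup
  subset : ∀ v ∈ Q, v ∈ G
  start : ∀ v ∈ S, v ∈ Q
  cur_nodup : cur.Nodup
  cur_todo : ∀ i ∈ cur, i ∈ todo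
  cur_tgt : ∀ i ∈ cur, tgt i ∈ Q.take k
  todo_lt : ∀ i ∈ todo, i < m
  todo_cur : ∀ i ∈ todo, tgt i ∈ Q.take k → i ∈ cur
  done_tgt : ∀ i < m, i ∉ todo → tgt i ∈ Q.take k
  done_own : ∀ i < m, i ∉ todo → src i ∈ G → 𝒢.owner (src i) = P → src i ∈ Q
  count_pos : ∀ u ∈ G, u ∉ Q → 𝒢.owner u ≠ P → 0 < todoCount src tgt G todo u
  sound : ∀ T, 𝒢.IsTrap P G T → Disjoint T S → ∀ v ∈ Q, v ∉ T

variable {𝒢 : ParityGame (Fin n)} {P : Player} {G S : Finset (Fin n)} {m : ℕ}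
  {src tgt : ℕ → Fin n} {Q : List (Fin n)} {k : ℕ} {cur : List ℕ} {todo : Finset ℕ}

/-- The counters start positive because `G` is a subgame: each vertex has an edge into `G`. -/
theorem WorkInv.init (hE : ∀ u w, (u, w) ∈ 𝒢.edges ↔ ∃ i < m, src i = u ∧ tgt i = w)
    (hG : 𝒢.IsSubgame G) (hS : S ⊆ G) (hQ : Q.Nodup) (hQS : ∀ v, v ∈ Q ↔ v ∈ S) :
    𝒢.WorkInv P G S m src tgt Q 0 [] (Finset.range m) where
  le_length := Nat.zero_le _
  nodup := hQ
  subset v hv := hS ((hQS v).1 hv)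
  start v hv := (hQS v).2 hv
  cur_nodup := List.nodup_nil
  cur_todo i hi := absurd hi List.not_mem_nil
  cur_tgt i hi := absurd hi List.not_mem_nil
  todo_lt i hi := Finset.mem_range.1 hi
  todo_cur i _ h := by simp at h
  done_tgt i hi h := absurd (Finset.mem_range.2 hi) h
  done_own i hi h := absurd (Finset.mem_range.2 hi) h
  count_pos u hu _ _ := by
    obtain ⟨w, hw, he⟩ := hG u hu
    obtain ⟨i, hi, h1, h2⟩ := (hE u w).1 he
    exact Finset.card_pos.2 ⟨i, Finset.mem_filter.2 ⟨Finset.mem_range.2 hi, h1, h2 ▸ hw⟩⟩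
  sound T _ hd v hv hvT := Finset.disjoint_left.1 hd hvT ((hQS v).1 hv)

/-- The queue has no repetitions, so no edge into `Q[k]` has been processed before and the whole
bucket is still to do. -/
theorem WorkInv.dequeue (h : 𝒢.WorkInv P G S m src tgt Q k [] todo) (hk : k < Q.length) :
    𝒢.WorkInv P G S m src tgt Q (k + 1) (bucket tgt m Q[k]) todo := by
  have htake : ∀ v, v ∈ Q.take (k + 1) ↔ v ∈ Q.take k ∨ v = Q[k] := by
    intro v
    rw [List.take_succ_eq_append_getElem hk, List.mem_append, List.mem_singleton]
  have hnot : Q[k] ∉ Q.take k := by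
    have h1 := h.nodup.sublist (List.take_sublist (k + 1) Q)
    rw [List.take_succ_eq_append_getElem hk, List.nodup_append] at h1
    intro hm
    exact h1.2.2 _ hm _ (List.mem_singleton_self _) rfl
  refine { h with
    le_length := hk
    cur_nodup := nodup_bucket _ _ _
    cur_todo := fun i hi => ?_
    cur_tgt := fun i hi => (htake _).2 (.inr (mem_bucket.1 hi).2)
    todo_cur := fun i hi ht => ?_
    done_tgt := fun i hi hn => (htake _).2 (.inl (h.done_tgt i hi hn)) }
  · obtain ⟨h1, h2⟩ := mem_bucket.1 hi
    by_contra hn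
    exact hnot (h2 ▸ h.done_tgt i h1 hn)
  · rcases (htake _).1 ht with h1 | h1
    · exact absurd (h.todo_cur i hi h1) List.not_mem_nil
    · exact mem_bucket.2 ⟨h.todo_lt i hi, h1⟩

/-- A new vertex enters the queue either because `P` can move along this edge, or because all edges
of the other player's vertex into `G` have been processed. In both cases it cannot lie in a trap for
`P` disjoint from `S`: the trap would contain a vertex that was queued earlier. -/
theorem WorkInv.edge (hE : ∀ u w, (u, w) ∈ 𝒢.edges ↔ ∃ i < m, src i = u ∧ tgt i = w) {i : ℕ}
    (h : 𝒢.WorkInv P G S m src tgt Q k (i :: cur) todo) {Q' : List (Fin n)}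
    (hQ' : Q' = Q ∨ Q' = Q ++ [src i] ∧ src i ∈ G ∧ src i ∉ Q ∧
      (𝒢.owner (src i) = P ∨
        𝒢.owner (src i) ≠ P ∧ todoCount src tgt G (todo.erase i) (src i) = 0))
    (hown : src i ∈ G → 𝒢.owner (src i) = P → src i ∈ Q')
    (hcount : src i ∈ G → src i ∉ Q' → 𝒢.owner (src i) ≠ P →
      0 < todoCount src tgt G (todo.erase i) (src i)) :
    𝒢.WorkInv P G S m src tgt Q' k cur (todo.erase i) := by
  have htodo : i ∈ todo := h.cur_todo i List.mem_cons_self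
  have htgt : tgt i ∈ Q.take k := h.cur_tgt i List.mem_cons_self
  have htgtG : tgt i ∈ G := h.subset _ (List.mem_of_mem_take htgt)
  have him : i < m := h.todo_lt i htodo
  have htake : Q'.take k = Q.take k := by
    rcases hQ' with rfl | ⟨rfl, -⟩
    · rfl
    · exact List.take_append_of_le_length h.le_length
  have hsub : ∀ v ∈ Q, v ∈ Q' := by
    rcases hQ' with rfl | ⟨rfl, -⟩
    · exact fun _ => id
    · exact fun v hv => List.mem_append_left _ hv
  have hdone : ∀ j < m, j ∉ todo.erase i → j = i ∨ j ∉ todo := by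
    intro j _ hj
    by_contra hcon
    push Not at hcon
    exact hj (Finset.mem_erase.2 hcon)
  refine
    { le_length := ?_, nodup := ?_, subset := ?_, start := fun v hv => hsub v (h.start v hv)
      cur_nodup := (List.nodup_cons.1 h.cur_nodup).2
      cur_todo := fun j hj => Finset.mem_erase.2
        ⟨fun he => (List.nodup_cons.1 h.cur_nodup).1 (he ▸ hj),
          h.cur_todo j (List.mem_cons_of_mem _ hj)⟩
      cur_tgt := fun j hj => htake ▸ h.cur_tgt j (List.mem_cons_of_mem _ hj)
      todo_lt := fun j hj => h.todo_lt j (Finset.mem_of_mem_erase hj)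
      todo_cur := fun j hj ht => ?_, done_tgt := fun j hj hn => ?_
      done_own := fun j hj hn hjG ho => ?_, count_pos := fun u hu huQ ho => ?_, sound := ?_ }
  · have h1 := h.le_length
    rcases hQ' with rfl | ⟨rfl, -⟩
    · exact h1
    · rw [List.length_append]; omega
  · rcases hQ' with rfl | ⟨rfl, -, hn, -⟩
    · exact h.nodup
    · exact (List.nodup_append.2 ⟨h.nodup, List.nodup_singleton _, fun a ha b hb hab => hn (by
        rw [List.mem_singleton] at hb; rwa [hab, hb] at ha)⟩)
  · rcases hQ' with rfl | ⟨rfl, hG, -, -⟩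
    · exact h.subset
    · intro v hv
      rcases List.mem_append.1 hv with hv | hv
      · exact h.subset v hv
      · rw [List.mem_singleton.1 hv]; exact hG
  · obtain ⟨h1, h2⟩ := Finset.mem_erase.1 hj
    exact (List.mem_cons.1 (h.todo_cur j h2 (htake ▸ ht))).resolve_left h1
  · rw [htake]
    rcases hdone j hj hn with rfl | h1
    · exact htgt
    · exact h.done_tgt j hj h1
  · rcases hdone j hj hn with rfl | h1
    · exact hown hjG ho
    · exact hsub _ (h.done_own j hj h1 hjG ho)
  · by_cases hui : src i = u
    · subst hui; exact hcount hu huQ ho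
    · rw [todoCount_erase htodo htgtG, if_neg hui]
      exact h.count_pos u hu (fun hm => huQ (hsub u hm)) ho
  · intro T hT hd v hv hvT
    rcases hQ' with rfl | ⟨rfl, hG, -, hc⟩
    · exact h.sound T hT hd v hv hvT
    rcases List.mem_append.1 hv with hv | hv
    · exact h.sound T hT hd v hv hvT
    rw [List.mem_singleton] at hv
    subst hv
    rcases hc with ho | ⟨ho, hc⟩
    · exact h.sound T hT hd _ (List.mem_of_mem_take htgt)
        (hT.closed _ hvT ho _ htgtG ((hE _ _).2 ⟨i, him, rfl, rfl⟩))
    · obtain ⟨w, hw, he⟩ := hT.exists_succ _ hvT ho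
      obtain ⟨j, hj, hsj, htj⟩ := (hE _ _).1 he
      subst htj
      have hjn : j ∉ todo.erase i := by
        intro hm
        have : 0 < todoCount src tgt G (todo.erase i) (src i) :=
          Finset.card_pos.2 ⟨j, Finset.mem_filter.2 ⟨hm, hsj, hT.subset hw⟩⟩
        omega
      refine h.sound T hT hd _ (List.mem_of_mem_take (i := k) ?_) hw
      rcases hdone j hj hjn with rfl | h1
      · exact htgt
      · exact h.done_tgt j hj h1

/-- When the queue is exhausted, every edge into it has been processed. A positive counter therefore
exhibits an edge that avoids the queue, so the complement is a trap. -/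
theorem WorkInv.eq_attr (hE : ∀ u w, (u, w) ∈ 𝒢.edges ↔ ∃ i < m, src i = u ∧ tgt i = w)
    (hG : 𝒢.IsSubgame G) (h : 𝒢.WorkInv P G S m src tgt Q k [] todo) (hk : Q.length ≤ k) :
    Q.toFinset = 𝒢.attr P S G := by
  have htake : Q.take k = Q := List.take_of_length_le hk
  have hdone : ∀ i < m, tgt i ∈ Q → i ∉ todo := by
    intro i hi ht hm
    exact absurd (h.todo_cur i hm (htake.symm ▸ ht)) List.not_mem_nil
  refine eq_attr_of_trap hG (fun v hv => List.mem_toFinset.2 (h.start v hv))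
    (fun v hv => h.subset v (List.mem_toFinset.1 hv))
    ⟨Finset.sdiff_subset, fun v hv ho w hw he => ?_, fun v hv ho => ?_⟩ fun T hT hd => ?_
  · rw [Finset.mem_sdiff, List.mem_toFinset] at hv ⊢
    refine ⟨hw, fun hwQ => hv.2 ?_⟩
    obtain ⟨i, hi, rfl, rfl⟩ := (hE v w).1 he
    exact h.done_own i hi (hdone i hi hwQ) hv.1 ho
  · rw [Finset.mem_sdiff, List.mem_toFinset] at hv
    obtain ⟨i, hi⟩ := Finset.card_pos.1 (h.count_pos v hv.1 hv.2 ho)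
    obtain ⟨hi1, rfl, hi3⟩ := Finset.mem_filter.1 hi
    refine ⟨tgt i, ?_, (hE _ _).2 ⟨i, h.todo_lt i hi1, rfl, rfl⟩⟩
    rw [Finset.mem_sdiff, List.mem_toFinset]
    exact ⟨hi3, fun hm => hdone i (h.todo_lt i hi1) hm hi1⟩
  · exact Finset.disjoint_right.2 fun v hv => h.sound T hT hd v (List.mem_toFinset.1 hv)

end Worklist

end ParityGame

/-! ### The attractor program -/

namespace Ram

open ParityGame

theorem Expr.val_lt_eq_zero {s : Store} {e f : Expr} :
    (Expr.lt e f).val s = 0 ↔ ¬ e.val s < f.val s := by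
  rw [Expr.val]
  split_ifs with h <;> simp [h]

namespace Store

theorem SameExcept.refl (R A : List ℕ) (s : Store) : SameExcept R A s s :=
  ⟨fun _ _ => rfl, fun _ _ => rfl⟩

@[simp] theorem sameExcept_setReg {R A : List ℕ} {s s' : Store} {r x : ℕ} (hr : r ∈ R) :
    SameExcept R A s (s'.setReg r x) ↔ SameExcept R A s s' := by
  constructor
  · refine fun h => ⟨fun r' hr' => ?_, h.arr⟩
    have h1 := h.reg r' hr'
    rwa [setReg_reg, if_neg (by rintro rfl; exact hr' hr)] at h1
  · refine fun h => ⟨fun r' hr' => ?_, h.arr⟩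
    rw [setReg_reg, if_neg (by rintro rfl; exact hr' hr)]
    exact h.reg r' hr'

@[simp] theorem sameExcept_setArr {R A : List ℕ} {s s' : Store} {a i x : ℕ} (ha : a ∈ A) :
    SameExcept R A s (s'.setArr a i x) ↔ SameExcept R A s s' := by
  constructor
  · refine fun h => ⟨h.reg, fun b hb => ?_⟩
    have h1 := h.arr b hb
    rwa [setArr_arr, if_neg (by rintro rfl; exact hb ha)] at h1
  · refine fun h => ⟨h.reg, fun b hb => ?_⟩
    rw [setArr_arr, if_neg (by rintro rfl; exact hb ha)]
    exact h.arr b hb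

/-- The array `a` is the indicator of `X`. -/
def ShowsSet {n : ℕ} (s : Store) (a : ℕ) (X : Finset (Fin n)) : Prop :=
  ∀ v : Fin n, s.arr a v = if v ∈ X then 1 else 0

/-- The array `a` starts with the list `Q`. -/
def ListAt {n : ℕ} (s : Store) (a : ℕ) (Q : List (Fin n)) : Prop :=
  ∀ j (h : j < Q.length), s.arr a j = (Q[j] : ℕ)

theorem ListAt.append {n : ℕ} {s s' : Store} {a : ℕ} {Q : List (Fin n)} {u : Fin n}
    (h : s.ListAt a Q) (h' : s'.arr a = Function.update (s.arr a) Q.length u) :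
    s'.ListAt a (Q ++ [u]) := by
  intro j hj
  rw [h', Function.update_apply]
  split_ifs with he
  · subst he; simp
  · have hj' : j < Q.length := by
      rw [List.length_append, List.length_singleton] at hj
      omega
    rw [List.getElem_append_left hj']
    exact h j hj'

end Store

/-- Sizes of the arrays and of the words that suffice for a game. -/
structure Dims (n m M W : ℕ) : Prop where
  n_le : n ≤ M
  m_le : m ≤ M
  n_lt : n + 2 < W
  m_lt : m + 2 < W
  W_gt : 20 < W

/-- No operation. -/
def skip : Prog := .set 11 (.const 0)

/-- Resets the counters and puts the vertices shown by array `5` into the queue. -/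
def attrInit : Prog :=
  .seq (.set 13 (.const 0))
    (forLoop 10 0 (.seq (.write 12 (.reg 10) (.const 0))
      (.ite (.eq (.read 5 (.reg 10)) (.const 1))
        (.seq (.write 13 (.reg 13) (.reg 10)) (.set 13 (.add (.reg 13) (.const 1))))
        skip)))

section

variable {n m M W : ℕ} {s : Store} {S G : Finset (Fin n)}

theorem attrInit_spec (hd : Dims n m M W) (h0 : s.reg 0 = n) (hS : s.ShowsSet 5 S) :
    Wp M W attrInit (fun s' t => s.SameExcept [10, 11, 13] [12, 13] s' ∧
      (∀ v : Fin n, s'.arr 12 v = 0) ∧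
      (∃ Q : List (Fin n), Q.Nodup ∧ (∀ v, v ∈ Q ↔ v ∈ S) ∧ s'.reg 13 = Q.length ∧
        s'.ListAt 13 Q) ∧ t ≤ 40 * (n + 1)) s := by
  have hn := hd.n_le
  have hnW := hd.n_lt
  have hW := hd.W_gt
  have hW1 : 1 < W := by omega
  refine Wp.seq (R := fun s' t => s' = s.setReg 13 0 ∧ t = 2) (.of_vc hW1 (by
    simp [vc, Expr.Ok, Expr.val, Expr.cost]; omega)) ?_
  rintro _ _ ⟨rfl, rfl⟩
  refine Wp.forLoop hW1 (N := n) (B := 20)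
    (fun i s' => s.SameExcept [10, 11, 13] [12, 13] s' ∧ s'.reg 10 = i ∧
      (∀ v : Fin n, v < i → s'.arr 12 v = 0) ∧
      (∃ Q : List (Fin n), Q.Nodup ∧ (∀ v, v ∈ Q ↔ v ∈ S ∧ v < i) ∧ s'.reg 13 = Q.length ∧
        s'.ListAt 13 Q)) (by omega) ?_ ?_ ?_ ?_
  · rintro i s' ⟨h1, h2, -⟩
    exact ⟨h2, by rw [h1.reg 0 (by simp), h0]⟩
  · refine ⟨by simp [Store.SameExcept.refl], by simp, by simp, [], by simp, by simp, by simp, ?_⟩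
    intro j hj; simp at hj
  · rintro i s₁ hi ⟨h1, h2, h3, Q, hQ1, hQ2, hQ3, hQ4⟩
    have hlen : Q.length ≤ n := by simpa using hQ1.length_le_card
    have hS' := hS ⟨i, hi⟩
    have h5 : s₁.arr 5 = s.arr 5 := h1.arr 5 (by simp)
    simp only [] at hS'
    have hQ2' := hQ2 ⟨i, hi⟩
    refine .of_vc hW1 ?_
    -- A list of vertices without repetitions has length at most `n`, which keeps the queue inside
    -- its array.
    have hext : (⟨i, hi⟩ : Fin n) ∈ S → (Q ++ [(⟨i, hi⟩ : Fin n)]).Nodup := fun _ =>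
      List.nodup_append.2 ⟨hQ1, List.nodup_singleton _, fun a ha b hb hab => by
        rw [List.mem_singleton] at hb
        rw [hab, hb, hQ2'] at ha
        exact absurd ha.2 (lt_irrefl i)⟩
    have hzero : ∀ v : Fin n, (v : ℕ) ≤ i → Function.update (s₁.arr 12) i 0 v = 0 := by
      intro v hv
      rw [Function.update_apply]
      split_ifs with h
      · rfl
      · exact h3 v (by omega)
    simp [vc, Expr.Ok, Expr.val, Expr.cost, skip, h1, h2, h5, hS', hQ3]
    refine ⟨by omega, by omega, ⟨by omega, by omega⟩, fun hiS => ?_, fun hiS => ?_⟩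
    · have hlen' : Q.length + 1 ≤ n := by simpa using (hext hiS).length_le_card
      refine ⟨by omega, ⟨by omega, by omega⟩, hzero, Q ++ [⟨i, hi⟩], hext hiS, fun v => ?_,
        by simp, hQ4.append (by simp)⟩
      rw [List.mem_append, hQ2, List.mem_singleton]
      constructor
      · rintro (⟨h6, h7⟩ | rfl)
        · exact ⟨h6, h7.le⟩
        · exact ⟨hiS, le_rfl⟩
      · rintro ⟨h6, h7⟩
        rcases h7.lt_or_eq with h8 | h8
        · exact .inl ⟨h6, h8⟩
        · exact .inr (Fin.ext h8)
    · refine ⟨by omega, hzero, Q, hQ1, fun v => ?_, rfl, fun j hj => ?_⟩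
      · rw [hQ2]
        refine and_congr_right fun h6 => ⟨fun h7 => h7.le, fun h7 => ?_⟩
        rcases h7.lt_or_eq with h8 | h8
        · exact h8
        · exact absurd ((Fin.ext h8 : v = ⟨i, hi⟩) ▸ h6) hiS
      · simpa using hQ4 j hj
  · rintro s' t ⟨h1, h2, h3, Q, hQ1, hQ2, hQ3, hQ4⟩ ht
    exact ⟨h1, fun v => h3 v v.2, ⟨Q, hQ1, fun v => by simp [hQ2], hQ3, hQ4⟩, by omega⟩

/-- A linked list, in which the number `i` is represented by `i + 1`. -/
def Linked (next : ℕ → ℕ) : ℕ → List ℕ → Prop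
  | e, [] => e = 0
  | e, i :: l => e = i + 1 ∧ Linked next (next i) l

theorem Linked.update {next : ℕ → ℕ} {e i x : ℕ} {l : List ℕ} (h : Linked next e l)
    (hi : i ∉ l) : Linked (Function.update next i x) e l := by
  induction l generalizing e with
  | nil => exact h
  | cons j l ih =>
    rw [List.mem_cons, not_or] at hi
    refine ⟨h.1, ?_⟩
    rw [Function.update_of_ne (Ne.symm hi.1)]
    exact ih h.2 hi.2

/-- The store contains the game in the form of edge lists. -/
structure GameStore (𝒢 : ParityGame (Fin n)) (m : ℕ) (src tgt : ℕ → Fin n) (s : Store) :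
    Prop where
  reg_n : s.reg 0 = n
  reg_m : s.reg 1 = m
  owner_eq : ∀ v : Fin n, s.arr 0 v = (𝒢.owner v).code
  prio_eq : ∀ v : Fin n, s.arr 1 v = 𝒢.prio v
  src_eq : ∀ i < m, s.arr 2 i = src i
  tgt_eq : ∀ i < m, s.arr 3 i = tgt i
  linked : ∀ v : Fin n, Linked (s.arr 11) (s.arr 10 v) (bucket tgt m v)

theorem GameStore.of_sameExcept {𝒢 : ParityGame (Fin n)} {src tgt : ℕ → Fin n} {s' : Store}
    {R A : List ℕ} (h : GameStore 𝒢 m src tgt s) (hs : s.SameExcept R A s')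
    (hR : 0 ∉ R ∧ 1 ∉ R) (hA : 0 ∉ A ∧ 1 ∉ A ∧ 2 ∉ A ∧ 3 ∉ A ∧ 10 ∉ A ∧ 11 ∉ A) :
    GameStore 𝒢 m src tgt s' where
  reg_n := by rw [hs.reg 0 hR.1, h.reg_n]
  reg_m := by rw [hs.reg 1 hR.2, h.reg_m]
  owner_eq v := by rw [hs.arr 0 hA.1, h.owner_eq]
  prio_eq v := by rw [hs.arr 1 hA.2.1, h.prio_eq]
  src_eq i hi := by rw [hs.arr 2 hA.2.2.1, h.src_eq i hi]
  tgt_eq i hi := by rw [hs.arr 3 hA.2.2.2.1, h.tgt_eq i hi]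
  linked v := by rw [hs.arr 10 hA.2.2.2.2.1, hs.arr 11 hA.2.2.2.2.2]; exact h.linked v

/-- Counts the edges inside of the set of the vertices whose rank is in register `7`. -/
def attrCount : Prog :=
  forLoop 10 1 (.ite (.eq (.read 6 (.read 2 (.reg 10))) (.reg 7))
    (.ite (.eq (.read 6 (.read 3 (.reg 10))) (.reg 7))
      (.write 12 (.read 2 (.reg 10)) (.add (.read 12 (.read 2 (.reg 10))) (.const 1)))
      skip)
    skip)

variable {𝒢 : ParityGame (Fin n)} {src tgt : ℕ → Fin n} {P : Player}

theorem todoCount_range_succ (i : ℕ) (u : Fin n) :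
    todoCount src tgt G (Finset.range (i + 1)) u =
      todoCount src tgt G (Finset.range i) u + if src i = u ∧ tgt i ∈ G then 1 else 0 := by
  unfold todoCount
  rw [Finset.range_add_one, Finset.filter_insert]
  split_ifs with h
  · rw [Finset.card_insert_of_notMem (by simp)]
  · rfl

theorem todoCount_range_le (i : ℕ) (u : Fin n) :
    todoCount src tgt G (Finset.range i) u ≤ i :=
  (Finset.card_filter_le _ _).trans (by simp)

theorem attrCount_spec (hd : Dims n m M W) (hg : GameStore 𝒢 m src tgt s)
    (hG : ∀ v : Fin n, s.arr 6 v = s.reg 7 ↔ v ∈ G) (h12 : ∀ v : Fin n, s.arr 12 v = 0) :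
    Wp M W attrCount (fun s' t => s.SameExcept [10, 11] [12] s' ∧
      (∀ u ∈ G, s'.arr 12 u = todoCount src tgt G (Finset.range m) u) ∧ t ≤ 50 * (m + 1)) s := by
  have hn := hd.n_le
  have hm := hd.m_le
  have hmW := hd.m_lt
  have hW := hd.W_gt
  have hW1 : 1 < W := by omega
  refine Wp.forLoop hW1 (N := m) (B := 40)
    (fun i s' => s.SameExcept [10, 11] [12] s' ∧ s'.reg 10 = i ∧
      ∀ u ∈ G, s'.arr 12 u = todoCount src tgt G (Finset.range i) u) (by omega) ?_ ?_ ?_ ?_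
  · rintro i s' ⟨h1, h2, -⟩
    exact ⟨h2, by rw [h1.reg 1 (by simp), hg.reg_m]⟩
  · refine ⟨by simp [Store.SameExcept.refl], by simp, ?_⟩
    simp [todoCount, h12]
  · rintro i s₁ hi ⟨h1, h2, h3⟩
    have e2 := h1.arr 2 (by simp)
    have e3 := h1.arr 3 (by simp)
    have e6 := h1.arr 6 (by simp)
    have e7 := h1.reg 7 (by simp)
    have hsrc := (src i).2
    have htgt := (tgt i).2
    have hle := todoCount_range_le (src := src) (tgt := tgt) (G := G) i (src i)
    refine .of_vc hW1 ?_
    simp [vc, Expr.Ok, Expr.val, Expr.cost, skip, h1, h2, e2, e3, e6, e7, hg.src_eq i hi,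
      hg.tgt_eq i hi, hG, todoCount_range_succ]
    refine ⟨⟨by omega, by omega⟩, fun hs => ⟨⟨by omega, by omega⟩, fun ht => ?_, fun ht => ?_⟩,
      fun hs => ?_⟩
    · rw [h3 _ hs]
      refine ⟨by omega, ⟨⟨by omega, by omega⟩, by omega, by omega⟩, by omega, fun u hu => ?_⟩
      rw [Function.update_apply]
      by_cases huv : src i = u
      · subst huv; simp [ht]
      · rw [if_neg (fun he => huv (Fin.ext he).symm), h3 u hu]; simp [huv]
    · exact ⟨by omega, fun u hu => by rw [h3 u hu]; simp [ht]⟩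
    · refine ⟨by omega, fun u hu => ?_⟩
      rw [h3 u hu, if_neg, Nat.add_zero]
      rintro ⟨rfl, -⟩
      exact hs hu
  · rintro s' t ⟨h1, h2, h3⟩ ht
    exact ⟨h1, h3, by omega⟩

/-- Marks the vertex in register `11` and puts it into the queue. -/
def enqueue : Prog :=
  .seq (.write 13 (.reg 13) (.reg 11))
    (.seq (.set 13 (.add (.reg 13) (.const 1))) (.write 5 (.reg 11) (.const 1)))

/-- Processes one edge or takes the next vertex from the queue. -/
def attrStep : Prog :=
  .ite (.lt (.const 0) (.reg 14))
    (.seq (.set 11 (.read 2 (.sub (.reg 14) (.const 1))))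
      (.seq (.set 14 (.read 11 (.sub (.reg 14) (.const 1))))
        (.ite (.eq (.read 6 (.reg 11)) (.reg 7))
          (.ite (.eq (.read 5 (.reg 11)) (.const 0))
            (.ite (.eq (.read 0 (.reg 11)) (.reg 3))
              enqueue
              (.seq (.write 12 (.reg 11) (.sub (.read 12 (.reg 11)) (.const 1)))
                (.ite (.eq (.read 12 (.reg 11)) (.const 0)) enqueue skip)))
            skip)
          skip)))
    (.seq (.set 14 (.read 10 (.read 13 (.reg 12)))) (.set 12 (.add (.reg 12) (.const 1))))

/-- The main loop of the computation of an attractor. -/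
def attrLoop : Prog :=
  .seq (.set 12 (.const 0)) (.seq (.set 14 (.const 0))
    (.while (.add (.lt (.const 0) (.reg 14)) (.lt (.reg 12) (.reg 13))) attrStep))

/-- The store represents a state of the computation of an attractor. -/
structure AttrStore (s₀ : Store) (𝒢 : ParityGame (Fin n)) (P : Player) (G S : Finset (Fin n))
    (m : ℕ) (src tgt : ℕ → Fin n) (Q : List (Fin n)) (k : ℕ) (cur : List ℕ) (todo : Finset ℕ)
    (s : Store) : Prop where
  work : 𝒢.WorkInv P G S m src tgt Q k cur todo
  same : s₀.SameExcept [11, 12, 13, 14] [5, 12, 13] s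
  head : s.reg 12 = k
  length : s.reg 13 = Q.length
  queue : s.ListAt 13 Q
  set : s.ShowsSet 5 Q.toFinset
  linked : Linked (s.arr 11) (s.reg 14) cur
  count : ∀ u ∈ G, u ∉ Q → 𝒢.owner u ≠ P → s.arr 12 u = todoCount src tgt G todo u

theorem Player.code_inj {P Q : Player} : P.code = Q.code ↔ P = Q := by
  cases P <;> cases Q <;> simp [Player.code]

/-- Each step either removes an edge from `todo` or advances the head `k`, and takes constant time;
this is what makes the attractor computation linear. -/
theorem attrStep_spec (hd : Dims n m M W) {s₀ : Store} (hg : GameStore 𝒢 m src tgt s₀)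
    (hE : ∀ u w, (u, w) ∈ 𝒢.edges ↔ ∃ i < m, src i = u ∧ tgt i = w)
    (hG : ∀ v : Fin n, s₀.arr 6 v = s₀.reg 7 ↔ v ∈ G) (hP : s₀.reg 3 = P.code)
    {Q : List (Fin n)} {k : ℕ} {cur : List ℕ} {todo : Finset ℕ}
    (h : AttrStore s₀ 𝒢 P G S m src tgt Q k cur todo s) (hcont : cur ≠ [] ∨ k < Q.length) :
    Wp M W attrStep (fun s' t => t ≤ 60 ∧ ∃ Q' k' cur' todo',
      todo'.card + (n - k') < todo.card + (n - k) ∧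
      AttrStore s₀ 𝒢 P G S m src tgt Q' k' cur' todo' s') s := by
  have hn := hd.n_le
  have hm := hd.m_le
  have hnW := hd.n_lt
  have hmW := hd.m_lt
  have hW := hd.W_gt
  have hW1 : 1 < W := by omega
  have hQn : Q.length ≤ n := by simpa using h.work.nodup.length_le_card
  have e0 := h.same.arr 0 (by simp)
  have e2 := h.same.arr 2 (by simp)
  have e6 := h.same.arr 6 (by simp)
  have e10 := h.same.arr 10 (by simp)
  have e11 := h.same.arr 11 (by simp)
  have e3 := h.same.reg 3 (by simp)
  have e7 := h.same.reg 7 (by simp)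
  refine .of_vc hW1 ?_
  rcases cur with _ | ⟨i, cur⟩
  · have hk : k < Q.length := hcont.resolve_left (by simp)
    have h14 : s.reg 14 = 0 := h.linked
    have hq := h.queue k hk
    have hlt := (Q[k]).2
    have hw := h.work.dequeue hk
    simp [vc, attrStep, Expr.Ok, Expr.val, Expr.cost, h14, h.head, hq]
    refine ⟨by omega, by omega, by omega, Q, k + 1, _, todo, by omega, hw, ?_, ?_, ?_, ?_, ?_, ?_,
      fun u hu huQ ho => ?_⟩
    · simp [h.same]
    · simp
    · simp [h.length]
    · exact fun j hj => by simpa using h.queue j hj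
    · exact fun v => by simpa using h.set v
    · simpa [e10, e11] using hg.linked Q[k]
    · simpa using h.count u hu huQ ho
  · obtain ⟨h14, hlink⟩ := h.linked
    have hitodo := h.work.cur_todo i List.mem_cons_self
    have him := h.work.todo_lt i hitodo
    have htgtG : tgt i ∈ G :=
      h.work.subset _ (List.mem_of_mem_take (h.work.cur_tgt i List.mem_cons_self))
    have hcard := Finset.card_erase_of_mem hitodo
    have hcpos := Finset.card_pos.2 ⟨i, hitodo⟩
    have hsrc := (src i).2
    have hset := h.set (src i)
    have hdec : (todo.erase i).card + (n - k) < todo.card + (n - k) := by omega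
    have hsame : ∀ u, src i ≠ u →
        todoCount src tgt G (todo.erase i) u = todoCount src tgt G todo u := fun u hu => by
      rw [todoCount_erase hitodo htgtG, if_neg hu]
    have hsame' : todoCount src tgt G (todo.erase i) (src i) =
        todoCount src tgt G todo (src i) - 1 := by
      rw [todoCount_erase hitodo htgtG, if_pos rfl]
    have hext : src i ∉ Q → Q.length + 1 ≤ n := fun hu => by
      have : (Q ++ [src i]).Nodup :=
        List.nodup_append.2 ⟨h.work.nodup, List.nodup_singleton _, fun a ha b hb hab => hu (by
          rw [List.mem_singleton] at hb; rwa [hab, hb] at ha)⟩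
      simpa using this.length_le_card
    have hset' : ∀ v : Fin n, Function.update (s.arr 5) (src i) 1 v =
        if v ∈ (Q ++ [src i]).toFinset then 1 else 0 := by
      intro v
      rw [Function.update_apply]
      by_cases hv : v = src i
      · simp [hv]
      · rw [if_neg (fun he => hv (Fin.ext he)), h.set v]
        simp [hv]
    simp [vc, attrStep, enqueue, skip, Expr.Ok, Expr.val, Expr.cost, h14, e0, e2, e6, e11, e3, e7,
      hg.src_eq i him, hG, hset, hg.owner_eq, hP, Player.code_inj, h.length]
    -- Edges from outside of `G` or from queued vertices need no work, as counters are only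
    -- maintained for vertices of `G` not yet in the queue. Register `11` becomes `0` through
    -- `skip`.
    have hskip : src i ∉ G ∨ src i ∈ Q → AttrStore s₀ 𝒢 P G S m src tgt Q k cur (todo.erase i)
        (((s.setReg 11 (src i)).setReg 14 (s₀.arr 11 i)).setReg 11 0) := fun hor => by
      refine ⟨h.work.edge hE (.inl rfl) (fun h1 _ => hor.resolve_left (not_not.2 h1))
        (fun h1 h2 => absurd (hor.resolve_left (not_not.2 h1)) h2),
        by simp [h.same], by simp [h.head], by simp [h.length],
        fun j hj => by simpa using h.queue j hj, fun v => by simpa using h.set v,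
        by simpa [e11] using hlink, fun u hu huQ ho => ?_⟩
      have hne : src i ≠ u := by
        rintro rfl
        exact hor.elim (fun h1 => h1 hu) huQ
      simpa [hsame u hne] using h.count u hu huQ ho
    refine ⟨by omega, by omega, by omega, fun hsG => ⟨by omega, fun hsQ => ⟨by omega,
      fun ho => ?_, fun ho => ?_⟩, fun hsQ => ⟨by omega, Q, k, cur, _, hdec, hskip (.inr hsQ)⟩⟩,
      fun hsG => ⟨by omega, Q, k, cur, _, hdec, hskip (.inl hsG)⟩⟩
    · have hlen := hext hsQ
      refine ⟨by omega, by omega, by omega, by omega, Q ++ [src i], k, cur, _, hdec,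
        h.work.edge hE (.inr ⟨rfl, hsG, hsQ, .inl ho⟩) (fun _ _ => by simp)
          (fun _ h2 => absurd (by simp) h2),
        by simp [h.same], by simp [h.head], by simp, h.queue.append (by simp), fun v => ?_,
        by simpa [e11] using hlink, fun u hu huQ ho => ?_⟩
      · simpa using hset' v
      · rw [List.mem_append, List.mem_singleton, not_or] at huQ
        simpa [hsame u (Ne.symm huQ.2)] using h.count u hu huQ.1 ho
    · have hlen := hext hsQ
      have hcount := h.count _ hsG hsQ ho
      rw [hcount, ← hsame']
      have hupd : ∀ u ∈ G, u ∉ Q → 𝒢.owner u ≠ P →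
          Function.update (s.arr 12) (src i) (todoCount src tgt G (todo.erase i) (src i)) u =
            todoCount src tgt G (todo.erase i) u := by
        intro u hu huQ ho
        rw [Function.update_apply]
        by_cases hui : src i = u
        · subst hui; simp
        · rw [if_neg (fun he => hui (Fin.ext he).symm), h.count u hu huQ ho, hsame u hui]
      refine ⟨by omega, by omega, by omega, fun hz => ?_, fun hz => ?_⟩
      · refine ⟨by omega, by omega, by omega, by omega, Q ++ [src i], k, cur, _, hdec,
          h.work.edge hE (.inr ⟨rfl, hsG, hsQ, .inr ⟨ho, hz⟩⟩) (fun _ _ => by simp)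
            (fun _ h2 => absurd (by simp) h2),
          by simp [h.same], by simp [h.head], by simp, h.queue.append (by simp), fun v => ?_,
          by simpa [e11] using hlink, fun u hu huQ ho => ?_⟩
        · simpa using hset' v
        · rw [List.mem_append, List.mem_singleton, not_or] at huQ
          simpa using hupd u hu huQ.1 ho
      · refine ⟨by omega, Q, k, cur, _, hdec,
          h.work.edge hE (.inl rfl) (fun _ h2 => absurd h2 ho)
            (fun _ _ _ => Nat.pos_of_ne_zero hz),
          by simp [h.same], by simp [h.head], by simp [h.length],
          fun j hj => by simpa using h.queue j hj, fun v => by simpa using h.set v,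
          by simpa [e11] using hlink, fun u hu huQ ho => ?_⟩
        simpa using hupd u hu huQ ho

theorem attrLoop_spec (hd : Dims n m M W) (hg : GameStore 𝒢 m src tgt s)
    (hE : ∀ u w, (u, w) ∈ 𝒢.edges ↔ ∃ i < m, src i = u ∧ tgt i = w)
    (hG : ∀ v : Fin n, s.arr 6 v = s.reg 7 ↔ v ∈ G) (hP : s.reg 3 = P.code)
    (hsub : 𝒢.IsSubgame G) (hSG : S ⊆ G) {Q : List (Fin n)} (hQ : Q.Nodup)
    (hQS : ∀ v, v ∈ Q ↔ v ∈ S) (h13 : s.reg 13 = Q.length) (hl : s.ListAt 13 Q)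
    (h5 : s.ShowsSet 5 S)
    (h12 : ∀ u ∈ G, s.arr 12 u = todoCount src tgt G (Finset.range m) u) :
    Wp M W attrLoop (fun s' t => s.SameExcept [11, 12, 13, 14] [5, 12, 13] s' ∧
      s'.ShowsSet 5 (𝒢.attr P S G) ∧ t ≤ 100 * (n + m + 1)) s := by
  have hW := hd.W_gt
  have hW1 : 1 < W := by omega
  refine Wp.seq (R := fun s' t => s' = s.setReg 12 0 ∧ t = 2) (.of_vc hW1 (by
    simp [vc, Expr.Ok, Expr.val, Expr.cost]; omega)) ?_
  rintro _ _ ⟨rfl, rfl⟩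
  refine Wp.seq (R := fun s' t => s' = (s.setReg 12 0).setReg 14 0 ∧ t = 2) (.of_vc hW1 (by
    simp [vc, Expr.Ok, Expr.val, Expr.cost]; omega)) ?_
  rintro _ _ ⟨rfl, rfl⟩
  refine Wp.while hW1 (fun x s' => ∃ Q k cur todo, x = todo.card + (n - k) ∧
    AttrStore s 𝒢 P G S m src tgt Q k cur todo s') 60 ?_ ?_ (k := m + n) ?_ ?_
  · rintro x s' -
    have hle : ∀ (p : Prop) [Decidable p], (if p then 1 else 0) ≤ 1 := fun p _ => by
      split_ifs <;> simp
    exact ⟨⟨by simp only [Expr.Ok]; omega, trivial⟩, ⟨trivial, trivial⟩,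
      lt_of_le_of_lt (Nat.add_le_add (hle _) (hle _)) (by omega)⟩
  · rintro x s' ⟨Q, k, cur, todo, rfl, h⟩ hv
    refine (attrStep_spec hd hg hE hG hP h ?_).mono ?_
    · by_contra hcon
      push Not at hcon
      obtain ⟨rfl, hk⟩ := hcon
      have h14 : s'.reg 14 = 0 := h.linked
      simp [Expr.val, h14, h.head, h.length] at hv
      omega
    · rintro s'' t ⟨ht, Q', k', cur', todo', hlt, h'⟩
      exact ⟨ht, _, hlt, Q', k', cur', todo', rfl, h'⟩
  · refine ⟨Q, 0, [], Finset.range m, by simp, .init hE hsub hSG hQ hQS, by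
      simp [Store.SameExcept.refl], by simp, by simp [h13],
      fun j hj => by simpa using hl j hj, fun v => by simpa [hQS] using h5 v, rfl,
      fun u hu _ _ => by simpa using h12 u hu⟩
  · rintro x s' t ⟨Q, k, cur, todo, -, h⟩ hv ht
    obtain ⟨hv1, hv2⟩ := Nat.add_eq_zero_iff.1 hv
    rw [Expr.val_lt_eq_zero] at hv1 hv2
    simp only [Expr.val, h.head, h.length, not_lt] at hv1 hv2
    have hcur : cur = [] := by
      have := h.linked
      rcases cur with _ | ⟨i, cur⟩
      · rfl
      · have h14 : s'.reg 14 = i + 1 := this.1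
        omega
    subst hcur
    refine ⟨h.same, ?_, ?_⟩
    · rw [← h.work.eq_attr hE hsub hv2]
      exact h.set
    · simp only [Expr.cost] at ht
      nlinarith

/-- Replaces the attractor in array `5` by its complement. -/
def attrFinish : Prog :=
  forLoop 10 0 (.write 5 (.reg 10) (.sub (.eq (.read 6 (.reg 10)) (.reg 7)) (.read 5 (.reg 10))))

/-- The truncated difference of two indicator values is the indicator of the set difference. -/
theorem attrFinish_spec (hd : Dims n m M W) (h0 : s.reg 0 = n)
    (hG : ∀ v : Fin n, s.arr 6 v = s.reg 7 ↔ v ∈ G) (h5 : s.ShowsSet 5 S) :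
    Wp M W attrFinish (fun s' t => s.SameExcept [10] [5] s' ∧
      s'.ShowsSet 5 (G \ S) ∧ t ≤ 50 * (n + 1)) s := by
  have hn := hd.n_le
  have hnW := hd.n_lt
  have hW := hd.W_gt
  have hW1 : 1 < W := by omega
  refine Wp.forLoop hW1 (N := n) (B := 40)
    (fun i s' => s.SameExcept [10] [5] s' ∧ s'.reg 10 = i ∧
      ∀ v : Fin n, s'.arr 5 v = if v < i then (if v ∈ G \ S then 1 else 0) else s.arr 5 v)
    (by omega) ?_ ?_ ?_ ?_
  · rintro i s' ⟨h1, h2, -⟩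
    exact ⟨h2, by rw [h1.reg 0 (by simp), h0]⟩
  · exact ⟨by simp [Store.SameExcept.refl], by simp, by simp⟩
  · rintro i s₁ hi ⟨h1, h2, h3⟩
    have e6 := h1.arr 6 (by simp)
    have e7 := h1.reg 7 (by simp)
    have hv := h3 ⟨i, hi⟩
    have hGi := hG ⟨i, hi⟩
    have h5i := h5 ⟨i, hi⟩
    simp only [lt_irrefl, if_false] at hv hGi h5i
    rw [h5i] at hv
    refine .of_vc hW1 ?_
    simp only [vc, Expr.Ok, Expr.val, Expr.cost, h2, e6, e7, hv, hGi]
    refine ⟨trivial, by simp; omega, by omega, by omega, by simp [h2], by simp [h1], by simp,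
      fun v => ?_⟩
    simp only [Store.setReg_arr, Store.setArr_arr, if_true, Function.update_apply]
    by_cases hvi : (v : ℕ) = i
    · obtain rfl : v = ⟨i, hi⟩ := Fin.ext hvi
      simp only [Finset.mem_sdiff, if_true]
      by_cases hm1 : (⟨i, hi⟩ : Fin n) ∈ G <;> by_cases hm2 : (⟨i, hi⟩ : Fin n) ∈ S <;>
        simp [hm1, hm2]
    · rw [if_neg hvi, h3 v]
      by_cases hlt : (v : ℕ) < i
      · rw [if_pos hlt, if_pos (show (v : ℕ) < i + 1 by omega)]
      · rw [if_neg hlt, if_neg (show ¬ (v : ℕ) < i + 1 by omega)]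
  · rintro s' t ⟨h1, h2, h3⟩ ht
    exact ⟨h1, fun v => by rw [h3 v, if_pos v.2], by omega⟩

/-- Let `G` be the set of the vertices whose rank is in register `7`. The set in array `5` is
replaced by the complement in `G` of its attractor for the player in register `3`. -/
def removeAttr : Prog := .seq attrInit (.seq attrCount (.seq attrLoop attrFinish))

theorem removeAttr_spec (hd : Dims n m M W) (hg : GameStore 𝒢 m src tgt s)
    (hE : ∀ u w, (u, w) ∈ 𝒢.edges ↔ ∃ i < m, src i = u ∧ tgt i = w)
    (hG : ∀ v : Fin n, s.arr 6 v = s.reg 7 ↔ v ∈ G) (hP : s.reg 3 = P.code)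
    (hsub : 𝒢.IsSubgame G) (hSG : S ⊆ G) (h5 : s.ShowsSet 5 S) :
    Wp M W removeAttr (fun s' t => s.SameExcept [10, 11, 12, 13, 14] [5, 12, 13] s' ∧
      s'.ShowsSet 5 (G \ 𝒢.attr P S G) ∧ t ≤ 300 * (n + m + 1)) s := by
  refine (attrInit_spec hd hg.reg_n h5).seq ?_
  rintro s₁ t₁ ⟨hs₁, h12, ⟨Q, hQ, hQS, h13, hl⟩, ht₁⟩
  have hg₁ := hg.of_sameExcept hs₁ (by simp) (by simp)
  have hG₁ : ∀ v : Fin n, s₁.arr 6 v = s₁.reg 7 ↔ v ∈ G := by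
    rw [hs₁.arr 6 (by simp), hs₁.reg 7 (by simp)]; exact hG
  refine (attrCount_spec hd hg₁ hG₁ h12).seq ?_
  rintro s₂ t₂ ⟨hs₂, h12, ht₂⟩
  have hg₂ := hg₁.of_sameExcept hs₂ (by simp) (by simp)
  have hG₂ : ∀ v : Fin n, s₂.arr 6 v = s₂.reg 7 ↔ v ∈ G := by
    rw [hs₂.arr 6 (by simp), hs₂.reg 7 (by simp)]; exact hG₁
  refine (attrLoop_spec (P := P) hd hg₂ hE hG₂ ?_ hsub hSG hQ hQS ?_ ?_ ?_ h12).seq ?_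
  · rw [hs₂.reg 3 (by simp), hs₁.reg 3 (by simp), hP]
  · rw [hs₂.reg 13 (by simp), h13]
  · intro j hj; rw [hs₂.arr 13 (by simp)]; exact hl j hj
  · intro v; rw [hs₂.arr 5 (by simp), hs₁.arr 5 (by simp)]; exact h5 v
  rintro s₃ t₃ ⟨hs₃, h5₃, ht₃⟩
  have hg₃ := hg₂.of_sameExcept hs₃ (by simp) (by simp)
  have hG₃ : ∀ v : Fin n, s₃.arr 6 v = s₃.reg 7 ↔ v ∈ G := by
    rw [hs₃.arr 6 (by simp), hs₃.reg 7 (by simp)]; exact hG₂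
  refine (attrFinish_spec hd hg₃.reg_n hG₃ h5₃).mono ?_
  rintro s₄ t₄ ⟨hs₄, h5₄, ht₄⟩
  refine ⟨(((hs₁.trans hs₂).trans hs₃).trans hs₄).mono (by simp) (by simp), h5₄, by omega⟩

end

/-! ### Machine states and their elementary transitions -/

/-- A stack of triples in the arrays `7`, `8`, `9`, the top at the end. -/
def StackAt (s : Store) : List (ℕ × ℕ × ℕ) → Prop
  | [] => True
  | x :: l => s.arr 7 l.length = x.1 ∧ s.arr 8 l.length = x.2.1 ∧ s.arr 9 l.length = x.2.2 ∧
      StackAt s l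

theorem StackAt.congr {s s' : Store} {l : List (ℕ × ℕ × ℕ)} (h : StackAt s l)
    (h' : ∀ j < l.length, s'.arr 7 j = s.arr 7 j ∧ s'.arr 8 j = s.arr 8 j ∧
      s'.arr 9 j = s.arr 9 j) : StackAt s' l := by
  induction l with
  | nil => trivial
  | cons x l ih =>
    obtain ⟨h1, h2, h3, h4⟩ := h
    obtain ⟨e1, e2, e3⟩ := h' l.length (by simp)
    exact ⟨by rw [e1, h1], by rw [e2, h2], by rw [e3, h3],
      ih h4 fun j hj => h' j (by rw [List.length_cons]; omega)⟩

/-- The data that determine the rest of the execution. The frames of pending calls for the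
opponent are not on the stack: there are `level` of them, and `rank v` is the number of those
whose vertex set contains `v`. -/
structure Machine (n : ℕ) where
  player : Player
  maxPrio : ℕ
  ownPrec : ℕ
  oppPrec : ℕ
  level : ℕ
  mode : ℕ
  set : Finset (Fin n)
  rank : Fin n → ℕ
  stack : List (ℕ × ℕ × ℕ)

/-- The store represents the machine state `x`. -/
structure Represents {n : ℕ} (𝒢 : ParityGame (Fin n)) (m : ℕ) (src tgt : ℕ → Fin n)
    (x : Machine n) (s : Store) : Prop where
  game : GameStore 𝒢 m src tgt s
  player : s.reg 3 = x.player.code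
  maxPrio : s.reg 4 = x.maxPrio
  ownPrec : s.reg 5 = x.ownPrec
  oppPrec : s.reg 6 = x.oppPrec
  level : s.reg 7 = x.level
  height : s.reg 8 = x.stack.length
  mode : s.reg 9 = x.mode
  set : s.ShowsSet 5 x.set
  rank : ∀ v : Fin n, s.arr 6 v = x.rank v
  stack : StackAt s x.stack

/-- Pushes a frame of the given kind and halves the precision of the opponent. -/
def pushFrame (kind : ℕ) : Prog :=
  .seq (.write 7 (.reg 8) (.reg 7)) (.seq (.write 8 (.reg 8) (.reg 6))
    (.seq (.write 9 (.reg 8) (.const kind)) (.seq (.set 8 (.add (.reg 8) (.const 1)))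
      (.seq (.set 6 (.div (.reg 6) (.const 2))) (.set 9 (.const 0))))))

/-- Sets register `12` to `1` if the set in array `5` is nonempty. -/
def testEmpty : Prog :=
  .seq (.set 12 (.const 0))
    (forLoop 10 0 (.ite (.eq (.read 5 (.reg 10)) (.const 1)) (.set 12 (.const 1)) skip))

/-- Starts the execution of a call. -/
def callStep : Prog :=
  .seq testEmpty
    (.ite (.lt (.const 0) (.reg 4))
      (.ite (.lt (.const 1) (.reg 6))
        (.ite (.reg 12) (pushFrame 0) (.set 9 (.const 1)))
        (.set 9 (.const 1)))
      (.set 9 (.const 1)))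

/-- Exchanges the players and their precisions. -/
def swapPlayers : Prog :=
  .seq (.set 3 (.sub (.const 1) (.reg 3)))
    (.seq (.set 11 (.reg 5)) (.seq (.set 5 (.reg 6)) (.set 6 (.reg 11))))

/-- Raises the rank of the current vertices and restricts array `5` to the highest priority. -/
def raiseRank : Prog :=
  .seq (.set 7 (.add (.reg 7) (.const 1)))
    (forLoop 10 0 (.ite (.eq (.read 5 (.reg 10)) (.const 1))
      (.seq (.write 6 (.reg 10) (.reg 7))
        (.write 5 (.reg 10) (.eq (.read 1 (.reg 10)) (.reg 4))))
      skip))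

/-- Lowers the rank of the vertices of the highest rank. -/
def lowerRank : Prog :=
  .seq (forLoop 10 0 (.ite (.eq (.read 6 (.reg 10)) (.reg 7))
      (.write 6 (.reg 10) (.sub (.reg 7) (.const 1))) skip))
    (.set 7 (.sub (.reg 7) (.const 1)))

/-- Starts the call for the opponent. -/
def startMiddle : Prog :=
  .seq raiseRank (.seq removeAttr
    (.seq (.set 4 (.sub (.reg 4) (.const 1))) (.seq swapPlayers (.set 9 (.const 0)))))

/-- Processes the result of the call for the opponent. -/
def finishMiddle : Prog :=
  .seq removeAttr (.seq lowerRank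
    (.seq (.set 4 (.add (.reg 4) (.const 1))) (.seq swapPlayers (pushFrame 1))))

/-- Processes the result of a call that has no frame on the stack. -/
def popMiddle : Prog := .ite (.lt (.const 0) (.reg 7)) finishMiddle (.set 9 (.const 2))

/-- Processes the result of a call that has a frame on the stack. -/
def popFrame : Prog :=
  .seq (.set 8 (.sub (.reg 8) (.const 1))) (.seq (.set 6 (.read 8 (.reg 8)))
    (.ite (.eq (.read 9 (.reg 8)) (.const 0)) startMiddle skip))

/-- Processes the result of a call. -/
def returnStep : Prog :=
  .ite (.lt (.const 0) (.reg 8))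
    (.ite (.eq (.read 7 (.sub (.reg 8) (.const 1))) (.reg 7)) popFrame popMiddle)
    popMiddle

section

variable {n m M W : ℕ} {s : Store} {S G : Finset (Fin n)} {𝒢 : ParityGame (Fin n)}
  {src tgt : ℕ → Fin n} {P : Player} {x : Machine n}

/-- Registers above `9` and arrays above `11` are scratch space. -/
theorem Represents.of_sameExcept {s' : Store} {R A : List ℕ} (h : Represents 𝒢 m src tgt x s)
    (hs : s.SameExcept R A s') (hR : ∀ r ∈ R, 9 < r) (hA : ∀ a ∈ A, 11 < a) :
    Represents 𝒢 m src tgt x s' := by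
  have hr : ∀ r ≤ 9, s'.reg r = s.reg r := fun r hr => hs.reg r fun h' => by
    have := hR r h'; omega
  have ha : ∀ a ≤ 11, s'.arr a = s.arr a := fun a ha => hs.arr a fun h' => by
    have := hA a h'; omega
  refine ⟨h.game.of_sameExcept hs ?_ ?_, ?_, ?_, ?_, ?_, ?_, ?_, ?_, ?_, ?_, ?_⟩
  · exact ⟨fun h' => by have := hR _ h'; omega, fun h' => by have := hR _ h'; omega⟩
  · refine ⟨?_, ?_, ?_, ?_, ?_, ?_⟩ <;> intro h' <;> have := hA _ h' <;> omega
  · rw [hr 3 (by omega), h.player]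
  · rw [hr 4 (by omega), h.maxPrio]
  · rw [hr 5 (by omega), h.ownPrec]
  · rw [hr 6 (by omega), h.oppPrec]
  · rw [hr 7 (by omega), h.level]
  · rw [hr 8 (by omega), h.height]
  · rw [hr 9 (by omega), h.mode]
  · intro v; rw [ha 5 (by omega)]; exact h.set v
  · intro v; rw [ha 6 (by omega)]; exact h.rank v
  · exact h.stack.congr fun j _ => by
      rw [ha 7 (by omega), ha 8 (by omega), ha 9 (by omega)]; exact ⟨rfl, rfl, rfl⟩

theorem testEmpty_spec (hd : Dims n m M W) (h0 : s.reg 0 = n) (h5 : s.ShowsSet 5 S) :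
    Wp M W testEmpty (fun s' t => s.SameExcept [10, 11, 12] [] s' ∧
      (s'.reg 12 = 0 ↔ S = ∅) ∧ t ≤ 50 * (n + 1)) s := by
  have hn := hd.n_le
  have hnW := hd.n_lt
  have hW := hd.W_gt
  have hW1 : 1 < W := by omega
  refine Wp.seq (R := fun s' t => s' = s.setReg 12 0 ∧ t = 2) (.of_vc hW1 (by
    simp [vc, Expr.Ok, Expr.val, Expr.cost]; omega)) ?_
  rintro _ _ ⟨rfl, rfl⟩
  refine Wp.forLoop hW1 (N := n) (B := 30)
    (fun i s' => s.SameExcept [10, 11, 12] [] s' ∧ s'.reg 10 = i ∧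
      (s'.reg 12 = 0 ↔ ∀ v : Fin n, v < i → v ∉ S)) (by omega) ?_ ?_ ?_ ?_
  · rintro i s' ⟨h1, h2, -⟩
    exact ⟨h2, by rw [h1.reg 0 (by simp), h0]⟩
  · exact ⟨by simp [Store.SameExcept.refl], by simp, by simp⟩
  · rintro i s₁ hi ⟨h1, h2, h3⟩
    have e5 := h1.arr 5 (by simp)
    have h5i := h5 ⟨i, hi⟩
    simp only [] at h5i
    refine .of_vc hW1 ?_
    simp [vc, Expr.Ok, Expr.val, Expr.cost, skip, h1, h2, e5, h5i, h3]
    refine ⟨by omega, fun hm => ⟨by omega, ⟨i, hi⟩, le_rfl, hm⟩, fun hm => ⟨by omega,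
      fun hall v hv => ?_, fun hall v hv => hall v hv.le⟩⟩
    rcases hv.lt_or_eq with hv | hv
    · exact hall v hv
    · rwa [(Fin.ext hv : v = ⟨i, hi⟩)]
  · rintro s' t ⟨h1, h2, h3⟩ ht
    refine ⟨h1, h3.trans ?_, by omega⟩
    rw [Finset.eq_empty_iff_forall_notMem]
    exact ⟨fun h v => h v v.2, fun h v _ => h v⟩

theorem Represents.push {kind : ℕ} {q L : ℕ} {s' : Store} {r : ℕ}
    (h : Represents 𝒢 m src tgt x s) (hs : s' = (((((s.setArr 7 r L).setArr 8 r q).setArr 9 r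
      kind).setReg 8 (r + 1)).setReg 6 (q / 2)).setReg 9 0) (hr : r = x.stack.length) :
    Represents 𝒢 m src tgt { x with
      oppPrec := q / 2, mode := 0, stack := (L, q, kind) :: x.stack } s' := by
  subst hs hr
  refine ⟨h.game.of_sameExcept (R := [6, 8, 9]) (A := [7, 8, 9]) (by
    simp [Store.SameExcept.refl]) (by simp) (by simp), ?_, ?_, ?_, ?_, ?_, ?_, ?_, ?_, ?_, ?_⟩
  · simp [h.player]
  · simp [h.maxPrio]
  · simp [h.ownPrec]
  · simp
  · simp [h.level]
  · simp
  · simp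
  · exact fun v => by simpa using h.set v
  · exact fun v => by simpa using h.rank v
  · refine ⟨by simp, by simp, by simp, h.stack.congr fun j hj => ?_⟩
    simp [hj.ne]

theorem callStep_leaf (hd : Dims n m M W) (h : Represents 𝒢 m src tgt x s)
    (hleaf : x.maxPrio = 0 ∨ x.set = ∅ ∨ x.oppPrec ≤ 1) :
    Wp M W callStep (fun s' t => Represents 𝒢 m src tgt { x with mode := 1 } s' ∧
      t ≤ 100 * (n + 1)) s := by
  have hW := hd.W_gt
  have hW1 : 1 < W := by omega
  refine (testEmpty_spec hd h.game.reg_n h.set).seq ?_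
  rintro s₁ t₁ ⟨hs₁, h12, ht₁⟩
  have h₁ := h.of_sameExcept hs₁ (by simp) (by simp)
  have hret : Represents 𝒢 m src tgt { x with mode := 1 } (s₁.setReg 9 1) := by
    refine ⟨h₁.game.of_sameExcept (R := [9]) (A := []) (by simp [Store.SameExcept.refl]) (by simp)
      (by simp), ?_, ?_, ?_, ?_, ?_, ?_, ?_, ?_, ?_, ?_⟩
    · simp [h₁.player]
    · simp [h₁.maxPrio]
    · simp [h₁.ownPrec]
    · simp [h₁.oppPrec]
    · simp [h₁.level]
    · simp [h₁.height]
    · simp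
    · exact fun v => by simpa using h₁.set v
    · exact fun v => by simpa using h₁.rank v
    · exact h₁.stack.congr fun j hj => by simp
  refine .of_vc hW1 ?_
  simp [vc, Expr.Ok, Expr.val, Expr.cost, h₁.maxPrio, h₁.oppPrec, h12, hret]
  refine ⟨by omega, fun h1 => ⟨by omega, fun h2 => ⟨fun h3 => ?_, fun _ => ?_⟩, fun _ => ?_⟩,
    fun _ => ?_⟩ <;> try omega
  rcases hleaf with h4 | h4 | h4
  · omega
  · exact absurd h4 h3
  · omega

theorem callStep_push (hd : Dims n m M W) (h : Represents 𝒢 m src tgt x s)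
    (h1 : x.maxPrio ≠ 0) (h2 : ¬ (x.set = ∅ ∨ x.oppPrec ≤ 1)) (hM : x.stack.length < M)
    (hMW : M + 1 < W) :
    Wp M W callStep (fun s' t => Represents 𝒢 m src tgt { x with
      oppPrec := x.oppPrec / 2, mode := 0, stack := (x.level, x.oppPrec, 0) :: x.stack } s' ∧
      t ≤ 100 * (n + 1)) s := by
  have hW := hd.W_gt
  have hW1 : 1 < W := by omega
  refine (testEmpty_spec hd h.game.reg_n h.set).seq ?_
  rintro s₁ t₁ ⟨hs₁, h12, ht₁⟩
  have h₁ := h.of_sameExcept hs₁ (by simp) (by simp)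
  have hpush := h₁.push (kind := 0) (q := x.oppPrec) (L := x.level) rfl rfl
  refine .of_vc hW1 ?_
  simp [vc, Expr.Ok, Expr.val, Expr.cost, pushFrame, h₁.maxPrio, h₁.oppPrec, h12, h₁.height,
    h₁.level, hpush, h1]
  push Not at h2
  refine ⟨by omega, by omega, fun _ => ⟨fun _ => by omega, fun h3 => ?_⟩, fun _ => by omega⟩
  exact absurd h3 h2.1.ne_empty

/-- Exchanging the players. -/
theorem swapPlayers_spec (hW : 20 < W) (h : Represents 𝒢 m src tgt x s) :
    Wp M W swapPlayers (fun s' t => Represents 𝒢 m src tgt { x with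
      player := x.player.opp, ownPrec := x.oppPrec, oppPrec := x.ownPrec } s' ∧ t ≤ 20) s := by
  refine .of_vc (by omega) ?_
  simp [vc, swapPlayers, Expr.Ok, Expr.val, Expr.cost]
  refine ⟨by omega, h.game.of_sameExcept (R := [3, 5, 6, 11]) (A := []) (by
    simp [Store.SameExcept.refl]) (by simp) (by simp), ?_, ?_, ?_, ?_, ?_, ?_, ?_, ?_, ?_, ?_⟩
  · simp [h.player]
    cases x.player <;> simp [Player.opp, Player.code]
  · simp [h.maxPrio]
  · simp [h.oppPrec]
  · simp [h.ownPrec]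
  · simp [h.level]
  · simp [h.height]
  · simp [h.mode]
  · exact fun v => by simpa using h.set v
  · exact fun v => by simpa using h.rank v
  · exact h.stack.congr fun j hj => by simp

theorem raiseRank_spec (hd : Dims n m M W) (h : Represents 𝒢 m src tgt x s)
    (hL : x.level + 1 < W) :
    Wp M W raiseRank (fun s' t => Represents 𝒢 m src tgt { x with
      level := x.level + 1, set := x.set.filter fun v => 𝒢.prio v = x.maxPrio
      rank := fun v => if v ∈ x.set then x.level + 1 else x.rank v } s' ∧ t ≤ 60 * (n + 1)) s := by
  have hn := hd.n_le
  have hnW := hd.n_lt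
  have hW := hd.W_gt
  have hW1 : 1 < W := by omega
  refine Wp.seq (R := fun s' t => s' = s.setReg 7 (x.level + 1) ∧ t = 4) (.of_vc hW1 (by
    simp [vc, Expr.Ok, Expr.val, Expr.cost, h.level]; omega)) ?_
  rintro _ _ ⟨rfl, rfl⟩
  refine Wp.forLoop hW1 (N := n) (B := 40)
    (fun i s' => s.SameExcept [7, 10, 11] [5, 6] s' ∧ s'.reg 10 = i ∧ s'.reg 7 = x.level + 1 ∧
      (∀ v : Fin n, s'.arr 5 v = if v ∈ x.set then
        (if (v : ℕ) < i then (if 𝒢.prio v = x.maxPrio then 1 else 0) else 1) else 0) ∧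
      (∀ v : Fin n, s'.arr 6 v = if v ∈ x.set ∧ (v : ℕ) < i then x.level + 1 else x.rank v))
    (by omega) ?_ ?_ ?_ ?_
  · rintro i s' ⟨h1, h2, -⟩
    exact ⟨h2, by rw [h1.reg 0 (by simp), h.game.reg_n]⟩
  · refine ⟨by simp [Store.SameExcept.refl], by simp, by simp, fun v => ?_, fun v => ?_⟩
    · simpa using h.set v
    · simpa using h.rank v
  · rintro i s₁ hi ⟨h1, h2, h3, h4, h5⟩
    have e1 := h1.arr 1 (by simp)
    have e4 := h1.reg 4 (by simp)
    have hp := h.game.prio_eq ⟨i, hi⟩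
    have h4i := h4 ⟨i, hi⟩
    have h5i := h5 ⟨i, hi⟩
    simp only [lt_irrefl, if_false, and_false] at h4i h5i hp
    refine .of_vc hW1 ?_
    simp [vc, Expr.Ok, Expr.val, Expr.cost, skip, h1, h2, h3, h4i, e1, e4, hp, h.maxPrio]
    refine ⟨by omega, fun hm => ⟨by omega, fun v => ?_, fun v => ?_⟩,
      fun hm => ⟨by omega, fun v => ?_, fun v => ?_⟩⟩
    all_goals
      by_cases hvi : (v : ℕ) = i
      · obtain rfl : v = ⟨i, hi⟩ := Fin.ext hvi
        simp [hm, h4i, h5i]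
      · have hlt : (v : ℕ) ≤ i ↔ (v : ℕ) < i := by omega
        simp [hvi, h4, h5, hlt]
  · rintro s' t ⟨h1, h2, h3, h4, h5⟩ ht
    refine ⟨⟨h.game.of_sameExcept h1 (by simp) (by simp), ?_, ?_, ?_, ?_, ?_, ?_, ?_, ?_, ?_, ?_⟩,
      by omega⟩
    · rw [h1.reg 3 (by simp), h.player]
    · rw [h1.reg 4 (by simp), h.maxPrio]
    · rw [h1.reg 5 (by simp), h.ownPrec]
    · rw [h1.reg 6 (by simp), h.oppPrec]
    · rw [h3]
    · rw [h1.reg 8 (by simp), h.height]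
    · rw [h1.reg 9 (by simp), h.mode]
    · intro v
      rw [h4 v, if_pos v.2]
      by_cases hm : v ∈ x.set <;> simp [hm]
    · intro v
      rw [h5 v]
      simp
    · exact h.stack.congr fun j _ => by
        rw [h1.arr 7 (by simp), h1.arr 8 (by simp), h1.arr 9 (by simp)]; exact ⟨rfl, rfl, rfl⟩

theorem lowerRank_spec (hd : Dims n m M W) (h : Represents 𝒢 m src tgt x s) :
    Wp M W lowerRank (fun s' t => Represents 𝒢 m src tgt { x with
      level := x.level - 1
      rank := fun v => if x.rank v = x.level then x.level - 1 else x.rank v } s' ∧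
      t ≤ 60 * (n + 1)) s := by
  have hn := hd.n_le
  have hnW := hd.n_lt
  have hW := hd.W_gt
  have hW1 : 1 < W := by omega
  refine Wp.seq (R := fun s' t => Represents 𝒢 m src tgt { x with
    rank := fun v => if x.rank v = x.level then x.level - 1 else x.rank v } s' ∧
      t ≤ 50 * (n + 1)) ?_ ?_
  · refine Wp.forLoop hW1 (N := n) (B := 40)
      (fun i s' => s.SameExcept [10, 11] [6] s' ∧ s'.reg 10 = i ∧
        (∀ v : Fin n, s'.arr 6 v =
          if (v : ℕ) < i ∧ x.rank v = x.level then x.level - 1 else x.rank v))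
      (by omega) ?_ ?_ ?_ ?_
    · rintro i s' ⟨h1, h2, -⟩
      exact ⟨h2, by rw [h1.reg 0 (by simp), h.game.reg_n]⟩
    · refine ⟨by simp [Store.SameExcept.refl], by simp, fun v => ?_⟩
      simpa using h.rank v
    · rintro i s₁ hi ⟨h1, h2, h3⟩
      have e7 := h1.reg 7 (by simp)
      have h3i := h3 ⟨i, hi⟩
      simp only [lt_irrefl, if_false, false_and] at h3i
      refine .of_vc hW1 ?_
      simp [vc, Expr.Ok, Expr.val, Expr.cost, skip, h1, h2, h3i, e7, h.level]
      refine ⟨by omega, fun hm => ⟨by omega, by omega, fun v => ?_⟩,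
        fun hm => ⟨by omega, fun v => ?_⟩⟩
      all_goals
        by_cases hvi : (v : ℕ) = i
        · obtain rfl : v = ⟨i, hi⟩ := Fin.ext hvi
          simp [hm, h3i]
        · have hlt : (v : ℕ) ≤ i ↔ (v : ℕ) < i := by omega
          simp [hvi, h3, hlt]
    · rintro s' t ⟨h1, h2, h3⟩ ht
      refine ⟨⟨h.game.of_sameExcept h1 (by simp) (by simp), ?_, ?_, ?_, ?_, ?_, ?_, ?_, ?_, ?_,
        ?_⟩, by omega⟩
      · rw [h1.reg 3 (by simp), h.player]
      · rw [h1.reg 4 (by simp), h.maxPrio]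
      · rw [h1.reg 5 (by simp), h.ownPrec]
      · rw [h1.reg 6 (by simp), h.oppPrec]
      · rw [h1.reg 7 (by simp), h.level]
      · rw [h1.reg 8 (by simp), h.height]
      · rw [h1.reg 9 (by simp), h.mode]
      · intro v; rw [h1.arr 5 (by simp)]; exact h.set v
      · intro v
        rw [h3 v]
        simp
      · exact h.stack.congr fun j _ => by
          rw [h1.arr 7 (by simp), h1.arr 8 (by simp), h1.arr 9 (by simp)]; exact ⟨rfl, rfl, rfl⟩
  · rintro s₁ t₁ ⟨h₁, ht₁⟩
    refine .of_vc hW1 ?_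
    simp [vc, Expr.Ok, Expr.val, Expr.cost]
    refine ⟨by omega, ⟨h₁.game.of_sameExcept (R := [7]) (A := []) (by
      simp [Store.SameExcept.refl]) (by simp) (by simp), ?_, ?_, ?_, ?_, ?_, ?_, ?_, ?_, ?_, ?_⟩,
      by omega⟩
    · simp [h₁.player]
    · simp [h₁.maxPrio]
    · simp [h₁.ownPrec]
    · simp [h₁.oppPrec]
    · simp [h₁.level]
    · simp [h₁.height]
    · simp [h₁.mode]
    · exact fun v => by simpa using h₁.set v
    · exact fun v => by simpa using h₁.rank v
    · exact h₁.stack.congr fun j hj => by simp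

theorem removeAttr_represents (hd : Dims n m M W) (h : Represents 𝒢 m src tgt x s)
    (hE : ∀ u w, (u, w) ∈ 𝒢.edges ↔ ∃ i < m, src i = u ∧ tgt i = w)
    (hG : ∀ v, x.rank v = x.level ↔ v ∈ G) (hsub : 𝒢.IsSubgame G) (hSG : x.set ⊆ G) :
    Wp M W removeAttr (fun s' t => Represents 𝒢 m src tgt { x with
      set := G \ 𝒢.attr x.player x.set G } s' ∧ t ≤ 300 * (n + m + 1)) s := by
  refine (removeAttr_spec (G := G) hd h.game hE (fun v => ?_) h.player hsub hSG h.set).mono ?_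
  · rw [h.rank, h.level]; exact hG v
  · rintro s' t ⟨h1, h2, ht⟩
    refine ⟨⟨h.game.of_sameExcept h1 (by simp) (by simp), ?_, ?_, ?_, ?_, ?_, ?_, ?_, ?_, ?_, ?_⟩,
      ht⟩
    · rw [h1.reg 3 (by simp), h.player]
    · rw [h1.reg 4 (by simp), h.maxPrio]
    · rw [h1.reg 5 (by simp), h.ownPrec]
    · rw [h1.reg 6 (by simp), h.oppPrec]
    · rw [h1.reg 7 (by simp), h.level]
    · rw [h1.reg 8 (by simp), h.height]
    · rw [h1.reg 9 (by simp), h.mode]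
    · exact h2
    · intro v; rw [h1.arr 6 (by simp)]; exact h.rank v
    · exact h.stack.congr fun j _ => by
        rw [h1.arr 7 (by simp), h1.arr 8 (by simp), h1.arr 9 (by simp)]; exact ⟨rfl, rfl, rfl⟩

theorem setMaxPrio_spec (h : Represents 𝒢 m src tgt x s) (d : ℕ) :
    Represents 𝒢 m src tgt { x with maxPrio := d } (s.setReg 4 d) := by
  refine ⟨h.game.of_sameExcept (R := [4]) (A := []) (by simp [Store.SameExcept.refl]) (by simp)
    (by simp), ?_, ?_, ?_, ?_, ?_, ?_, ?_, ?_, ?_, ?_⟩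
  · simp [h.player]
  · simp
  · simp [h.ownPrec]
  · simp [h.oppPrec]
  · simp [h.level]
  · simp [h.height]
  · simp [h.mode]
  · exact fun v => by simpa using h.set v
  · exact fun v => by simpa using h.rank v
  · exact h.stack.congr fun j hj => by simp

theorem setMode_spec (h : Represents 𝒢 m src tgt x s) (k : ℕ) :
    Represents 𝒢 m src tgt { x with mode := k } (s.setReg 9 k) := by
  refine ⟨h.game.of_sameExcept (R := [9]) (A := []) (by simp [Store.SameExcept.refl]) (by simp)
    (by simp), ?_, ?_, ?_, ?_, ?_, ?_, ?_, ?_, ?_, ?_⟩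
  · simp [h.player]
  · simp [h.maxPrio]
  · simp [h.ownPrec]
  · simp [h.oppPrec]
  · simp [h.level]
  · simp [h.height]
  · simp
  · exact fun v => by simpa using h.set v
  · exact fun v => by simpa using h.rank v
  · exact h.stack.congr fun j hj => by simp

/-- All old ranks are at most the old level, so after the increment the vertices of top rank are
exactly those of the current set. This saves `G₁` without copying it. -/
theorem startMiddle_spec (hd : Dims n m M W) (h : Represents 𝒢 m src tgt x s)
    (hE : ∀ u w, (u, w) ∈ 𝒢.edges ↔ ∃ i < m, src i = u ∧ tgt i = w)
    (hL : x.level + 1 < W) (hrank : ∀ v, x.rank v ≤ x.level) (hsub : 𝒢.IsSubgame x.set) :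
    Wp M W startMiddle (fun s' t => Represents 𝒢 m src tgt
      { player := x.player.opp, maxPrio := x.maxPrio - 1, ownPrec := x.oppPrec
        oppPrec := x.ownPrec, level := x.level + 1, mode := 0
        set := 𝒢.restSet x.player x.maxPrio x.set
        rank := fun v => if v ∈ x.set then x.level + 1 else x.rank v
        stack := x.stack } s' ∧ t ≤ 500 * (n + m + 1)) s := by
  have hW := hd.W_gt
  have hW1 : 1 < W := by omega
  refine (raiseRank_spec hd h hL).seq ?_
  rintro s₁ t₁ ⟨h₁, ht₁⟩
  refine (removeAttr_represents (G := x.set) hd h₁ hE (fun v => ?_) hsub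
    (Finset.filter_subset _ _)).seq ?_
  · simp only []
    split_ifs with hv
    · simp [hv]
    · have := hrank v
      exact ⟨fun he => by omega, fun hv' => absurd hv' hv⟩
  rintro s₂ t₂ ⟨h₂, ht₂⟩
  refine Wp.seq (R := fun s' t => s' = s₂.setReg 4 (x.maxPrio - 1) ∧ t = 4) (.of_vc hW1 (by
    simp [vc, Expr.Ok, Expr.val, Expr.cost, h₂.maxPrio]; omega)) ?_
  rintro _ _ ⟨rfl, rfl⟩
  refine (swapPlayers_spec hW (setMaxPrio_spec h₂ (x.maxPrio - 1))).seq ?_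
  rintro s₃ t₃ ⟨h₃, ht₃⟩
  refine .of_vc hW1 ⟨by simp only [Expr.Ok]; omega, setMode_spec h₃ 0, ?_⟩
  simp only [Expr.cost]
  omega

/-- The set `G` is recovered as the vertices of top rank. The caller's parameters come back by
exchanging the precisions and incrementing `maxPrio`, so the middle call needs no frame; a frame of
kind `1` is pushed for the third call. -/
theorem finishMiddle_spec (hd : Dims n m M W) (h : Represents 𝒢 m src tgt x s)
    (hE : ∀ u w, (u, w) ∈ 𝒢.edges ↔ ∃ i < m, src i = u ∧ tgt i = w)
    (hD : x.maxPrio + 1 < W) (hG : ∀ v, x.rank v = x.level ↔ v ∈ G) (hsub : 𝒢.IsSubgame G)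
    (hSG : x.set ⊆ G) (hM : x.stack.length < M) (hMW : M + 1 < W) :
    Wp M W finishMiddle (fun s' t => Represents 𝒢 m src tgt
      { player := x.player.opp, maxPrio := x.maxPrio + 1, ownPrec := x.oppPrec
        oppPrec := x.ownPrec / 2, level := x.level - 1, mode := 0
        set := G \ 𝒢.attr x.player x.set G
        rank := fun v => if x.rank v = x.level then x.level - 1 else x.rank v
        stack := (x.level - 1, x.ownPrec, 1) :: x.stack } s' ∧ t ≤ 500 * (n + m + 1)) s := by
  have hW := hd.W_gt
  have hW1 : 1 < W := by omega
  refine (removeAttr_represents (G := G) hd h hE hG hsub hSG).seq ?_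
  rintro s₁ t₁ ⟨h₁, ht₁⟩
  refine (lowerRank_spec hd h₁).seq ?_
  rintro s₂ t₂ ⟨h₂, ht₂⟩
  refine Wp.seq (R := fun s' t => s' = s₂.setReg 4 (x.maxPrio + 1) ∧ t = 4) (.of_vc hW1 (by
    simp [vc, Expr.Ok, Expr.val, Expr.cost, h₂.maxPrio]; omega)) ?_
  rintro _ _ ⟨rfl, rfl⟩
  refine (swapPlayers_spec hW (setMaxPrio_spec h₂ (x.maxPrio + 1))).seq ?_
  rintro s₃ t₃ ⟨h₃, ht₃⟩
  have hpush := h₃.push (kind := 1) (q := x.ownPrec) (L := x.level - 1) rfl rfl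
  refine .of_vc hW1 ?_
  simp [vc, Expr.Ok, Expr.val, Expr.cost, pushFrame, h₃.oppPrec, h₃.height, h₃.level]
  refine ⟨by omega, by omega, by omega, by omega, by omega, by omega, hpush, by omega⟩

end

/-! ### Returning from calls -/

section

variable {n m M W : ℕ} {s : Store} {S G : Finset (Fin n)} {𝒢 : ParityGame (Fin n)}
  {src tgt : ℕ → Fin n} {P : Player} {x : Machine n}

theorem Wp.ite (hW : 1 < W) {e : Expr} {c₁ c₂ : Prog} {Q : Store → ℕ → Prop}
    (hOk : e.Ok M W s) (h₁ : e.val s ≠ 0 → Wp M W c₁ (fun s' t => Q s' (e.cost + 1 + t)) s)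
    (h₂ : e.val s = 0 → Wp M W c₂ (fun s' t => Q s' (e.cost + 1 + t)) s) :
    Wp M W (.ite e c₁ c₂) Q s := by
  intro hs
  by_cases hv : e.val s = 0
  · obtain ⟨s', t, hr, hb, hq⟩ := h₂ hv hs
    exact ⟨s', _, .iteFalse (hOk.safe hW hs) hv hr, hb, hq⟩
  · obtain ⟨s', t, hr, hb, hq⟩ := h₁ hv hs
    exact ⟨s', _, .iteTrue (hOk.safe hW hs) hv hr, hb, hq⟩

theorem Represents.pop {L q k : ℕ} {st : List (ℕ × ℕ × ℕ)} (h : Represents 𝒢 m src tgt x s)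
    (hst : x.stack = (L, q, k) :: st) :
    Represents 𝒢 m src tgt { x with oppPrec := q, stack := st }
      ((s.setReg 8 st.length).setReg 6 q) := by
  have hs := h.stack
  rw [hst] at hs
  refine ⟨h.game.of_sameExcept (R := [6, 8]) (A := []) (by simp [Store.SameExcept.refl]) (by simp)
    (by simp), ?_, ?_, ?_, ?_, ?_, ?_, ?_, ?_, ?_, ?_⟩
  · simp [h.player]
  · simp [h.maxPrio]
  · simp [h.ownPrec]
  · simp
  · simp [h.level]
  · simp
  · simp [h.mode]
  · exact fun v => by simpa using h.set v
  · exact fun v => by simpa using h.rank v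
  · exact hs.2.2.2.congr fun j hj => by simp

/-- A top frame carrying the current level belongs to the caller of the finished call. Kind `0`
means that the middle call comes next; otherwise the caller is finished too. -/
theorem returnStep_pop {T : ℕ} (hW : 20 < W) {Q : Store → ℕ → Prop} {q k : ℕ}
    {st : List (ℕ × ℕ × ℕ)} (h : Represents 𝒢 m src tgt x s)
    (hst : x.stack = (x.level, q, k) :: st) (hM : st.length < M)
    (h₁ : k = 0 → Wp M W startMiddle (fun s' t => Q s' T ∧ t + 40 ≤ T)
      ((s.setReg 8 st.length).setReg 6 q))
    (h₂ : k ≠ 0 → Q (((s.setReg 8 st.length).setReg 6 q).setReg 11 0) T ∧ 50 ≤ T) :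
    Wp M W returnStep (fun s' t => Q s' T ∧ t ≤ T) s := by
  have hW1 : 1 < W := by omega
  have hh := h.height
  have hs := h.stack
  rw [hst] at hs hh
  obtain ⟨h7, h8, h9, -⟩ := hs
  simp only [List.length_cons] at hh h7 h8 h9
  have h0 : st.length + 1 - 1 = st.length := by omega
  refine .ite hW1 (by simp [Expr.Ok]; omega) (fun _ => ?_) (fun hv => ?_)
  swap
  · rw [Expr.val_lt_eq_zero] at hv
    simp [Expr.val, hh] at hv
  refine .ite hW1 ?_ (fun _ => ?_) (fun hv => ?_)
  · simp [Expr.Ok, Expr.val, hh]; omega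
  swap
  · simp [Expr.val, hh, h7, h.level] at hv
  refine Wp.seq (R := fun s' t => s' = s.setReg 8 st.length ∧ t = 4) (.of_vc hW1 (by
    simp [vc, Expr.Ok, Expr.val, Expr.cost, hh]; omega)) ?_
  rintro _ _ ⟨rfl, rfl⟩
  refine Wp.seq (R := fun s' t => s' = (s.setReg 8 st.length).setReg 6 q ∧ t = 3) (.of_vc hW1 (by
    simp [vc, Expr.Ok, Expr.val, Expr.cost, h8]; omega)) ?_
  rintro _ _ ⟨rfl, rfl⟩
  refine .ite hW1 ?_ (fun hv => ?_) (fun hv => ?_)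
  · simp [Expr.Ok, Expr.val]; omega
  · refine (h₁ ?_).mono fun s' t hq => ?_
    · simp [Expr.val, h9] at hv
      exact hv
    · simp only [Expr.cost]
      exact ⟨hq.1, by omega⟩
  · have hk : k ≠ 0 := by
      simp [Expr.val, h9] at hv
      exact hv
    refine .of_vc hW1 ?_
    simp only [vc, skip, Expr.Ok, Expr.val, Expr.cost]
    exact ⟨by omega, (h₂ hk).1, by have := (h₂ hk).2; omega⟩

theorem returnStep_first (hd : Dims n m M W) {q : ℕ} {st : List (ℕ × ℕ × ℕ)}
    (h : Represents 𝒢 m src tgt x s) (hst : x.stack = (x.level, q, 0) :: st)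
    (hM : st.length < M) (hE : ∀ u w, (u, w) ∈ 𝒢.edges ↔ ∃ i < m, src i = u ∧ tgt i = w)
    (hL : x.level + 1 < W) (hrank : ∀ v, x.rank v ≤ x.level) (hsub : 𝒢.IsSubgame x.set) :
    Wp M W returnStep (fun s' t => Represents 𝒢 m src tgt
      { player := x.player.opp, maxPrio := x.maxPrio - 1, ownPrec := q
        oppPrec := x.ownPrec, level := x.level + 1, mode := 0
        set := 𝒢.restSet x.player x.maxPrio x.set
        rank := fun v => if v ∈ x.set then x.level + 1 else x.rank v
        stack := st } s' ∧ t ≤ 600 * (n + m + 1)) s := by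
  refine returnStep_pop (Q := fun s' _ => Represents 𝒢 m src tgt _ s') hd.W_gt h hst hM
    (fun _ => ?_) (fun hk => absurd rfl hk)
  refine (startMiddle_spec hd (h.pop hst) hE hL hrank hsub).mono ?_
  rintro s' t ⟨h1, ht⟩
  exact ⟨h1, by omega⟩

theorem returnStep_third (hd : Dims n m M W) {q : ℕ} {st : List (ℕ × ℕ × ℕ)}
    (h : Represents 𝒢 m src tgt x s) (hst : x.stack = (x.level, q, 1) :: st)
    (hM : st.length < M) :
    Wp M W returnStep (fun s' t => Represents 𝒢 m src tgt { x with oppPrec := q, stack := st } s' ∧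
      t ≤ 600 * (n + m + 1)) s := by
  refine returnStep_pop (Q := fun s' _ => Represents 𝒢 m src tgt _ s') hd.W_gt h hst hM
    (fun hk => absurd hk one_ne_zero) (fun hk => ⟨?_, by omega⟩)
  exact (h.pop hst).of_sameExcept (R := [11]) (A := []) (by simp [Store.SameExcept.refl])
    (by simp) (by simp)

/-- Without a frame of the current level, the finished call is a middle call or the main call;
`popMiddle` tells these apart by the level. -/
theorem returnStep_of_ne {T : ℕ} (hW : 20 < W) {Q : Store → ℕ → Prop}
    (h : Represents 𝒢 m src tgt x s) (hst : ∀ y ∈ x.stack.head?, y.1 ≠ x.level)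
    (hM : x.stack.length ≤ M) (hp : Wp M W popMiddle (fun s' t => Q s' T ∧ t + 20 ≤ T) s) :
    Wp M W returnStep (fun s' t => Q s' T ∧ t ≤ T) s := by
  have hW1 : 1 < W := by omega
  have hh := h.height
  refine .ite hW1 (by simp [Expr.Ok]; omega) (fun hv => ?_) (fun hv => ?_)
  swap
  · exact hp.mono fun s' t hq => ⟨hq.1, by simp only [Expr.cost]; omega⟩
  obtain ⟨y, st, hy⟩ : ∃ y st, x.stack = y :: st := by
    rcases hxs : x.stack with _ | ⟨y, st⟩
    · rw [hxs] at hh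
      exact absurd (Expr.val_lt_eq_zero.2 (by simp [Expr.val, hh])) hv
    · exact ⟨y, st, rfl⟩
  have hs := h.stack
  rw [hy] at hs hh hst hM
  simp only [List.length_cons] at hh hM
  have h7 := hs.1
  have hne := hst y (by simp)
  refine .ite hW1 ?_ (fun hv => ?_) (fun _ => ?_)
  · simp [Expr.Ok, Expr.val, hh]; omega
  · simp [Expr.val, hh, h7, h.level] at hv
    exact absurd hv hne
  · exact hp.mono fun s' t hq => ⟨hq.1, by simp only [Expr.cost]; omega⟩

theorem returnStep_middle (hd : Dims n m M W) (h : Represents 𝒢 m src tgt x s)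
    (hst : ∀ y ∈ x.stack.head?, y.1 ≠ x.level) (hpos : 0 < x.level)
    (hE : ∀ u w, (u, w) ∈ 𝒢.edges ↔ ∃ i < m, src i = u ∧ tgt i = w)
    (hD : x.maxPrio + 1 < W) (hG : ∀ v, x.rank v = x.level ↔ v ∈ G) (hsub : 𝒢.IsSubgame G)
    (hSG : x.set ⊆ G) (hM : x.stack.length < M) (hMW : M + 1 < W) :
    Wp M W returnStep (fun s' t => Represents 𝒢 m src tgt
      { player := x.player.opp, maxPrio := x.maxPrio + 1, ownPrec := x.oppPrec
        oppPrec := x.ownPrec / 2, level := x.level - 1, mode := 0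
        set := G \ 𝒢.attr x.player x.set G
        rank := fun v => if x.rank v = x.level then x.level - 1 else x.rank v
        stack := (x.level - 1, x.ownPrec, 1) :: x.stack } s' ∧ t ≤ 600 * (n + m + 1)) s := by
  have hW := hd.W_gt
  refine returnStep_of_ne (Q := fun s' _ => Represents 𝒢 m src tgt _ s') hW h hst hM.le ?_
  refine .ite (by omega) (by simp [Expr.Ok]; omega) (fun _ => ?_) (fun hv => ?_)
  · refine (finishMiddle_spec hd h hE hD hG hsub hSG hM hMW).mono ?_
    rintro s' t ⟨h1, ht⟩
    exact ⟨h1, by simp only [Expr.cost]; omega⟩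
  · rw [Expr.val_lt_eq_zero] at hv
    simp only [Expr.val, h.level] at hv
    omega

theorem returnStep_stop (hd : Dims n m M W) (h : Represents 𝒢 m src tgt x s)
    (hst : x.stack = []) (hlevel : x.level = 0) :
    Wp M W returnStep (fun s' t => Represents 𝒢 m src tgt { x with mode := 2 } s' ∧
      t ≤ 600 * (n + m + 1)) s := by
  have hW := hd.W_gt
  refine returnStep_of_ne (Q := fun s' _ => Represents 𝒢 m src tgt _ s') hW h (by simp [hst])
    (by simp [hst]) ?_
  refine .ite (by omega) (by simp [Expr.Ok]; omega) (fun hv => ?_) (fun _ => .of_vc (by omega) ?_)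
  · exact absurd (Expr.val_lt_eq_zero.2 (by simp [Expr.val, h.level, hlevel])) hv
  · exact ⟨by simp only [Expr.Ok]; omega, setMode_spec h 2, by simp only [Expr.cost]; omega⟩

/-! ### Simulation of the recursion by the main loop -/

/-- Some iterations of a loop. -/
inductive LoopRun (M W : ℕ) (e : Expr) (c : Prog) : Store → Store → ℕ → List Store → Prop where
  | refl (s : Store) : LoopRun M W e c s s 0 []
  | step {s s₁ s₂ : Store} {t₁ t₂ : ℕ} {l₁ l₂ : List Store} (he : e.Safe M W s)
      (hv : e.val s ≠ 0) (h₁ : Run M W c s s₁ t₁ l₁) (h₂ : LoopRun M W e c s₁ s₂ t₂ l₂) :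
      LoopRun M W e c s s₂ (e.cost + 1 + t₁ + t₂) (l₁ ++ l₂)

theorem LoopRun.trans {e : Expr} {c : Prog} {s₁ s₂ s₃ : Store} {t₁ t₂ : ℕ} {l₁ l₂ : List Store}
    (h₁ : LoopRun M W e c s₁ s₂ t₁ l₁) (h₂ : LoopRun M W e c s₂ s₃ t₂ l₂) :
    LoopRun M W e c s₁ s₃ (t₁ + t₂) (l₁ ++ l₂) := by
  induction h₁ with
  | refl s => simpa using h₂
  | step he hv hr _ ih =>
    have := LoopRun.step he hv hr (ih h₂)
    rwa [← Nat.add_assoc, ← List.append_assoc] at this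

theorem LoopRun.run {e : Expr} {c : Prog} {s₁ s₂ : Store} {t : ℕ} {l : List Store}
    (h : LoopRun M W e c s₁ s₂ t l) (he : e.Safe M W s₂) (hv : e.val s₂ = 0) :
    Run M W (.while e c) s₁ s₂ (t + (e.cost + 1)) l := by
  induction h with
  | refl s => simpa using Run.whileFalse he hv
  | step he' hv' hr _ ih =>
    have := Run.whileTrue he' hv' hr (ih he hv)
    rwa [← Nat.add_assoc] at this

/-- The machine is running. -/
def guard : Expr := .lt (.reg 9) (.const 2)

/-- One step of the main loop. -/
def mainStep : Prog := .ite (.eq (.reg 9) (.const 0)) (.seq .mark callStep) returnStep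

/-- The mark precedes `callStep`, so the recorded store still shows the arguments of the call. -/
theorem loopRun_call (hW : 20 < W) (hb : s.Bounded M W) {Q : Store → Prop} {T : ℕ}
    (h9 : s.reg 9 = 0) (h : Wp M W callStep (fun s' t => Q s' ∧ t ≤ T) s) :
    ∃ s' t, LoopRun M W guard mainStep s s' t [s] ∧ s'.Bounded M W ∧ Q s' ∧ t ≤ T + 20 := by
  obtain ⟨s', t, hr, hb', hq, ht⟩ := h hb
  have hsafe : guard.Safe M W s := Expr.Ok.safe (by omega) hb (by simp [guard, Expr.Ok]; omega)
  have hsafe' : (Expr.eq (.reg 9) (.const 0)).Safe M W s :=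
    Expr.Ok.safe (by omega) hb (by simp [Expr.Ok]; omega)
  have hv : guard.val s ≠ 0 := fun h0 => by
    have := Expr.val_lt_eq_zero.1 h0
    simp [Expr.val, h9] at this
  have hv' : (Expr.eq (.reg 9) (.const 0)).val s ≠ 0 := by simp [Expr.val, h9]
  refine ⟨s', _, .step hsafe hv (.iteTrue hsafe' hv' ((Run.mark s).seq hr)) (.refl s'), hb', hq, ?_⟩
  simp only [guard, Expr.cost]
  omega

theorem loopRun_return (hW : 20 < W) (hb : s.Bounded M W) {Q : Store → Prop} {T : ℕ}
    (h9 : s.reg 9 = 1) (h : Wp M W returnStep (fun s' t => Q s' ∧ t ≤ T) s) :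
    ∃ s' t, LoopRun M W guard mainStep s s' t [] ∧ s'.Bounded M W ∧ Q s' ∧ t ≤ T + 20 := by
  obtain ⟨s', t, hr, hb', hq, ht⟩ := h hb
  have hsafe : guard.Safe M W s := Expr.Ok.safe (by omega) hb (by simp [guard, Expr.Ok]; omega)
  have hsafe' : (Expr.eq (.reg 9) (.const 0)).Safe M W s :=
    Expr.Ok.safe (by omega) hb (by simp [Expr.Ok]; omega)
  have hv : guard.val s ≠ 0 := fun h0 => by
    have := Expr.val_lt_eq_zero.1 h0
    simp [Expr.val, h9] at this
  have hv' : (Expr.eq (.reg 9) (.const 0)).val s = 0 := by simp [Expr.val, h9]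
  refine ⟨s', _, .step hsafe hv (.iteFalse hsafe' hv' hr) (.refl s'), hb', hq, ?_⟩
  simp only [guard, Expr.cost]
  omega

theorem Represents.showsCall (h : Represents 𝒢 m src tgt x s) :
    ShowsCall s ⟨x.player, x.set, x.maxPrio, x.ownPrec, x.oppPrec⟩ := by
  refine ⟨h.player, h.maxPrio, h.ownPrec, h.oppPrec, fun v => ?_⟩
  rw [h.set v]
  split_ifs with hv <;> simp [hv]

/-- Each call is allotted `2 * K` steps with `K = 700 * (n + m + 1)` and leaves `K` of its budget
unspent. The three subcalls thus hand over `3 * K`; together with the net `K` of the caller this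
pays for one start and three returns. -/
theorem time_add_le {t₁ t₂ t₃ t₄ t₅ t₆ t₇ a b c : ℕ} (c₁ : t₁ ≤ 100 * (n + 1) + 20)
    (c₂ : t₂ + 700 * (n + m + 1) ≤ 2 * a * (700 * (n + m + 1)))
    (c₃ : t₃ ≤ 600 * (n + m + 1) + 20)
    (c₄ : t₄ + 700 * (n + m + 1) ≤ 2 * b * (700 * (n + m + 1)))
    (c₅ : t₅ ≤ 600 * (n + m + 1) + 20)
    (c₆ : t₆ + 700 * (n + m + 1) ≤ 2 * c * (700 * (n + m + 1)))
    (c₇ : t₇ ≤ 600 * (n + m + 1) + 20) :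
    t₁ + (t₂ + (t₃ + (t₄ + (t₅ + (t₆ + t₇))))) + 700 * (n + m + 1) ≤
      2 * (a + (b + c) + 1) * (700 * (n + m + 1)) := by
  nlinarith [Nat.zero_le n, Nat.zero_le m]

/-- A completed call leaves everything but the set and the mode unchanged, ranks and stack included;
this is what makes the induction compose. Levels on the stack never exceed `L`, so at level `L + 1`
a returning middle call is recognized. Each pushed frame is paid for by one halving in `hroom`, and
`L + d` does not grow. -/
theorem loopRun_solve (hd : Dims n m M W)
    (hE : ∀ u w, (u, w) ∈ 𝒢.edges ↔ ∃ i < m, src i = u ∧ tgt i = w) (hMW : M + 1 < W)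
    {D : ℕ} (hDW : D + 1 < W) {P : Player} {G : Finset (Fin n)} {d p q L : ℕ} {rk : Fin n → ℕ}
    {st : List (ℕ × ℕ × ℕ)} {s : Store}
    (hG : 𝒢.IsSubgame G) (hpr : ∀ v ∈ G, 𝒢.prio v ≤ d) (hP : P = Player.ofParity d)
    (hD : L + d ≤ D) (hrk : ∀ v, rk v ≤ L) (hrkG : ∀ v ∈ G, rk v = L)
    (hst : ∀ y ∈ st.head?, y.1 ≤ L) (hroom : st.length + Nat.log 2 p + Nat.log 2 q ≤ M)
    (hb : s.Bounded M W) (hs : Represents 𝒢 m src tgt ⟨P, d, p, q, L, 0, G, rk, st⟩ s) :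
    ∃ s' t l, LoopRun M W guard mainStep s s' t l ∧ s'.Bounded M W ∧
      Represents 𝒢 m src tgt ⟨P, d, p, q, L, 1, 𝒢.solve P G d p q, rk, st⟩ s' ∧
      t + 700 * (n + m + 1) ≤ 2 * (𝒢.calls P G d p q).length * (700 * (n + m + 1)) ∧
      List.Forall₂ ShowsCall l (𝒢.calls P G d p q) := by
  have hW := hd.W_gt
  have hleaf : d = 0 ∨ G = ∅ ∨ q ≤ 1 → 𝒢.solve P G d p q = G ∧
      𝒢.calls P G d p q = [⟨P, G, d, p, q⟩] := by
    intro h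
    rcases d with _ | d
    · exact ⟨solve_zero, calls_zero⟩
    · have h' := h.resolve_left (by omega)
      exact ⟨solve_base h', calls_base h'⟩
  induction d generalizing P G p q L rk st s with
  | zero =>
    obtain ⟨h1, h2⟩ := hleaf (.inl rfl)
    obtain ⟨s', t, hr, hb', hq, ht⟩ := loopRun_call hW hb hs.mode (callStep_leaf hd hs (.inl rfl))
    refine ⟨s', t, _, hr, hb', by rw [h1]; exact hq, ?_, ?_⟩
    · rw [h2, List.length_singleton]; omega
    · rw [h2]; exact .cons hs.showsCall .nil
  | succ d ihd =>
  induction q using Nat.strong_induction_on generalizing G L rk st s with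
  | _ q ihq =>
  by_cases hbase : G = ∅ ∨ q ≤ 1
  · obtain ⟨h1, h2⟩ := hleaf (.inr hbase)
    obtain ⟨s', t, hr, hb', hq, ht⟩ :=
      loopRun_call hW hb hs.mode (callStep_leaf hd hs (.inr hbase))
    refine ⟨s', t, _, hr, hb', by rw [h1]; exact hq, ?_, ?_⟩
    · rw [h2, List.length_singleton]; omega
    · rw [h2]; exact .cons hs.showsCall .nil
  have hlog : Nat.log 2 q = Nat.log 2 (q / 2) + 1 := by
    push Not at hbase
    exact Nat.log_of_one_lt_of_le (by norm_num) (by omega)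
  have hq2 : q / 2 < q := by push Not at hbase; omega
  have hsep₁ := separates_solve (p := p) (q := q / 2) hG hpr hP
  set G₁ := 𝒢.solve P G (d + 1) p (q / 2) with hG₁
  have hG₁sub : 𝒢.IsSubgame G₁ := hsep₁.trap.isSubgame hG
  have hG₁G : G₁ ⊆ G := hsep₁.trap.subset
  have hpr₁ : ∀ v ∈ G₁, 𝒢.prio v ≤ d + 1 := fun v hv => hpr v (hG₁G hv)
  have hHtrap : 𝒢.IsTrap P G₁ (𝒢.restSet P (d + 1) G₁) := restSet_trap hG₁sub
  have hHsub := hHtrap.isSubgame hG₁sub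
  have hHpr := restSet_prio_lt (P := P) hG₁sub hpr₁
  have hP' : P.opp = Player.ofParity d := by rw [hP, Player.ofParity_succ, Player.opp_opp]
  have hsep₂ := separates_solve (p := q) (q := p) hHsub hHpr hP'
  set Z := 𝒢.solve P.opp (𝒢.restSet P (d + 1) G₁) d q p with hZ
  have hZG₁ : Z ⊆ G₁ := hsep₂.trap.subset.trans hHtrap.subset
  have hG₂trap := (attr_spec (P := P.opp) hG₁sub hZG₁).2.1
  set G₂ := G₁ \ 𝒢.attr P.opp Z G₁ with hG₂
  have hG₂G₁ : G₂ ⊆ G₁ := hG₂trap.subset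
  have hsolve := solve_step hbase hG₁.symm hZ.symm
  have hcalls := calls_step hbase hG₁.symm hZ.symm
  rw [← hG₂] at hsolve hcalls
  have hpush : st.length < M := by omega
  -- the first recursive call
  obtain ⟨s₁, t₁, r₁, b₁, q₁, c₁⟩ := loopRun_call hW hb hs.mode
    (callStep_push hd hs (Nat.succ_ne_zero d) hbase hpush hMW)
  obtain ⟨s₂, t₂, l₂, r₂, b₂, q₂, c₂, f₂⟩ := ihq (q / 2) hq2 hG hpr hD hrk hrkG
    (by simp) (by simp only [List.length_cons]; omega) b₁ q₁ (fun h => by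
      have h' := h.resolve_left (by omega)
      exact ⟨solve_base h', calls_base h'⟩)
  -- the call for the opponent
  obtain ⟨s₃, t₃, r₃, b₃, q₃, c₃⟩ := loopRun_return hW b₂ q₂.mode
    (returnStep_first hd q₂ rfl hpush hE (by simp only []; omega) hrk hG₁sub)
  simp only [Nat.add_sub_cancel] at q₃
  obtain ⟨s₄, t₄, l₄, r₄, b₄, q₄, c₄, f₄⟩ := ihd hHsub hHpr hP' (L := L + 1)
    (by omega) (fun v => by
      split_ifs
      · exact le_rfl
      · have := hrk v; omega)
    (fun v hv => by rw [← hG₁, if_pos (hHtrap.subset hv)])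
    (fun y hy => (hst y hy).trans (Nat.le_succ L)) (by omega) b₃ q₃ (fun h => by
      rcases d with _ | d
      · exact ⟨solve_zero, calls_zero⟩
      · have h' := h.resolve_left (by omega)
        exact ⟨solve_base h', calls_base h'⟩)
  -- the second recursive call
  obtain ⟨s₅, t₅, r₅, b₅, q₅, c₅⟩ := loopRun_return hW b₄ q₄.mode
    (returnStep_middle (G := G₁) hd q₄ (fun y hy => by
      have := hst y hy
      simp only []; omega) (Nat.succ_pos L) hE (by simp only []; omega) (fun v => by
      simp only [← hG₁]
      split_ifs with hv
      · simp [hv]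
      · have := hrk v
        exact ⟨fun he => by omega, fun hv' => absurd hv' hv⟩)
      hG₁sub hZG₁ hpush hMW)
  -- Raising and lowering cancel, because the vertices of `G₁ ⊆ G` had rank exactly `L`.
  have hrk' : (fun v => if (if v ∈ G₁ then L + 1 else rk v) = L + 1 then L
      else if v ∈ G₁ then L + 1 else rk v) = rk := by
    funext v
    have := hrk v
    by_cases hv : v ∈ G₁
    · simp [hv, hrkG v (hG₁G hv)]
    · have hne : rk v ≠ L + 1 := by omega
      simp [hv, hne]
  simp only [← hG₁, hrk', Player.opp_opp, Nat.add_sub_cancel] at q₅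
  obtain ⟨s₆, t₆, l₆, r₆, b₆, q₆, c₆, f₆⟩ := ihq (q / 2) hq2 (G := G₂)
    (hG₂trap.isSubgame hG₁sub) (fun v hv => hpr₁ v (hG₂G₁ hv)) hD hrk
    (fun v hv => hrkG v (hG₁G (hG₂G₁ hv)))
    (by simp) (by simp only [List.length_cons]; omega) b₅ q₅ (fun h => by
      have h' := h.resolve_left (by omega)
      exact ⟨solve_base h', calls_base h'⟩)
  obtain ⟨s₇, t₇, r₇, b₇, q₇, c₇⟩ := loopRun_return hW b₆ q₆.mode
    (returnStep_third hd q₆ rfl hpush)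
  refine ⟨s₇, _, _, r₁.trans (r₂.trans (r₃.trans (r₄.trans (r₅.trans (r₆.trans r₇))))), b₇, ?_,
    ?_, ?_⟩
  · rw [hsolve]; exact q₇
  · rw [hcalls]
    simp only [List.length_cons, List.length_append]
    exact time_add_le c₁ c₂ c₃ c₄ c₅ c₆ c₇
  · rw [hcalls]
    simp only [List.append_nil, List.nil_append, List.singleton_append]
    exact .cons hs.showsCall (List.rel_append f₂ (List.rel_append f₄ f₆))

end

/-! ### The complete program -/

/-- Sorts the edges by their targets, into linked lists. -/
def linkEdges : Prog :=
  forLoop 10 1 (.seq (.write 11 (.reg 10) (.read 10 (.read 3 (.reg 10))))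
    (.write 10 (.read 3 (.reg 10)) (.add (.reg 10) (.const 1))))

/-- Writes the arguments of the main call. -/
def loadArguments : Prog :=
  .seq (.set 3 (.sub (.reg 2) (.mul (.const 2) (.div (.reg 2) (.const 2)))))
    (.seq (.set 4 (.reg 2)) (.seq (.set 5 (.reg 0)) (.seq (.set 6 (.reg 0))
      (forLoop 10 0 (.write 5 (.reg 10) (.const 1))))))

/-- Copies the result to the output array. -/
def outputResult : Prog := forLoop 10 0 (.write 4 (.reg 10) (.read 5 (.reg 10)))

/-- The implementation of the algorithm. -/
def solver : Prog :=
  .seq loadArguments (.seq linkEdges (.seq (.while guard mainStep) outputResult))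

theorem solver_within : solver.Within 15 := by
  simp [solver, loadArguments, linkEdges, guard, mainStep, callStep, returnStep, outputResult,
    testEmpty, pushFrame, popFrame, popMiddle, startMiddle, finishMiddle, raiseRank, lowerRank,
    swapPlayers, removeAttr, attrInit, attrCount, attrLoop, attrStep, attrFinish, enqueue, skip,
    forLoop, Prog.Within, Expr.Within]

theorem code_ofParity (d : ℕ) : (Player.ofParity d).code = d - 2 * (d / 2) := by
  unfold Player.ofParity
  split_ifs <;> simp only [Player.code] <;> omega

section

variable {n m M W : ℕ} {s : Store} {𝒢 : ParityGame (Fin n)} {src tgt : ℕ → Fin n}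

theorem loadArguments_spec (hd : Dims n m M W) {d : ℕ} (h0 : s.reg 0 = n) (h2 : s.reg 2 = d)
    (hdW : d + 1 < W) :
    Wp M W loadArguments (fun s' t => s.SameExcept [3, 4, 5, 6, 10] [5] s' ∧
      s'.reg 3 = (Player.ofParity d).code ∧ s'.reg 4 = d ∧ s'.reg 5 = n ∧ s'.reg 6 = n ∧
      (∀ v : Fin n, s'.arr 5 v = 1) ∧ t ≤ 50 * (n + 1)) s := by
  have hn := hd.n_le
  have hnW := hd.n_lt
  have hW := hd.W_gt
  have hW1 : 1 < W := by omega
  refine Wp.seq (R := fun s' t => s' = s.setReg 3 (Player.ofParity d).code ∧ t = 8)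
    (.of_vc hW1 (by
      simp [vc, Expr.Ok, Expr.val, Expr.cost, h2, code_ofParity]; omega)) ?_
  rintro _ _ ⟨rfl, rfl⟩
  refine Wp.seq (R := fun s' t => s' = (s.setReg 3 (Player.ofParity d).code).setReg 4 d ∧ t = 2)
    (.of_vc hW1 (by simp [vc, Expr.Ok, Expr.val, Expr.cost, h2])) ?_
  rintro _ _ ⟨rfl, rfl⟩
  refine Wp.seq (R := fun s' t =>
    s' = ((s.setReg 3 (Player.ofParity d).code).setReg 4 d).setReg 5 n ∧ t = 2)
    (.of_vc hW1 (by simp [vc, Expr.Ok, Expr.val, Expr.cost, h0])) ?_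
  rintro _ _ ⟨rfl, rfl⟩
  refine Wp.seq (R := fun s' t =>
    s' = (((s.setReg 3 (Player.ofParity d).code).setReg 4 d).setReg 5 n).setReg 6 n ∧ t = 2)
    (.of_vc hW1 (by simp [vc, Expr.Ok, Expr.val, Expr.cost, h0])) ?_
  rintro _ _ ⟨rfl, rfl⟩
  refine Wp.forLoop hW1 (N := n) (B := 10)
    (fun i s' => s.SameExcept [3, 4, 5, 6, 10] [5] s' ∧ s'.reg 10 = i ∧
      s'.reg 3 = (Player.ofParity d).code ∧ s'.reg 4 = d ∧ s'.reg 5 = n ∧ s'.reg 6 = n ∧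
      ∀ v : Fin n, v < i → s'.arr 5 v = 1) (by omega) ?_ ?_ ?_ ?_
  · rintro i s' ⟨h1, h2, -⟩
    exact ⟨h2, by rw [h1.reg 0 (by simp), h0]⟩
  · simp [Store.SameExcept.refl]
  · rintro i s₁ hi ⟨h1, h2, h3, h4, h5, h6, h7⟩
    refine .of_vc hW1 ?_
    simp [vc, Expr.Ok, Expr.val, Expr.cost, h1, h2, h3, h4, h5, h6]
    refine ⟨by omega, by omega, fun v hv => ?_⟩
    rw [Function.update_apply]
    split_ifs with h
    · rfl
    · exact h7 v (by omega)
  · rintro s' t ⟨h1, h2, h3, h4, h5, h6, h7⟩ ht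
    exact ⟨h1, h3, h4, h5, h6, fun v => h7 v v.2, by omega⟩

theorem linkEdges_spec (hd : Dims n m M W) (h1 : s.reg 1 = m)
    (htgt : ∀ i < m, s.arr 3 i = tgt i) (h10 : ∀ v : Fin n, s.arr 10 v = 0) :
    Wp M W linkEdges (fun s' t => s.SameExcept [10] [10, 11] s' ∧
      (∀ v : Fin n, Linked (s'.arr 11) (s'.arr 10 v) (bucket tgt m v)) ∧
      t ≤ 50 * (m + 1)) s := by
  have hn := hd.n_le
  have hm := hd.m_le
  have hnW := hd.n_lt
  have hmW := hd.m_lt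
  have hW := hd.W_gt
  have hW1 : 1 < W := by omega
  refine Wp.forLoop hW1 (N := m) (B := 40)
    (fun i s' => s.SameExcept [10] [10, 11] s' ∧ s'.reg 10 = i ∧
      ∀ v : Fin n, Linked (s'.arr 11) (s'.arr 10 v) (bucket tgt i v)) (by omega) ?_ ?_ ?_ ?_
  · rintro i s' ⟨h2, h3, -⟩
    exact ⟨h3, by rw [h2.reg 1 (by simp), h1]⟩
  · exact ⟨by simp [Store.SameExcept.refl], by simp, fun v => by simp [bucket, Linked, h10]⟩
  · rintro i s₁ hi ⟨h2, h3, h4⟩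
    have e3 := h2.arr 3 (by simp)
    have hti := (tgt i).2
    refine .of_vc hW1 ?_
    simp [vc, Expr.Ok, Expr.val, Expr.cost, h2, h3, e3, htgt i hi]
    refine ⟨⟨by omega, by omega⟩, by omega, by omega, by omega, fun v => ?_⟩
    -- Cell `i` belongs to no list yet, so linking edge `i` in front of its bucket disturbs none of
    -- them.
    have hlink := (h4 v).update (i := i) (x := s₁.arr 10 (tgt i))
      fun hm => absurd (mem_bucket.1 hm).1 (lt_irrefl i)
    rw [bucket, Function.update_apply]
    by_cases hv : tgt i = v
    · subst hv
      simp only [if_true]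
      exact ⟨rfl, by simpa using hlink⟩
    · rw [if_neg hv, if_neg fun he => hv (Fin.ext he).symm]
      exact hlink
  · rintro s' t ⟨h2, h3, h4⟩ ht
    exact ⟨h2, h4, by omega⟩

theorem outputResult_spec (hd : Dims n m M W) (h0 : s.reg 0 = n) {X : Finset (Fin n)}
    (h5 : s.ShowsSet 5 X) :
    Wp M W outputResult (fun s' t => s'.ShowsSet 4 X ∧ t ≤ 50 * (n + 1)) s := by
  have hn := hd.n_le
  have hnW := hd.n_lt
  have hW := hd.W_gt
  have hW1 : 1 < W := by omega
  refine Wp.forLoop hW1 (N := n) (B := 20)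
    (fun i s' => s.SameExcept [10] [4] s' ∧ s'.reg 10 = i ∧
      ∀ v : Fin n, v < i → s'.arr 4 v = if v ∈ X then 1 else 0) (by omega) ?_ ?_ ?_ ?_
  · rintro i s' ⟨h1, h2, -⟩
    exact ⟨h2, by rw [h1.reg 0 (by simp), h0]⟩
  · simp [Store.SameExcept.refl]
  · rintro i s₁ hi ⟨h1, h2, h3⟩
    have e5 := h1.arr 5 (by simp)
    refine .of_vc hW1 ?_
    simp [vc, Expr.Ok, Expr.val, Expr.cost, h1, h2, e5]
    refine ⟨by omega, fun v hv => ?_⟩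
    rw [Function.update_apply]
    split_ifs with h hX hX
    · rw [← h, h5 v, if_pos hX]
    · rw [← h, h5 v, if_neg hX]
    · rw [h3 v (by omega), if_pos hX]
    · rw [h3 v (by omega), if_neg hX]
  · rintro s' t ⟨h1, h2, h3⟩ ht
    exact ⟨fun v => h3 v v.2, by omega⟩

/-- The simulation ends in mode `1` at level `0` with an empty stack; one more return step switches
to mode `2` and the loop stops. The spare unit in the time bound covers preprocessing, this step and
the output. -/
theorem solver_run (hd : Dims n m M W)
    (hE : ∀ u w, (u, w) ∈ 𝒢.edges ↔ ∃ i < m, src i = u ∧ tgt i = w) (hMW : M + 1 < W)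
    {d : ℕ} (hdW : d + 1 < W) (hpr : ∀ v, 𝒢.prio v ≤ d) (hroom : 2 * Nat.log 2 n ≤ M)
    (hb : s.Bounded M W) (h0 : s.reg 0 = n) (h1 : s.reg 1 = m) (h2 : s.reg 2 = d)
    (hz : ∀ r, 7 ≤ r → s.reg r = 0) (howner : ∀ v : Fin n, s.arr 0 v = (𝒢.owner v).code)
    (hprio : ∀ v : Fin n, s.arr 1 v = 𝒢.prio v) (hsrc : ∀ i < m, s.arr 2 i = src i)
    (htgt : ∀ i < m, s.arr 3 i = tgt i) (ha : ∀ a i, 4 ≤ a → s.arr a i = 0) :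
    ∃ s' t l, Run M W solver s s' t l ∧
      s'.ShowsSet 4 (𝒢.solve (Player.ofParity d) Finset.univ d n n) ∧
      List.Forall₂ ShowsCall l (𝒢.calls (Player.ofParity d) Finset.univ d n n) ∧
      t ≤ 2 * ((𝒢.calls (Player.ofParity d) Finset.univ d n n).length + 1) *
        (700 * (n + m + 1)) := by
  have hW := hd.W_gt
  obtain ⟨s₁, t₁, r₁, b₁, ⟨e₁, q3, q4, q5, q6, qset, c₁⟩⟩ := loadArguments_spec hd h0 h2 hdW hb
  obtain ⟨s₂, t₂, r₂, b₂, ⟨e₂, qlink, c₂⟩⟩ := linkEdges_spec (tgt := tgt) hd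
    (by rw [e₁.reg 1 (by simp), h1]) (by rw [e₁.arr 3 (by simp)]; exact htgt)
    (by rw [e₁.arr 10 (by simp)]; exact fun v => ha 10 v (by norm_num)) b₁
  have e := e₁.trans e₂
  have hrep : Represents 𝒢 m src tgt ⟨Player.ofParity d, d, n, n, 0, 0, Finset.univ, fun _ => 0,
      []⟩ s₂ := by
    refine ⟨⟨?_, ?_, ?_, ?_, ?_, ?_, qlink⟩, ?_, ?_, ?_, ?_, ?_, ?_, ?_, ?_, ?_, trivial⟩
    · rw [e.reg 0 (by simp), h0]
    · rw [e.reg 1 (by simp), h1]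
    · rw [e.arr 0 (by simp)]; exact howner
    · rw [e.arr 1 (by simp)]; exact hprio
    · rw [e.arr 2 (by simp)]; exact hsrc
    · rw [e.arr 3 (by simp)]; exact htgt
    · rw [e₂.reg 3 (by simp), q3]
    · rw [e₂.reg 4 (by simp), q4]
    · rw [e₂.reg 5 (by simp), q5]
    · rw [e₂.reg 6 (by simp), q6]
    · rw [e.reg 7 (by simp), hz 7 (by norm_num)]
    · rw [e.reg 8 (by simp), hz 8 (by norm_num)]; rfl
    · rw [e.reg 9 (by simp), hz 9 (by norm_num)]
    · intro v; rw [e₂.arr 5 (by simp), qset v]; simp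
    · intro v; rw [e.arr 6 (by simp), ha 6 v (by norm_num)]
  have huniv : 𝒢.IsSubgame Finset.univ := fun v _ => by
    obtain ⟨w, hw⟩ := 𝒢.total v
    exact ⟨w, Finset.mem_univ w, hw⟩
  obtain ⟨s₃, t₃, l, r₃, b₃, q₃, c₃, f₃⟩ := loopRun_solve hd hE hMW hdW huniv
    (fun v _ => hpr v) rfl (Nat.zero_add d).le (fun _ => le_rfl) (fun _ _ => rfl) (by simp)
    (by simp only [List.length_nil]; omega) b₂ hrep
  obtain ⟨s₄, t₄, r₄, b₄, q₄, c₄⟩ := loopRun_return hW b₃ q₃.mode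
    (returnStep_stop hd q₃ rfl rfl)
  have hsafe : guard.Safe M W s₄ := Expr.Ok.safe (by omega) b₄ (by simp [guard, Expr.Ok]; omega)
  have hv : guard.val s₄ = 0 := Expr.val_lt_eq_zero.2 (by
    have := q₄.mode
    simp [Expr.val, this])
  have r₅ := (r₃.trans r₄).run hsafe hv
  obtain ⟨s₆, t₆, r₆, b₆, q₆, c₆⟩ := outputResult_spec hd q₄.game.reg_n q₄.set b₄
  have r := r₁.seq (r₂.seq (r₅.seq r₆))
  simp only [List.append_nil, List.nil_append] at r
  refine ⟨s₆, _, l, r, q₆, f₃, ?_⟩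
  have hc : guard.cost = 3 := rfl
  rw [hc]
  nlinarith [Nat.zero_le n, Nat.zero_le m]

end

section

variable {n : ℕ} {𝒢 : ParityGame (Fin n)} {es : List (Fin n × Fin n)} {d : ℕ}

theorem inputStore_bounded {M W : ℕ} (hn : n < W) (hes : es.length < W) (hdW : d < W)
    (hpr : ∀ v, 𝒢.prio v ≤ d) (hW : 1 < W) : (inputStore 𝒢 es d).Bounded M W := by
  constructor
  · intro r
    simp only [inputStore]
    split_ifs <;> omega
  · intro a i _
    simp only [inputStore]
    split_ifs with _ h _ h _ h _ h
    · cases 𝒢.owner ⟨i, h⟩ <;> simp only [Player.code] <;> omega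
    · omega
    · exact (hpr _).trans_lt hdW
    · omega
    · exact (Fin.is_lt _).trans hn
    · omega
    · exact (Fin.is_lt _).trans hn
    · omega
    · omega

/-- Every vertex has an outgoing edge, so `n ≤ m`. Hence `2 * m` cells hold vertices, edges and a
stack of height at most `2 log n`, and `n + m + 1 ≤ 3 * m`, which turns `700` into `2100`. -/
theorem solver_run_inputStore (hn : 0 < n) (hpr : ∀ v, 𝒢.prio v ≤ d) (hnd : es.Nodup)
    (hes : es.toFinset = 𝒢.edges) :
    ∃ (t : ℕ) (s : Store) (l : List Store),
      Run (2 * 𝒢.edges.card) ((n + d) ^ 4) solver (inputStore 𝒢 es d) s t l ∧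
      s.ShowsSet 4 (𝒢.solve (Player.ofParity d) Finset.univ d n n) ∧
      List.Forall₂ ShowsCall l (𝒢.calls (Player.ofParity d) Finset.univ d n n) ∧
      t ≤ 2 * ((𝒢.calls (Player.ofParity d) Finset.univ d n n).length + 1) *
        (2100 * 𝒢.edges.card) ∧ 0 < 𝒢.edges.card := by
  have hm : es.length = 𝒢.edges.card := by rw [← hes, List.toFinset_card_of_nodup hnd]
  have hn2 := 𝒢.two_le_of_pos hn
  have hd1 : 1 ≤ d := (𝒢.prio_pos ⟨0, hn⟩).trans (hpr _)
  have hnm : n ≤ 𝒢.edges.card := by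
    have h : (Finset.univ : Finset (Fin n)) ⊆ 𝒢.edges.image Prod.fst := fun v _ => by
      obtain ⟨w, hw⟩ := 𝒢.total v
      exact Finset.mem_image.2 ⟨_, hw, rfl⟩
    simpa using (Finset.card_le_card h).trans Finset.card_image_le
  have hmn : 𝒢.edges.card ≤ n * n := by
    simpa using Finset.card_le_univ 𝒢.edges
  have hlog : Nat.log 2 n < n := Nat.log_lt_self 2 (by omega)
  -- Here `n ≥ 2` and `d ≥ 1` give `n + d ≥ 3`, so the fourth power exceeds all sizes and the small
  -- program constants.
  have hW : 2 * 𝒢.edges.card + (n + d) + 20 < (n + d) ^ 4 := by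
    have h3 : 3 ≤ n + d := by omega
    have h4 : n * n ≤ (n + d) * (n + d) := Nat.mul_le_mul (by omega) (by omega)
    generalize n + d = x at *
    have h9 : 9 ≤ x * x := Nat.mul_le_mul h3 h3
    have hx : 3 * x ≤ x * x := Nat.mul_le_mul_right x h3
    have hpow : x ^ 4 = (x * x) * (x * x) := by ring
    rw [hpow]
    have := Nat.mul_le_mul_right (x * x) h9
    omega
  -- The default vertex beyond the end of the list is never used, since only indices below `m`
  -- matter.
  set src : ℕ → Fin n := fun i => if h : i < es.length then es[i].1 else ⟨0, hn⟩ with hsrc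
  set tgt : ℕ → Fin n := fun i => if h : i < es.length then es[i].2 else ⟨0, hn⟩ with htgt
  have hE : ∀ u w, (u, w) ∈ 𝒢.edges ↔ ∃ i < 𝒢.edges.card, src i = u ∧ tgt i = w := by
    intro u w
    rw [← hm, ← hes, List.mem_toFinset, List.mem_iff_getElem]
    constructor
    · rintro ⟨i, hi, he⟩
      exact ⟨i, hi, by simp [hsrc, hi, he], by simp [htgt, hi, he]⟩
    · rintro ⟨i, hi, h1, h2⟩
      simp only [hsrc, htgt, hi, dif_pos] at h1 h2
      exact ⟨i, hi, Prod.ext h1 h2⟩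
  obtain ⟨s, t, l, h1, h2, h3, h4⟩ := solver_run (s := inputStore 𝒢 es d)
    (m := 𝒢.edges.card) (M := 2 * 𝒢.edges.card) (W := (n + d) ^ 4)
    ⟨by omega, by omega, by omega, by omega, by omega⟩ hE (by omega) (by omega) hpr (by omega)
    (inputStore_bounded (by omega) (by omega) (by omega) hpr (by omega))
    (by simp [inputStore]) (by simp [inputStore, hm]) (by simp [inputStore])
    (fun r hr => by
      simp only [inputStore]
      rw [if_neg (by omega), if_neg (by omega), if_neg (by omega)])
    (fun v => by simp [inputStore]) (fun v => by simp [inputStore])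
    (fun i hi => by
      rw [← hm] at hi
      simp [inputStore, hsrc, hi])
    (fun i hi => by
      rw [← hm] at hi
      simp [inputStore, htgt, hi])
    (fun a i ha => by
      simp only [inputStore]
      rw [if_neg (by omega), if_neg (by omega), if_neg (by omega), if_neg (by omega)])
  exact ⟨t, s, l, h1, h2, h3, h4.trans (Nat.mul_le_mul_left _ (by omega)), by omega⟩

end

end Ram

/-! ### The theorem -/

theorem mainTheorem1 :
    -- correctness and number of calls, in every subgame of a finite parity game
    (∀ (V : Type*) [Fintype V] [DecidableEq V] (𝒢 : ParityGame V) (G : Finset V) (d : ℕ)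
        (P : Player), 𝒢.IsSubgame G → (∀ v ∈ G, 𝒢.prio v ≤ d) → P = Player.ofParity d →
      -- the returned set separates small dominions
      (∀ p q : ℕ,
        𝒢.IsClosedIn P (𝒢.solve P G d p q) G ∧
        (∀ D : Finset V, 𝒢.IsDominion P G D → D.card ≤ p → D ⊆ 𝒢.solve P G d p q) ∧
        (∀ D : Finset V, 𝒢.IsDominion P.opp G D → D.card ≤ q →
          Disjoint (𝒢.solve P G d p q) D)) ∧
      -- with full precision, the winning regions are computed
      (𝒢.solve P G d G.card G.card = 𝒢.winRegion P G ∧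
        G \ 𝒢.solve P G d G.card G.card = 𝒢.winRegion P.opp G) ∧
      -- the number of calls
      (∀ p q ℓ : ℕ, 1 ≤ p → 1 ≤ q → ℓ = Nat.log 2 p + Nat.log 2 q →
        (𝒢.calls P G d p q).length ≤ 2 ^ (ℓ + 1) * (d + ℓ).choose ℓ - 1)) ∧
    -- complexity of the algorithm on a random access machine
    (∃ (prog : Ram.Prog) (k K : ℕ) (C : ℝ), prog.Within k ∧
      (∀ (n : ℕ) (𝒢 : ParityGame (Fin n)) (d : ℕ) (es : List (Fin n × Fin n)),
        0 < n → (∀ v, 𝒢.prio v ≤ d) → es.Nodup → es.toFinset = 𝒢.edges →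
        ∃ (M t : ℕ) (s : Ram.Store) (l : List Ram.Store),
          Ram.Run M ((n + d) ^ K) prog (Ram.inputStore 𝒢 es d) s t l ∧
          -- the program executes exactly the calls of the algorithm
          List.Forall₂ Ram.ShowsCall l (𝒢.calls (Player.ofParity d) Finset.univ d n n) ∧
          -- and outputs the set returned by the algorithm
          (∀ v : Fin n, s.arr 4 v =
            if v ∈ 𝒢.solve (Player.ofParity d) Finset.univ d n n then 1 else 0) ∧
          -- memory
          ((k + k * M : ℕ) : ℝ) ≤ C * (𝒢.edges.card + n * Real.logb 2 n) ∧
          -- time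
          (t : ℝ) ≤ C * (𝒢.edges.card *
            (n : ℝ) ^ ((4.9 : ℝ) + 2 * Real.logb 2 (1 + d / (2 * Real.logb 2 n))))) ∧
      -- the second form of the time bound
      (∃ B : ℝ, ∀ (n : ℕ) (𝒢 : ParityGame (Fin n)) (d : ℕ), 0 < n → (∀ v, 𝒢.prio v ≤ d) →
        C * (𝒢.edges.card *
            (n : ℝ) ^ ((4.9 : ℝ) + 2 * Real.logb 2 (1 + d / (2 * Real.logb 2 n))))
          ≤ (n : ℝ) ^ (B * (1 + Real.logb 2 (1 + d / Real.logb 2 n)))) ∧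
      (∀ c : ℝ, 0 < c → ∃ B : ℝ, ∀ (n : ℕ) (𝒢 : ParityGame (Fin n)) (d : ℕ), 0 < n →
        (∀ v, 𝒢.prio v ≤ d) → c * Real.logb 2 n ≤ d →
        C * (𝒢.edges.card *
            (n : ℝ) ^ ((4.9 : ℝ) + 2 * Real.logb 2 (1 + d / (2 * Real.logb 2 n))))
          ≤ (n : ℝ) ^ (B * Real.logb 2 (1 + d / Real.logb 2 n)))) := by
  refine ⟨fun V _ _ 𝒢 G d P hG hd hP => ⟨fun p q => ?_, 𝒢.solve_card_eq hG hd hP,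
    fun p q l hp hq hl => ?_⟩, Ram.solver, 15, 4, 10000, Ram.solver_within,
    fun n 𝒢 d es hn hpr hnd hes => ?_, exists_quasipolynomial_bound 10000,
    exists_quasipolynomial_bound_of_le 10000⟩
  · have hs := ParityGame.separates_solve (p := p) (q := q) hG hd hP
    exact ⟨(ParityGame.isClosedIn_iff hG).2 hs.trap,
      fun D hD hp => hs.own D ((ParityGame.isDominion_iff hG).1 hD) hp,
      fun D hD hq => hs.other D ((ParityGame.isDominion_iff hG).1 hD) hq⟩
  · have := ParityGame.length_calls_le (𝒢 := 𝒢) (P := P) (G := G) (d := d) hp hq hl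
    omega
  · obtain ⟨t, s, l, h1, h2, h3, h4, hm⟩ := Ram.solver_run_inputStore hn hpr hnd hes
    have hn2 := 𝒢.two_le_of_pos hn
    refine ⟨_, t, s, l, h1, h3, h2, ?_, ?_⟩
    · have hlog : 0 ≤ Real.logb 2 (n : ℝ) :=
        Real.logb_nonneg (by norm_num) (by exact_mod_cast hn)
      have hmR : (1 : ℝ) ≤ 𝒢.edges.card := by exact_mod_cast hm
      have := mul_nonneg (Nat.cast_nonneg (α := ℝ) n) hlog
      push_cast
      linarith
    -- The constants multiply to `2 * 2 * 2100 = 8400`, one factor `2` coming from the budget per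
    -- call and one from the bound on the number of calls; `10000` is large enough.
    · have hlen := ParityGame.length_calls_le (𝒢 := 𝒢) (P := Player.ofParity d)
        (G := Finset.univ) (d := d) hn hn (Nat.two_mul (Nat.log 2 n))
      have hbound := two_pow_mul_choose_le n d hn2
      set e := (n : ℝ) ^ ((4.9 : ℝ) + 2 * Real.logb 2 (1 + d / (2 * Real.logb 2 n)))
      have h5 := (Nat.cast_le (α := ℝ)).2 (h4.trans
        (Nat.mul_le_mul_right _ (Nat.mul_le_mul_left 2 hlen)))
      have hmR : (0 : ℝ) ≤ 𝒢.edges.card := Nat.cast_nonneg _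
      rw [Nat.cast_mul, Nat.cast_mul 2, Nat.cast_mul 2100] at h5
      have h6 := mul_le_mul_of_nonneg_left hbound hmR
      have h7 : 0 ≤ 𝒢.edges.card * e := by positivity
      push_cast at h5 h6 ⊢
      nlinarith
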